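/- Let $\gamma_0,\gamma_1$ be two simple regular $C^3$ arcs in the Euclidean plane ($C^3$ up to their end-points), parametrized by arc length $s$ from a common end-point $O$, which leave $O$ in the same direction and whose signed curvatures $\kappa_0,\kappa_1$ at $O$ are different, nonzero and of the same sign. Consider a billiard table that near $O$ is the closed region between the two arcs (a "horn"). A billiard trajectory is the path of a point particle of unit mass that moves in the table with unit speed along straight segments and is reflected elastically at the arcs; it is maximal if it is defined on $[0,T)$, $0<T\le\infty$, with collision times that do not accumulate before $T$, and cannot be continued beyond $T$. Then there is a neighborhood $U$ of $O$ such that: 1. a billiard trajectory on $[0,T)$ that stays in $U$ has only finitely many collisions, and every maximal billiard trajectory that starts in $U$ leaves $U$ (at some time before $T$) after finitely many collisions; 2. let $C=\frac12(C_0+C_1)$ be the midpoint of the centers of curvature $C_0,C_1$ of the two arcs at $O$, and let $L=\pm\det[\,p-C,\ v\,]$ be the angular momentum about $C$ of the particle at position $p$ with velocity $v$, with the sign equal to the sign of $\kappa_0$ (so that motion towards $O$ has $L<0$). There is a constant $c>0$, independent of the trajectory, such that at every non-grazing collision in $U$, at arc-length distance $s$ from $O$, one has $L_+-L_->c\,s\,(\vec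 v_-\cdot\vec n)>0$, where $\vec v_-$ is the velocity before the collision, $\vec n$ is the unit normal pointing out of the table, and $L_-,L_+$ are the angular momenta before and after the collision. -/

import Mathlib

open Set Filter Topology

noncomputable section

namespace HornBilliard

/-- The Euclidean plane. -/
abbrev Plane : Type := EuclideanSpace ℝ (Fin 2)

/-- The two-dimensional cross product `det [a b]`. -/
def cross (a b : Plane) : ℝ := a 0 * b 1 - a 1 * b 0

/-- Counterclockwise rotation by a right angle. -/
def rot (a : Plane) : Plane := !₂[-a 1, a 0]

/-- A simple regular `C^3` arc of positive length, parametrized by arc length on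
`[0, length]`; it is `C^3` up to and including its end-points. -/
structure Arc where
  length : ℝ
  length_pos : 0 < length
  toFun : ℝ → Plane
  contDiffOn : ContDiffOn ℝ 3 toFun (Icc 0 length)
  injOn : InjOn toFun (Icc 0 length)
  unit_speed : ∀ s ∈ Icc 0 length, ‖derivWithin toFun (Icc 0 length) s‖ = 1

namespace Arc

/-- The unit tangent vector at arc-length parameter `s`. -/
def tangent (A : Arc) (s : ℝ) : Plane := derivWithin A.toFun (Icc 0 A.length) s

/-- The signed curvature at arc-length parameter `s`. -/
def curvature (A : Arc) (s : ℝ) : ℝ :=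
  cross (A.tangent s) (iteratedDerivWithin 2 A.toFun (Icc 0 A.length) s)

/-- The center of the osculating circle at the initial point (for nonzero curvature). -/
def osculatingCenter (A : Arc) : Plane :=
  A.toFun 0 + (A.curvature 0)⁻¹ • rot (A.tangent 0)

/-- The points of the arc other than its initial point. -/
def carrier (A : Arc) : Set Plane := A.toFun '' Ioc 0 A.length

end Arc

/-- The two arcs bound a horn: they start at the same point, in the same direction, with
different curvatures of the same sign. -/
structure IsHorn (A : Fin 2 → Arc) : Prop where
  common_point : (A 0).toFun 0 = (A 1).toFun 0
  common_tangent : (A 0).tangent 0 = (A 1).tangent 0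
  same_sign : 0 < (A 0).curvature 0 * (A 1).curvature 0
  curvature_ne : (A 0).curvature 0 ≠ (A 1).curvature 0

/-- The tip of the horn. -/
def tip (A : Fin 2 → Arc) : Plane := (A 0).toFun 0

/-- The closed region between the initial pieces of length `δ` of the two arcs: the union of
all segments that join them and are perpendicular to the common tangent at the tip.
(For small `δ` the pieces are graphs over the tangent line, and this is the set of points
between the two graphs.) -/
def regionBetween (A : Fin 2 → Arc) (δ : ℝ) : Set Plane :=
  {p | ∃ s ∈ Icc 0 δ, ∃ t ∈ Icc 0 δ,
    inner ℝ ((A 0).toFun s - (A 1).toFun t) ((A 0).tangent 0) = 0 ∧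
      p ∈ segment ℝ ((A 0).toFun s) ((A 1).toFun t)}

/-- `Q` is a billiard table which near the tip coincides with the closed region between the two
arcs. Nothing is assumed about `Q` away from the tip. -/
def IsHornTable (A : Fin 2 → Arc) (Q : Set Plane) : Prop :=
  ∀ᶠ δ in 𝓝[>] (0 : ℝ), ∀ᶠ p in 𝓝 (tip A), p ∈ Q ↔ p ∈ regionBetween A δ

/-- Immediately after time `t` the particle moves on a straight line with velocity `u`. -/
def Outgoing (q : ℝ → Plane) (t : ℝ) (u : Plane) : Prop :=
  ∀ᶠ h in 𝓝[>] (0 : ℝ), q (t + h) = q t + h • u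

/-- Immediately before time `t` the particle moves on a straight line with velocity `w`. -/
def Incoming (q : ℝ → Plane) (t : ℝ) (w : Plane) : Prop :=
  ∀ᶠ h in 𝓝[>] (0 : ℝ), q (t - h) = q t - h • w

/-- The velocity change at the point `p`: the velocity is unchanged in the interior of the table
and is reflected elastically in the tangent line at a point of one of the arcs. No rule is
prescribed on the rest of the boundary of the table; the tip is not allowed. -/
structure VelocityRule (A : Fin 2 → Arc) (Q : Set Plane) (p w u : Plane) : Prop where
  ne_tip : p ≠ tip A
  free : p ∈ interior Q → (∀ i, p ∉ (A i).carrier) → u = w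
  reflect : ∀ i, ∀ s ∈ Ioc 0 (A i).length, p = (A i).toFun s →
    u = w - (2 * inner ℝ w (rot ((A i).tangent s))) • rot ((A i).tangent s)

/-- A billiard trajectory with unit speed in the table `Q` on the time interval `[0, T)`, where
`0 < T ≤ ∞`. Collision times cannot accumulate at a time before `T`, but they may accumulate
at `T`. -/
structure IsTrajectory (A : Fin 2 → Arc) (Q : Set Plane) (T : EReal) (q : ℝ → Plane) :
    Prop where
  pos : 0 < T
  mem : ∀ t : ℝ, 0 ≤ t → (t : EReal) < T → q t ∈ Q
  start : ∃ u : Plane, ‖u‖ = 1 ∧ Outgoing q 0 u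
  motion : ∀ t : ℝ, 0 < t → (t : EReal) < T → ∃ w u : Plane, ‖w‖ = 1 ∧ ‖u‖ = 1 ∧
    Incoming q t w ∧ Outgoing q t u ∧ VelocityRule A Q (q t) w u

/-- A billiard trajectory which cannot be continued beyond time `T`. -/
structure IsMaximalTrajectory (A : Fin 2 → Arc) (Q : Set Plane) (T : EReal) (q : ℝ → Plane) :
    Prop where
  isTrajectory : IsTrajectory A Q T q
  maximal : ∀ (T' : EReal) (q' : ℝ → Plane), IsTrajectory A Q T' q' → T ≤ T' →
    (∀ t : ℝ, 0 ≤ t → (t : EReal) < T → q' t = q t) → T' = T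

/-- The times at which the particle is on one of the two arcs (grazing contacts included). -/
def collisionTimes (A : Fin 2 → Arc) (T : EReal) (q : ℝ → Plane) : Set ℝ :=
  {t | 0 ≤ t ∧ (t : EReal) < T ∧ ∃ i, q t ∈ (A i).carrier}

/-- `n` is the unit normal at the point `(A i).toFun s` that points out of the table. -/
structure IsOutwardNormal (A : Fin 2 → Arc) (Q : Set Plane) (i : Fin 2) (s : ℝ) (n : Plane) :
    Prop where
  unit : ‖n‖ = 1
  normal : inner ℝ n ((A i).tangent s) = 0
  outward : ∀ᶠ h in 𝓝[>] (0 : ℝ), (A i).toFun s + h • n ∉ Q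

/-- The center of the middle circle: the midpoint of the two centers of curvature at the tip. -/
def middleCenter (A : Fin 2 → Arc) : Plane :=
  (1 / 2 : ℝ) • ((A 0).osculatingCenter + (A 1).osculatingCenter)

/-- The angular momentum, about the center of the middle circle, of a particle of unit mass at
`p` with velocity `v`. The sign of the curvature fixes the orientation: motion towards the tip
has negative angular momentum. -/
def angularMomentum (A : Fin 2 → Arc) (p v : Plane) : ℝ :=
  SignType.sign ((A 0).curvature 0) * cross (p - middleCenter A) v

end HornBilliard

end

/-! Put the tip at the origin and the common tangent along the x-axis, oriented so that the arcs are
graphs `f < g` with second derivatives `0 < k₁ < k₂` at 0. The center of the middle circle is `(0,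
R)` with `R = (1/k₁ + 1/k₂)/2`, hence `R k₁ < 1 < R k₂`. Therefore the impulse of either arc has a
nonnegative torque about this center, at least a constant times `x` times the size of the impulse:
the angular momentum `L` is constant in flight and never decreases at collisions
(`Flow.angMom_jump`, and with constants `Chart.angularMomentum_gain`).

The stay in the horn is bounded in time. Let `ρ` be the power of the particle with respect to the
middle circle and `m` the radial momentum; then `m² + L² = ρ + R²`, and in flight `ρ' = 2m`, `m' =
1`. Since `ρ = O(x²)`, the function `A L + ρ m / x + L x` is bounded. Its derivative in flight is at
least `m²/x + L²/R - O(x)`, hence at least `R/2`, and for a large weight `A` the jumps of `A L`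
absorb those of `ρ m / x` (`Flow.length_le`).

So a trajectory that stays near the tip has a finite final time, and by its unit speed it converges.
The limit is not the tip (`Flow.not_tendsto_tip`). Let `ℓ` be the limit of `L`. If `ℓ² < R²`, then
`m²` is bounded away from 0, and the derivative of the bounded function above beats a multiple of
`-(log x)'`, although `log x` tends to `-∞`. If `ℓ = R`, the particle finally moves away from the
tip. If `ℓ = -R`, then `L ≤ -R` throughout, the particle is outside the middle circle whenever it is
in contact, and it hits only the lower arc. There it bounces under an effective gravity `f'' v₁²`;
its energy decays at most exponentially because the third derivative is bounded, but at the tip it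
would be `O(x²)`.

At a limit point other than the tip, the product of the distance to the arc (measured vertically)
and its rate of change increases, vanishes at every contact and tends to 0; so contacts cannot
accumulate (`Flow.exists_limit_interior`). Convexity prevents accumulation at every other time, and
compactness gives finiteness. Finally, a particle that arrives at such a point with a definite
velocity can be reflected once more, so a maximal trajectory cannot end there and must leave the
neighborhood.

Collisions are never enumerated: all monotonicity statements come from the behavior immediately
before and after each single time. -/

noncomputable section

namespace HornBilliard

/-! ### A monotonicity criterion for functions with jumps -/

/-- A supremum argument on the set of `z` up to which `F` stays above `F s`. The hypothesis on the
left shows that the supremum belongs to the set, the one on the right that it can be passed. No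
continuity is needed, so upward jumps are allowed. -/
lemma monotoneOn_Ioo_of_local {F : ℝ → ℝ} {a b : ℝ}
    (hr : ∀ t ∈ Ioo a b, ∀ᶠ h in 𝓝[>] (0 : ℝ), F t ≤ F (t + h))
    (hl : ∀ t ∈ Ioo a b, ∀ᶠ h in 𝓝[>] (0 : ℝ), F (t - h) ≤ F t) :
    MonotoneOn F (Ioo a b) := by
  intro s hs t ht hst
  by_contra hlt
  set Z : Set ℝ := {z | z ∈ Icc s t ∧ ∀ z' ∈ Icc s z, F s ≤ F z'} with hZ
  have hsZ : s ∈ Z := by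
    refine ⟨⟨le_rfl, hst⟩, fun z' hz' => ?_⟩
    rw [le_antisymm hz'.2 hz'.1]
  have hbdd : BddAbove Z := ⟨t, fun z hz => hz.1.2⟩
  set m := sSup Z
  have hsm : s ≤ m := le_csSup hbdd hsZ
  have hmt : m ≤ t := csSup_le ⟨s, hsZ⟩ fun z hz => hz.1.2
  have hmab : m ∈ Ioo a b := ⟨hs.1.trans_le hsm, hmt.trans_lt ht.2⟩
  have hbelow : ∀ z, s ≤ z → z < m → F s ≤ F z := by
    intro z hsz hzm
    obtain ⟨z₁, hz₁, hlt₁⟩ := exists_lt_of_lt_csSup ⟨s, hsZ⟩ hzm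
    exact hz₁.2 z ⟨hsz, hlt₁.le⟩
  have hm : F s ≤ F m := by
    rcases hsm.eq_or_lt with h | h
    · rw [← h]
    · obtain ⟨h', h1, h2⟩ := ((hl m hmab).and
        (Ioo_mem_nhdsGT (show (0 : ℝ) < m - s by linarith))).exists
      exact (hbelow (m - h') (by linarith [h2.2]) (by linarith [h2.1])).trans h1
  have hmZ : m ∈ Z := by
    refine ⟨⟨hsm, hmt⟩, fun z hz => ?_⟩
    rcases hz.2.eq_or_lt with h | h
    · rw [h]; exact hm
    · exact hbelow z hz.1 h
  rcases hmt.eq_or_lt with h | h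
  · exact hlt (h ▸ hm)
  · obtain ⟨ε, hε, hε'⟩ := mem_nhdsGT_iff_exists_Ioo_subset.1 (hr m hmab)
    have hε0 : 0 < ε := hε
    have hpos : 0 < min (ε / 2) (t - m) := lt_min (by positivity) (by linarith)
    have hmem : m + min (ε / 2) (t - m) ∈ Z := by
      refine ⟨⟨by linarith, by linarith [min_le_right (ε / 2) (t - m)]⟩, fun z hz => ?_⟩
      rcases le_or_gt z m with h' | h'
      · exact hmZ.2 z ⟨hz.1, h'⟩
      · have h1 : z - m ∈ Ioo 0 ε :=
          ⟨by linarith, by linarith [hz.2, min_le_left (ε / 2) (t - m)]⟩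
        have h2 : F m ≤ F (m + (z - m)) := hε' h1
        rw [add_sub_cancel] at h2
        exact hm.trans h2
    linarith [le_csSup hbdd hmem]

lemma eventually_lt_of_hasDerivAt_pos {φ : ℝ → ℝ} {d : ℝ} (h : HasDerivAt φ d 0) (hd : 0 < d) :
    (∀ᶠ h in 𝓝[>] (0 : ℝ), φ 0 < φ h) ∧ ∀ᶠ h in 𝓝[>] (0 : ℝ), φ (-h) < φ 0 := by
  have key : ∀ᶠ z in 𝓝[≠] (0 : ℝ), 0 < slope φ 0 z :=
    (hasDerivAt_iff_tendsto_slope.1 h).eventually (lt_mem_nhds hd)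
  rw [eventually_nhdsWithin_iff] at key
  constructor
  · filter_upwards [key.filter_mono nhdsWithin_le_nhds, self_mem_nhdsWithin] with z hz hz0
    have hz0 : 0 < z := hz0
    have := hz hz0.ne'
    rw [slope_def_field] at this
    have h2 := (div_pos_iff_of_pos_right (by simpa using hz0)).1 this
    linarith
  · have key2 : ∀ᶠ z in 𝓝 (0 : ℝ), -z ∈ ({0}ᶜ : Set ℝ) → 0 < slope φ 0 (-z) := by
      have : Tendsto (fun z : ℝ => -z) (𝓝 0) (𝓝 0) := by
        simpa using (continuous_neg.tendsto (0 : ℝ))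
      exact this.eventually key
    filter_upwards [key2.filter_mono nhdsWithin_le_nhds, self_mem_nhdsWithin] with z hz hz0
    have hz0 : 0 < z := hz0
    have h1 := hz (by simpa using hz0.ne')
    rw [slope_def_field] at h1
    by_contra hcon
    have : (φ (-z) - φ 0) / (-z - 0) ≤ 0 :=
      div_nonpos_of_nonneg_of_nonpos (by linarith) (by linarith)
    linarith

/-- Adding `η t` makes the one-sided derivatives strictly positive, so that the local criterion
applies; then `η` tends to 0. The inequality `φ 0 ≤ F t` in `hl` permits an upward jump at `t`. -/
lemma monotoneOn_Ioo_of_oneSided {F : ℝ → ℝ} {a b : ℝ}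
    (hr : ∀ t ∈ Ioo a b, ∃ φ : ℝ → ℝ, ∃ d, 0 ≤ d ∧ HasDerivAt φ d 0 ∧ φ 0 = F t ∧
      ∀ᶠ h in 𝓝[>] (0 : ℝ), F (t + h) = φ h)
    (hl : ∀ t ∈ Ioo a b, ∃ φ : ℝ → ℝ, ∃ d, 0 ≤ d ∧ HasDerivAt φ d 0 ∧ φ 0 ≤ F t ∧
      ∀ᶠ h in 𝓝[>] (0 : ℝ), F (t - h) = φ (-h)) :
    MonotoneOn F (Ioo a b) := by
  have key : ∀ η > 0, MonotoneOn (fun t => F t + η * t) (Ioo a b) := by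
    intro η hη
    apply monotoneOn_Ioo_of_local
    · intro t ht
      obtain ⟨φ, d, hd, hφ, h0, hev⟩ := hr t ht
      have hD : HasDerivAt (fun h => φ h + η * (t + h)) (d + η * 1) 0 :=
        hφ.add (((hasDerivAt_id (0 : ℝ)).const_add t).const_mul η)
      filter_upwards [hev, (eventually_lt_of_hasDerivAt_pos hD (by linarith)).1] with h h1 h2
      rw [h1]
      simp only [add_zero, h0] at h2
      exact h2.le
    · intro t ht
      obtain ⟨φ, d, hd, hφ, h0, hev⟩ := hl t ht
      have hD : HasDerivAt (fun h => φ h + η * (t + h)) (d + η * 1) 0 :=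
        hφ.add (((hasDerivAt_id (0 : ℝ)).const_add t).const_mul η)
      filter_upwards [hev, (eventually_lt_of_hasDerivAt_pos hD (by linarith)).2] with h h1 h2
      rw [h1]
      simp only [add_zero] at h2
      rw [← sub_eq_add_neg] at h2
      linarith
  intro s hs t ht hst
  refine le_of_forall_pos_le_add fun ε hε => ?_
  have h1 := key (ε / (t - s + 1)) (div_pos hε (by linarith)) hs ht hst
  simp only at h1
  have h2 : ε / (t - s + 1) * (t - s) ≤ ε := by
    rw [div_mul_eq_mul_div, div_le_iff₀ (by linarith)]
    nlinarith
  nlinarith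

/-! ### Horns in Cartesian coordinates -/

/-- The horn `f x ≤ y ≤ g x`, `0 < x < r`, between the graphs of two convex functions, with the
estimates that hold near the tip. The center of the middle circle is `(0, R)`. -/
structure Profile where
  (f f1 f2 f3 g g1 g2 : ℝ → ℝ)
  (R c K r : ℝ)
  R_pos : 0 < R
  c_pos : 0 < c
  K_pos : 0 < K
  r_pos : 0 < r
  r_le_one : r ≤ 1
  r_le_R : r ≤ R
  K_r : K * r ≤ R / 2
  small : ((1 + 2 * R * K) / R + (1 + 2 * R * K) + (1 + 2 * R * K) ^ 2 / 4 + 2 * (1 + R) / R) * r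
    ≤ R / 2
  hf : ∀ x, 0 < x → x < r → HasDerivAt f (f1 x) x
  hf1 : ∀ x, 0 < x → x < r → HasDerivAt f1 (f2 x) x
  hf2 : ∀ x, 0 < x → x < r → HasDerivAt f2 (f3 x) x
  hg : ∀ x, 0 < x → x < r → HasDerivAt g (g1 x) x
  hg1 : ∀ x, 0 < x → x < r → HasDerivAt g1 (g2 x) x
  f_nonneg : ∀ x, 0 < x → x < r → 0 ≤ f x
  f_lt_g : ∀ x, 0 < x → x < r → f x < g x
  g_le : ∀ x, 0 < x → x < r → g x ≤ K * x ^ 2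
  f1_nonneg : ∀ x, 0 < x → x < r → 0 ≤ f1 x
  f1_le : ∀ x, 0 < x → x < r → f1 x ≤ K * x
  g1_nonneg : ∀ x, 0 < x → x < r → 0 ≤ g1 x
  g1_le : ∀ x, 0 < x → x < r → g1 x ≤ K * x
  f2_ge : ∀ x, 0 < x → x < r → c ≤ f2 x
  f2_le : ∀ x, 0 < x → x < r → f2 x ≤ K
  f3_le : ∀ x, 0 < x → x < r → |f3 x| ≤ K
  g2_pos : ∀ x, 0 < x → x < r → 0 < g2 x
  lo_torque : ∀ x, 0 < x → x < r → c * x ≤ x - (R - f x) * f1 x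
  hi_torque : ∀ x, 0 < x → x < r → c * x ≤ (R - g x) * g1 x - x
  hi_inside : ∀ x, 0 < x → x < r → x ^ 2 + g x ^ 2 - 2 * R * g x < 0

/-- The coordinates `x, y` and the velocities `u` after and `w` before time `t` of a billiard
trajectory that stays in the horn on the time interval `(a, b)`. -/
structure Flow (P : Profile) (a b : ℝ) (x y u₁ u₂ w₁ w₂ : ℝ → ℝ) : Prop where
  x_pos : ∀ t ∈ Ioo a b, 0 < x t
  x_lt : ∀ t ∈ Ioo a b, x t < P.r
  lo : ∀ t ∈ Ioo a b, P.f (x t) ≤ y t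
  hi : ∀ t ∈ Ioo a b, y t ≤ P.g (x t)
  unit_u : ∀ t ∈ Ioo a b, u₁ t ^ 2 + u₂ t ^ 2 = 1
  unit_w : ∀ t ∈ Ioo a b, w₁ t ^ 2 + w₂ t ^ 2 = 1
  right : ∀ t ∈ Ioo a b, ∀ᶠ h in 𝓝[>] (0 : ℝ), x (t + h) = x t + h * u₁ t ∧
    y (t + h) = y t + h * u₂ t ∧ u₁ (t + h) = u₁ t ∧ u₂ (t + h) = u₂ t
  left : ∀ t ∈ Ioo a b, ∀ᶠ h in 𝓝[>] (0 : ℝ), x (t - h) = x t - h * w₁ t ∧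
    y (t - h) = y t - h * w₂ t ∧ u₁ (t - h) = w₁ t ∧ u₂ (t - h) = w₂ t
  reflect_lo : ∀ t ∈ Ioo a b, y t = P.f (x t) → ∃ j, u₁ t = w₁ t - j * P.f1 (x t) ∧
    u₂ t = w₂ t + j ∧ j * (1 + P.f1 (x t) ^ 2) = -2 * (w₂ t - P.f1 (x t) * w₁ t)
  reflect_hi : ∀ t ∈ Ioo a b, y t = P.g (x t) → ∃ j, u₁ t = w₁ t - j * P.g1 (x t) ∧
    u₂ t = w₂ t + j ∧ j * (1 + P.g1 (x t) ^ 2) = -2 * (w₂ t - P.g1 (x t) * w₁ t)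
  free : ∀ t ∈ Ioo a b, P.f (x t) < y t → y t < P.g (x t) → u₁ t = w₁ t ∧ u₂ t = w₂ t

namespace Flow

variable {P : Profile} {a b : ℝ} {x y u₁ u₂ w₁ w₂ : ℝ → ℝ}

lemma mono (F : Flow P a b x y u₁ u₂ w₁ w₂) {a' b' : ℝ} (ha : a ≤ a') (hb : b' ≤ b) :
    Flow P a' b' x y u₁ u₂ w₁ w₂ := by
  have h : ∀ t ∈ Ioo a' b', t ∈ Ioo a b := fun t ht => ⟨ha.trans_lt ht.1, ht.2.trans_le hb⟩
  exact ⟨fun t ht => F.x_pos t (h t ht), fun t ht => F.x_lt t (h t ht),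
    fun t ht => F.lo t (h t ht), fun t ht => F.hi t (h t ht), fun t ht => F.unit_u t (h t ht),
    fun t ht => F.unit_w t (h t ht), fun t ht => F.right t (h t ht),
    fun t ht => F.left t (h t ht), fun t ht => F.reflect_lo t (h t ht),
    fun t ht => F.reflect_hi t (h t ht), fun t ht => F.free t (h t ht)⟩

/-- The Lyapunov principle behind all later arguments: a phase function `Φ` increases along the
trajectory if its flight derivative `D` is nonnegative for the velocities before and after each time
and no velocity change decreases it. -/
lemma monotoneOn (F : Flow P a b x y u₁ u₂ w₁ w₂) (Φ D : ℝ → ℝ → ℝ → ℝ → ℝ → ℝ)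
    (hD : ∀ t ∈ Ioo a b, ∀ v₁ v₂ : ℝ, v₁ ^ 2 + v₂ ^ 2 = 1 →
      HasDerivAt (fun h => Φ (t + h) (x t + h * v₁) (y t + h * v₂) v₁ v₂)
        (D t (x t) (y t) v₁ v₂) 0)
    (hu : ∀ t ∈ Ioo a b, 0 ≤ D t (x t) (y t) (u₁ t) (u₂ t))
    (hw : ∀ t ∈ Ioo a b, 0 ≤ D t (x t) (y t) (w₁ t) (w₂ t))
    (hj : ∀ t ∈ Ioo a b, Φ t (x t) (y t) (w₁ t) (w₂ t) ≤ Φ t (x t) (y t) (u₁ t) (u₂ t)) :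
    MonotoneOn (fun t => Φ t (x t) (y t) (u₁ t) (u₂ t)) (Ioo a b) := by
  apply monotoneOn_Ioo_of_oneSided
  · intro t ht
    refine ⟨_, _, hu t ht, hD t ht _ _ (F.unit_u t ht), by simp, ?_⟩
    filter_upwards [F.right t ht] with h hh
    obtain ⟨h1, h2, h3, h4⟩ := hh
    rw [h1, h2, h3, h4]
  · intro t ht
    refine ⟨_, _, hw t ht, hD t ht _ _ (F.unit_w t ht), by simpa using hj t ht, ?_⟩
    filter_upwards [F.left t ht] with h hh
    obtain ⟨h1, h2, h3, h4⟩ := hh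
    rw [h1, h2, h3, h4]
    simp only [neg_mul, ← sub_eq_add_neg]

/-- Strict increase just after a time at which the derivative is positive. -/
lemma exists_lt (F : Flow P a b x y u₁ u₂ w₁ w₂) (Φ : ℝ → ℝ → ℝ → ℝ → ℝ → ℝ) {t d : ℝ}
    (ht : t ∈ Ioo a b)
    (hD : HasDerivAt (fun h => Φ (t + h) (x t + h * u₁ t) (y t + h * u₂ t) (u₁ t) (u₂ t)) d 0)
    (hd : 0 < d) : ∃ t' ∈ Ioo t b, Φ t (x t) (y t) (u₁ t) (u₂ t) <
      Φ t' (x t') (y t') (u₁ t') (u₂ t') := by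
  obtain ⟨h, ⟨⟨h1, h2, h3, h4⟩, h5⟩, h6⟩ := (((F.right t ht).and
    (eventually_lt_of_hasDerivAt_pos hD hd).1).and
    (Ioo_mem_nhdsGT (show (0 : ℝ) < b - t by linarith [ht.2]))).exists
  refine ⟨t + h, ⟨by linarith [h6.1], by linarith [h6.2]⟩, ?_⟩
  rw [h1, h2, h3, h4]
  simpa using h5

end Flow

/-! ### Angular momentum, radial momentum and power with respect to the middle circle -/

/-- Angular momentum about `(0, R)`. -/
def angMom (R x y v₁ v₂ : ℝ) : ℝ := x * v₂ + (R - y) * v₁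

/-- Half the derivative of the squared distance to `(0, R)`. -/
def radMom (R x y v₁ v₂ : ℝ) : ℝ := x * v₁ + (y - R) * v₂

/-- The power of the point `(x, y)` with respect to the middle circle. -/
def circlePower (R x y : ℝ) : ℝ := x ^ 2 + y ^ 2 - 2 * R * y

lemma radMom_sq_add_angMom_sq (R x y : ℝ) {v₁ v₂ : ℝ} (hv : v₁ ^ 2 + v₂ ^ 2 = 1) :
    radMom R x y v₁ v₂ ^ 2 + angMom R x y v₁ v₂ ^ 2 = circlePower R x y + R ^ 2 := by
  have : radMom R x y v₁ v₂ ^ 2 + angMom R x y v₁ v₂ ^ 2 =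
      (circlePower R x y + R ^ 2) * (v₁ ^ 2 + v₂ ^ 2) := by
    unfold radMom angMom circlePower; ring
  rw [this, hv, mul_one]

lemma abs_le_one_of_sq_add_sq {v₁ v₂ : ℝ} (hv : v₁ ^ 2 + v₂ ^ 2 = 1) : |v₁| ≤ 1 ∧ |v₂| ≤ 1 :=
  ⟨abs_le_one_iff_mul_self_le_one.2 (by nlinarith [sq_nonneg v₂]),
    abs_le_one_iff_mul_self_le_one.2 (by nlinarith [sq_nonneg v₁])⟩

lemma hasDerivAt_line (x v : ℝ) : HasDerivAt (fun h : ℝ => x + h * v) v 0 := by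
  simpa using ((hasDerivAt_id (0 : ℝ)).mul_const v).const_add x

lemma HasDerivAt.along_line {f : ℝ → ℝ} {f' x : ℝ} (hf : HasDerivAt f f' x) (v : ℝ) :
    HasDerivAt (fun h : ℝ => f (x + h * v)) (f' * v) 0 := by
  have h : HasDerivAt f f' (x + 0 * v) := by simpa using hf
  exact h.comp (0 : ℝ) (hasDerivAt_line x v)

/-! ### The bounded function that increases at a definite rate -/

namespace Profile

variable (P : Profile)

/-- A bound for the circle power of a point at distance `x` from the tip, divided by `x ^ 2`. -/
def powerBound : ℝ := 1 + 2 * P.R * P.K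

lemma powerBound_pos : 0 < P.powerBound := by
  have := P.R_pos; have := P.K_pos
  unfold powerBound; positivity

/-- The constant of the error term in `progressDeriv_ge`. -/
def errorBound : ℝ :=
  P.powerBound / P.R + P.powerBound + P.powerBound ^ 2 / 4 + 2 * (1 + P.R) / P.R

lemma errorBound_pos : 0 < P.errorBound := by
  have := P.R_pos; have := P.powerBound_pos
  unfold errorBound; positivity

variable {P}

lemma y_bounds {x y : ℝ} (h0 : 0 < x) (h1 : x < P.r) (hf : P.f x ≤ y) (hg : y ≤ P.g x) :
    0 ≤ y ∧ y ≤ P.K * x ^ 2 ∧ y ≤ P.R / 2 := by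
  have h2 := P.g_le x h0 h1
  refine ⟨(P.f_nonneg x h0 h1).trans hf, hg.trans h2, ?_⟩
  have h3 : x ^ 2 ≤ P.r := by nlinarith [P.r_le_one]
  nlinarith [P.K_r, P.K_pos]

/-- The middle circle is tangent to the x-axis at the tip, and `0 ≤ y ≤ K x²` in the horn, so every
term of the power is of second order. -/
lemma abs_circlePower_le {x y : ℝ} (h0 : 0 < x) (h1 : x < P.r) (hf : P.f x ≤ y)
    (hg : y ≤ P.g x) : |circlePower P.R x y| ≤ P.powerBound * x ^ 2 := by
  obtain ⟨hy0, hyK, hyR⟩ := y_bounds h0 h1 hf hg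
  have hR := P.R_pos
  unfold circlePower powerBound
  rw [abs_le]
  constructor
  · nlinarith [sq_nonneg x, sq_nonneg y, mul_le_mul_of_nonneg_left hyK hR.le]
  · have : y ^ 2 ≤ 2 * P.R * y := by nlinarith
    nlinarith [mul_nonneg (mul_nonneg hR.le P.K_pos.le) (sq_nonneg x)]

lemma abs_angMom_le {x y v₁ v₂ : ℝ} (h0 : 0 < x) (h1 : x < P.r) (hf : P.f x ≤ y)
    (hg : y ≤ P.g x) (hv : v₁ ^ 2 + v₂ ^ 2 = 1) :
    |angMom P.R x y v₁ v₂| ≤ 1 + P.R ∧ |radMom P.R x y v₁ v₂| ≤ 1 + P.R := by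
  obtain ⟨hy0, hyK, hyR⟩ := y_bounds h0 h1 hf hg
  obtain ⟨hv1, hv2⟩ := abs_le_one_of_sq_add_sq hv
  have hx1 : x ≤ 1 := h1.le.trans P.r_le_one
  have hR := P.R_pos
  have aux : ∀ p q : ℝ, |p| ≤ 1 → |q| ≤ 1 → |x * p + (P.R - y) * q| ≤ 1 + P.R := by
    intro p q hp hq
    refine (abs_add_le _ _).trans ?_
    rw [abs_mul, abs_mul, abs_of_pos h0, abs_of_nonneg (show 0 ≤ P.R - y by linarith)]
    nlinarith [abs_nonneg p, abs_nonneg q]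
  refine ⟨aux v₂ v₁ hv2 hv1, ?_⟩
  have := aux v₁ (-v₂) hv1 (by rwa [abs_neg])
  rw [show radMom P.R x y v₁ v₂ = x * v₁ + (P.R - y) * -v₂ by unfold radMom; ring]
  exact this

/-- The weight of the angular momentum in `progress`. -/
def weight (P : Profile) : ℝ := P.powerBound * (P.R + P.K) / P.c

lemma weight_pos : 0 < P.weight := by
  have := P.R_pos; have := P.powerBound_pos; have := P.K_pos; have := P.c_pos
  unfold weight; positivity

/-- A bounded phase function that increases at a definite rate along trajectories. -/
def progress (P : Profile) (x y v₁ v₂ : ℝ) : ℝ :=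
  P.weight * angMom P.R x y v₁ v₂ + circlePower P.R x y * radMom P.R x y v₁ v₂ / x +
    angMom P.R x y v₁ v₂ * x

/-- The derivative of `progress` along a free flight. -/
def progressDeriv (P : Profile) (x y v₁ v₂ : ℝ) : ℝ :=
  (2 * radMom P.R x y v₁ v₂ ^ 2 + circlePower P.R x y) / x -
    circlePower P.R x y * radMom P.R x y v₁ v₂ * v₁ / x ^ 2 + angMom P.R x y v₁ v₂ * v₁

/-- In flight `L` is constant, the radial momentum has derivative `|v|² = 1`, and the circle power
has twice the radial momentum as derivative. -/
lemma hasDerivAt_progress {x y v₁ v₂ : ℝ} (h0 : 0 < x) (hv : v₁ ^ 2 + v₂ ^ 2 = 1) :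
    HasDerivAt (fun h => P.progress (x + h * v₁) (y + h * v₂) v₁ v₂)
      (P.progressDeriv x y v₁ v₂) 0 := by
  have hx := hasDerivAt_line x v₁
  have hy := hasDerivAt_line y v₂
  have hL : HasDerivAt (fun h => angMom P.R (x + h * v₁) (y + h * v₂) v₁ v₂) 0 0 := by
    have : (fun h => angMom P.R (x + h * v₁) (y + h * v₂) v₁ v₂) =
        fun _ => angMom P.R x y v₁ v₂ := by
      funext h; unfold angMom; ring
    rw [this]; exact hasDerivAt_const _ _
  have hm : HasDerivAt (fun h => radMom P.R (x + h * v₁) (y + h * v₂) v₁ v₂) 1 0 := by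
    unfold radMom
    refine ((hx.mul_const v₁).add ((hy.sub_const P.R).mul_const v₂)).congr_deriv ?_
    rw [← hv]; ring
  have hρ : HasDerivAt (fun h => circlePower P.R (x + h * v₁) (y + h * v₂))
      (2 * radMom P.R x y v₁ v₂) 0 := by
    unfold circlePower radMom
    refine (((hx.pow 2).add (hy.pow 2)).sub (hy.const_mul (2 * P.R))).congr_deriv ?_
    simp; ring
  unfold progress progressDeriv
  have h0' : x + 0 * v₁ ≠ 0 := by simpa using h0.ne'
  refine (((hL.const_mul P.weight).add ((hρ.mul hm).div hx h0')).add (hL.mul hx)).congr_deriv ?_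
  simp only [Pi.mul_apply, zero_mul, add_zero, mul_zero, zero_add, mul_one]
  have : x ≠ 0 := h0.ne'
  field_simp

/-- One of the two terms `m²/x` absorbs the mixed term in `ρ m v₁ / x²`; the other survives. The
term `L v₁` supplies `L²/R`, because `L` is nearly `R v₁` close to the tip. -/
lemma progressDeriv_ge {x y v₁ v₂ : ℝ} (h0 : 0 < x) (h1 : x < P.r) (hf : P.f x ≤ y)
    (hg : y ≤ P.g x) (hv : v₁ ^ 2 + v₂ ^ 2 = 1) :
    radMom P.R x y v₁ v₂ ^ 2 / x + angMom P.R x y v₁ v₂ ^ 2 / P.R -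
      (P.powerBound + P.powerBound ^ 2 / 4 + 2 * (1 + P.R) / P.R) * x ≤
        P.progressDeriv x y v₁ v₂ := by
  obtain ⟨hy0, hyK, hyR⟩ := y_bounds h0 h1 hf hg
  obtain ⟨hv1, hv2⟩ := abs_le_one_of_sq_add_sq hv
  have hR := P.R_pos
  have hL := (abs_angMom_le h0 h1 hf hg hv).1
  have hρ := abs_circlePower_le h0 h1 hf hg
  have hB := P.powerBound_pos
  have hLv : angMom P.R x y v₁ v₂ * v₁ =
      (angMom P.R x y v₁ v₂ ^ 2 - x * (angMom P.R x y v₁ v₂ * v₂)) / (P.R - y) := by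
    rw [eq_div_iff (by linarith)]; unfold angMom; ring
  unfold progressDeriv
  rw [hLv]
  generalize angMom P.R x y v₁ v₂ = L at *
  generalize radMom P.R x y v₁ v₂ = m
  generalize circlePower P.R x y = ρ at *
  generalize P.powerBound = B at *
  have hx2 : 0 < x ^ 2 := by positivity
  have e1 : -(B * x) ≤ ρ / x := by
    rw [le_div_iff₀ h0]; nlinarith [(abs_le.1 hρ).1]
  have e2 : ρ * m * v₁ / x ^ 2 ≤ m ^ 2 / x + B ^ 2 / 4 * x := by
    have k1 : ρ * m * v₁ / x ^ 2 ≤ B * |m| := by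
      rw [div_le_iff₀ hx2]
      refine (le_abs_self _).trans ?_
      rw [abs_mul, abs_mul]
      have : |ρ| * |m| * |v₁| ≤ (B * x ^ 2) * |m| * 1 := by gcongr
      linarith
    -- Completing the square; this is the origin of the term `powerBound ^ 2 / 4` in `errorBound`.
    have k2 : m ^ 2 / x + B ^ 2 / 4 * x - B * |m| = (|m| - B / 2 * x) ^ 2 / x := by
      rw [← sq_abs m]; field_simp; ring
    have k3 : 0 ≤ (|m| - B / 2 * x) ^ 2 / x := by positivity
    linarith
  have e3 : L ^ 2 / P.R - 2 * (1 + P.R) / P.R * x ≤ (L ^ 2 - x * (L * v₂)) / (P.R - y) := by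
    have hRy : 0 < P.R - y := by linarith
    have k1 : L ^ 2 / P.R ≤ L ^ 2 / (P.R - y) :=
      div_le_div_of_nonneg_left (sq_nonneg L) hRy (by linarith)
    have k2 : x * (L * v₂) / (P.R - y) ≤ 2 * (1 + P.R) / P.R * x := by
      have a1 : L * v₂ ≤ 1 + P.R := by
        refine (le_abs_self _).trans ?_
        rw [abs_mul]
        nlinarith [abs_nonneg L, abs_nonneg v₂]
      rw [div_le_iff₀ hRy]
      have a2 : 1 + P.R ≤ 2 * (1 + P.R) / P.R * (P.R - y) := by
        rw [div_mul_eq_mul_div, le_div_iff₀ hR]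
        nlinarith
      nlinarith
    rw [sub_div]; linarith
  have e4 : (2 * m ^ 2 + ρ) / x = m ^ 2 / x + m ^ 2 / x + ρ / x := by ring
  rw [e4]
  nlinarith

/-- Since `x < r ≤ R`, the lower bound contains `(m² + L²)/R = (ρ + R²)/R`, which is `R` up to a
multiple of `x`. The field `small` says exactly that the total error is at most `R / 2`. -/
lemma progressDeriv_ge_half {x y v₁ v₂ : ℝ} (h0 : 0 < x) (h1 : x < P.r) (hf : P.f x ≤ y)
    (hg : y ≤ P.g x) (hv : v₁ ^ 2 + v₂ ^ 2 = 1) : P.R / 2 ≤ P.progressDeriv x y v₁ v₂ := by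
  refine le_trans ?_ (progressDeriv_ge h0 h1 hf hg hv)
  have hR := P.R_pos
  have hsum := radMom_sq_add_angMom_sq P.R x y hv
  have hρ := (abs_le.1 (abs_circlePower_le h0 h1 hf hg)).1
  have hB := P.powerBound_pos
  have hm : radMom P.R x y v₁ v₂ ^ 2 / P.R ≤ radMom P.R x y v₁ v₂ ^ 2 / x :=
    div_le_div_of_nonneg_left (sq_nonneg _) h0 (h1.le.trans P.r_le_R)
  have h2 : P.R - P.powerBound / P.R * x ≤
      radMom P.R x y v₁ v₂ ^ 2 / P.R + angMom P.R x y v₁ v₂ ^ 2 / P.R := by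
    rw [← add_div, hsum, le_div_iff₀ hR, sub_mul, div_mul_eq_mul_div, div_mul_cancel₀ _ hR.ne']
    have : x ^ 2 ≤ x := by nlinarith [P.r_le_one]
    nlinarith
  have h3 : P.errorBound * x ≤ P.R / 2 :=
    (mul_le_mul_of_nonneg_left h1.le P.errorBound_pos.le).trans P.small
  unfold errorBound at h3
  nlinarith

lemma abs_progress_le {x y v₁ v₂ : ℝ} (h0 : 0 < x) (h1 : x < P.r) (hf : P.f x ≤ y)
    (hg : y ≤ P.g x) (hv : v₁ ^ 2 + v₂ ^ 2 = 1) :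
    |P.progress x y v₁ v₂| ≤ (P.weight + P.powerBound + 1) * (1 + P.R) := by
  obtain ⟨hL, hm⟩ := abs_angMom_le h0 h1 hf hg hv
  have hρ := abs_circlePower_le h0 h1 hf hg
  have hx1 : x ≤ 1 := h1.le.trans P.r_le_one
  have hR := P.R_pos
  have hA := P.weight_pos
  have hB := P.powerBound_pos
  unfold progress
  have e1 : |P.weight * angMom P.R x y v₁ v₂| ≤ P.weight * (1 + P.R) := by
    rw [abs_mul, abs_of_pos hA]; gcongr
  have e2 : |circlePower P.R x y * radMom P.R x y v₁ v₂ / x| ≤ P.powerBound * (1 + P.R) := by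
    rw [abs_div, abs_mul, abs_of_pos h0, div_le_iff₀ h0]
    calc _ ≤ (P.powerBound * x ^ 2) * (1 + P.R) := by gcongr
      _ = P.powerBound * (1 + P.R) * (x * x) := by ring
      _ ≤ P.powerBound * (1 + P.R) * (1 * x) := by gcongr
      _ = _ := by ring
  have e3 : |angMom P.R x y v₁ v₂ * x| ≤ 1 * (1 + P.R) := by
    rw [abs_mul, abs_of_pos h0, one_mul]
    nlinarith [abs_nonneg (angMom P.R x y v₁ v₂)]
  refine (abs_add_le _ _).trans ((add_le_add (abs_add_le _ _) le_rfl).trans ?_)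
  linarith

end Profile

/-! ### Collisions and the bound for the time in the horn -/

namespace Flow

variable {P : Profile} {a b : ℝ} {x y u₁ u₂ w₁ w₂ : ℝ → ℝ}

lemma left_mem (F : Flow P a b x y u₁ u₂ w₁ w₂) {t : ℝ} (ht : t ∈ Ioo a b) :
    ∀ᶠ h in 𝓝[>] (0 : ℝ), t - h ∈ Ioo a b ∧ x (t - h) = x t - h * w₁ t ∧
      y (t - h) = y t - h * w₂ t ∧ u₁ (t - h) = w₁ t ∧ u₂ (t - h) = w₂ t := by
  filter_upwards [F.left t ht, Ioo_mem_nhdsGT (show (0 : ℝ) < t - a by linarith [ht.1])]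
    with h h1 h2
  exact ⟨⟨by linarith [h2.2], by linarith [h2.1, ht.2]⟩, h1⟩

/-- Otherwise the particle would have been below the lower graph just before the contact. -/
lemma lo_incoming (F : Flow P a b x y u₁ u₂ w₁ w₂) {t : ℝ} (ht : t ∈ Ioo a b)
    (hc : y t = P.f (x t)) : w₂ t - P.f1 (x t) * w₁ t ≤ 0 := by
  by_contra hpos
  have hD := (hasDerivAt_line (y t) (w₂ t)).sub
    (HasDerivAt.along_line (P.hf _ (F.x_pos t ht) (F.x_lt t ht)) (w₁ t))
  obtain ⟨h, h1, h2, h3, h4, -⟩ :=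
    ((eventually_lt_of_hasDerivAt_pos hD (by linarith)).2.and (F.left_mem ht)).exists
  have h5 := F.lo _ h2
  rw [h3, h4] at h5
  simp only [Pi.sub_apply, neg_mul, zero_mul, add_zero, hc, ← sub_eq_add_neg] at h1
  rw [hc] at h5
  linarith

lemma hi_incoming (F : Flow P a b x y u₁ u₂ w₁ w₂) {t : ℝ} (ht : t ∈ Ioo a b)
    (hc : y t = P.g (x t)) : 0 ≤ w₂ t - P.g1 (x t) * w₁ t := by
  by_contra hpos
  have hD := (HasDerivAt.along_line (P.hg _ (F.x_pos t ht) (F.x_lt t ht)) (w₁ t)).sub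
    (hasDerivAt_line (y t) (w₂ t))
  obtain ⟨h, h1, h2, h3, h4, -⟩ :=
    ((eventually_lt_of_hasDerivAt_pos hD (by linarith)).2.and (F.left_mem ht)).exists
  have h5 := F.hi _ h2
  rw [h3, h4] at h5
  simp only [Pi.sub_apply, neg_mul, zero_mul, add_zero, hc, ← sub_eq_add_neg] at h1
  rw [hc] at h5
  linarith

/-- The sign of the impulse `j` comes from the sign of the incoming velocity relative to the arc.
The last equation in each contact case says that this relative velocity is reversed. -/
lemma rule (F : Flow P a b x y u₁ u₂ w₁ w₂) {t : ℝ} (ht : t ∈ Ioo a b) :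
    (P.f (x t) < y t ∧ y t < P.g (x t) ∧ u₁ t = w₁ t ∧ u₂ t = w₂ t) ∨
    (y t = P.f (x t) ∧ ∃ j, 0 ≤ j ∧ u₁ t = w₁ t - j * P.f1 (x t) ∧ u₂ t = w₂ t + j ∧
      u₂ t - P.f1 (x t) * u₁ t = -(w₂ t - P.f1 (x t) * w₁ t)) ∨
    (y t = P.g (x t) ∧ ∃ j, j ≤ 0 ∧ u₁ t = w₁ t - j * P.g1 (x t) ∧ u₂ t = w₂ t + j ∧
      u₂ t - P.g1 (x t) * u₁ t = -(w₂ t - P.g1 (x t) * w₁ t)) := by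
  rcases (F.lo t ht).eq_or_lt with h | h
  · right; left
    refine ⟨h.symm, ?_⟩
    obtain ⟨j, h1, h2, h3⟩ := F.reflect_lo t ht h.symm
    refine ⟨j, ?_, h1, h2, ?_⟩
    · have := F.lo_incoming ht h.symm
      by_contra hj
      nlinarith [sq_nonneg (P.f1 (x t))]
    · rw [h1, h2]; linear_combination h3
  · rcases (F.hi t ht).eq_or_lt with h' | h'
    · right; right
      refine ⟨h', ?_⟩
      obtain ⟨j, h1, h2, h3⟩ := F.reflect_hi t ht h'
      refine ⟨j, ?_, h1, h2, ?_⟩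
      · have := F.hi_incoming ht h'
        by_contra hj
        nlinarith [sq_nonneg (P.g1 (x t))]
      · rw [h1, h2]; linear_combination h3
    · exact Or.inl ⟨h, h', F.free t ht h h'⟩

/-- An impulse `j (-s, 1)` changes `L` by `j (x - (R - y) s)`. On the lower arc both factors are
nonnegative, on the upper arc both are nonpositive, by the torque estimates of `Profile`. -/
lemma angMom_jump (F : Flow P a b x y u₁ u₂ w₁ w₂) {t : ℝ} (ht : t ∈ Ioo a b) :
    angMom P.R (x t) (y t) (w₁ t) (w₂ t) ≤ angMom P.R (x t) (y t) (u₁ t) (u₂ t) := by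
  have hx := F.x_pos t ht
  have hcx := mul_pos P.c_pos hx
  rcases F.rule ht with ⟨-, -, h1, h2⟩ | ⟨hc, j, hj, h1, h2, -⟩ | ⟨hc, j, hj, h1, h2, -⟩
  · rw [h1, h2]
  · have := P.lo_torque _ hx (F.x_lt t ht)
    rw [h1, h2, hc]; unfold angMom; nlinarith
  · have := P.hi_torque _ hx (F.x_lt t ht)
    rw [h1, h2, hc]; unfold angMom; nlinarith

lemma angMom_monotoneOn (F : Flow P a b x y u₁ u₂ w₁ w₂) :
    MonotoneOn (fun t => angMom P.R (x t) (y t) (u₁ t) (u₂ t)) (Ioo a b) := by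
  refine F.monotoneOn (fun _ x y v₁ v₂ => angMom P.R x y v₁ v₂) (fun _ _ _ _ _ => 0) ?_
    (fun _ _ => le_rfl) (fun _ _ => le_rfl) (fun t ht => F.angMom_jump ht)
  intro t _ v₁ v₂ _
  have : (fun h => angMom P.R (x t + h * v₁) (y t + h * v₂) v₁ v₂) =
      fun _ => angMom P.R (x t) (y t) v₁ v₂ := by
    funext h; unfold angMom; ring
  rw [this]; exact hasDerivAt_const _ _

/-- The incoming angular momentum is the outgoing one of an earlier time. -/
lemma exists_angMom_left (F : Flow P a b x y u₁ u₂ w₁ w₂) {t : ℝ} (ht : t ∈ Ioo a b) :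
    ∃ t' ∈ Ioo a b, angMom P.R (x t') (y t') (u₁ t') (u₂ t') =
      angMom P.R (x t) (y t) (w₁ t) (w₂ t) := by
  obtain ⟨h, h1, h2, h3, h4, h5⟩ := (F.left_mem ht).exists
  refine ⟨t - h, h1, ?_⟩
  rw [h2, h3, h4, h5]; unfold angMom; ring

/-- For an impulse of size `i`, the term `ρ m / x` changes by at most `powerBound * x * i * (R +
K)`, while `L` gains at least `c * x * i`. The weight is the ratio of these bounds. -/
lemma progress_jump (F : Flow P a b x y u₁ u₂ w₁ w₂) {t : ℝ} (ht : t ∈ Ioo a b) :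
    P.progress (x t) (y t) (w₁ t) (w₂ t) ≤ P.progress (x t) (y t) (u₁ t) (u₂ t) := by
  have hx := F.x_pos t ht
  have hxr := F.x_lt t ht
  have hx1 : x t ≤ 1 := hxr.le.trans P.r_le_one
  have hρ := abs_le.1 (Profile.abs_circlePower_le hx hxr (F.lo t ht) (F.hi t ht))
  obtain ⟨hy0, hyK, hyR⟩ := Profile.y_bounds hx hxr (F.lo t ht) (F.hi t ht)
  have hL := F.angMom_jump ht
  have hK := P.K_pos
  have hB := P.powerBound_pos
  have hR := P.R_pos
  have hA := P.weight_pos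
  have hAc : P.weight * P.c = P.powerBound * (P.R + P.K) :=
    div_mul_cancel₀ _ P.c_pos.ne'
  -- Here `s` is the slope of the arc and `i = |j|`, so that both arcs are treated at once.
  have key : ∀ s i : ℝ, 0 ≤ i → 0 ≤ s → s ≤ P.K * x t →
      P.c * x t * i ≤ angMom P.R (x t) (y t) (u₁ t) (u₂ t) -
        angMom P.R (x t) (y t) (w₁ t) (w₂ t) →
      |radMom P.R (x t) (y t) (u₁ t) (u₂ t) - radMom P.R (x t) (y t) (w₁ t) (w₂ t)| =
        i * (P.R - y t + x t * s) →
      P.progress (x t) (y t) (w₁ t) (w₂ t) ≤ P.progress (x t) (y t) (u₁ t) (u₂ t) := by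
    intro s i hi hs0 hs h1 h2
    unfold Profile.progress
    have e1 : |circlePower P.R (x t) (y t) * (radMom P.R (x t) (y t) (u₁ t) (u₂ t) -
        radMom P.R (x t) (y t) (w₁ t) (w₂ t)) / x t| ≤ P.weight * (P.c * x t * i) := by
      rw [abs_div, abs_of_pos hx, div_le_iff₀ hx, abs_mul, h2]
      have k1 : P.R - y t + x t * s ≤ P.R + P.K := by nlinarith
      calc _ ≤ (P.powerBound * x t ^ 2) * (i * (P.R + P.K)) := by
            have k2 : 0 ≤ P.R - y t + x t * s := by nlinarith
            gcongr
            exact abs_le.2 hρ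
        _ = _ := by linear_combination (-(x t) ^ 2 * i) * hAc
    have e2 := (abs_le.1 e1).1
    have e3 : circlePower P.R (x t) (y t) * (radMom P.R (x t) (y t) (u₁ t) (u₂ t) -
        radMom P.R (x t) (y t) (w₁ t) (w₂ t)) / x t =
        circlePower P.R (x t) (y t) * radMom P.R (x t) (y t) (u₁ t) (u₂ t) / x t -
        circlePower P.R (x t) (y t) * radMom P.R (x t) (y t) (w₁ t) (w₂ t) / x t := by ring
    have e4 := mul_le_mul_of_nonneg_left h1 hA.le
    have e5 := mul_le_mul_of_nonneg_right hL hx.le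
    linarith
  rcases F.rule ht with ⟨-, -, h1, h2⟩ | ⟨hc, j, hj, h1, h2, -⟩ | ⟨hc, j, hj, h1, h2, -⟩
  · rw [h1, h2]
  · have ht' := P.lo_torque _ hx hxr
    have hs := P.f1_nonneg _ hx hxr
    refine key (P.f1 (x t)) j hj hs (P.f1_le _ hx hxr) ?_ ?_
    · rw [h1, h2, hc]; unfold angMom; nlinarith
    · rw [h1, h2]; unfold radMom
      rw [show x t * (w₁ t - j * P.f1 (x t)) + (y t - P.R) * (w₂ t + j) -
        (x t * w₁ t + (y t - P.R) * w₂ t) = -(j * (P.R - y t + x t * P.f1 (x t))) by ring,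
        abs_neg, abs_of_nonneg]
      have := mul_nonneg hx.le hs
      exact mul_nonneg hj (by linarith)
  · have ht' := P.hi_torque _ hx hxr
    have hs := P.g1_nonneg _ hx hxr
    refine key (P.g1 (x t)) (-j) (by linarith) hs (P.g1_le _ hx hxr) ?_ ?_
    · rw [h1, h2, hc]; unfold angMom; nlinarith
    · rw [h1, h2]; unfold radMom
      rw [show x t * (w₁ t - j * P.g1 (x t)) + (y t - P.R) * (w₂ t + j) -
        (x t * w₁ t + (y t - P.R) * w₂ t) = -j * (P.R - y t + x t * P.g1 (x t)) by ring,
        abs_of_nonneg]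
      have := mul_nonneg hx.le hs
      exact mul_nonneg (by linarith) (by linarith)

/-- A trajectory stays in the horn only for a bounded time. -/
lemma length_le (F : Flow P a b x y u₁ u₂ w₁ w₂) :
    b - a ≤ 4 * ((P.weight + P.powerBound + 1) * (1 + P.R)) / P.R + 1 := by
  have hR := P.R_pos
  set B := (P.weight + P.powerBound + 1) * (1 + P.R) with hB
  have hD : ∀ t ∈ Ioo a b, ∀ v₁ v₂ : ℝ, v₁ ^ 2 + v₂ ^ 2 = 1 →
      0 ≤ P.progressDeriv (x t) (y t) v₁ v₂ - P.R / 2 * 1 := by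
    intro t ht v₁ v₂ hv
    have := Profile.progressDeriv_ge_half (F.x_pos t ht) (F.x_lt t ht) (F.lo t ht) (F.hi t ht) hv
    linarith
  have hmono := F.monotoneOn (fun t x y v₁ v₂ => P.progress x y v₁ v₂ - P.R / 2 * t)
    (fun _ x y v₁ v₂ => P.progressDeriv x y v₁ v₂ - P.R / 2 * 1)
    (fun t ht v₁ v₂ hv => (Profile.hasDerivAt_progress (F.x_pos t ht) hv).sub
      (((hasDerivAt_id (0 : ℝ)).const_add t).const_mul (P.R / 2)))
    (fun t ht => hD t ht _ _ (F.unit_u t ht)) (fun t ht => hD t ht _ _ (F.unit_w t ht))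
    (fun t ht => by linarith [F.progress_jump ht])
  by_contra hlt
  have hB0 : 0 < B := by
    have := P.weight_pos; have := P.powerBound_pos; positivity
  have hBR : 0 < 4 * B / P.R := by positivity
  -- Moving in by `1 / 3` at each end keeps the times inside the open interval; the summand 1 in the
  -- bound leaves room for both.
  set s := a + 1 / 3
  set t := b - 1 / 3
  have hs : s ∈ Ioo a b := ⟨by simp [s], by simp only [s]; linarith⟩
  have ht : t ∈ Ioo a b := ⟨by simp only [t]; linarith, by simp [t]⟩
  have h1 := hmono hs ht (by simp only [s, t]; linarith)
  simp only at h1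
  have h2 := (abs_le.1 (Profile.abs_progress_le (F.x_pos t ht) (F.x_lt t ht) (F.lo t ht)
    (F.hi t ht) (F.unit_u t ht))).2
  have h3 := (abs_le.1 (Profile.abs_progress_le (F.x_pos s hs) (F.x_lt s hs) (F.lo s hs)
    (F.hi s hs) (F.unit_u s hs))).1
  have h4 : 4 * B / P.R < t - s := by simp only [s, t]; linarith
  rw [div_lt_iff₀ hR] at h4
  nlinarith

end Flow

/-! ### Convexity of the arcs and the energy of bouncing on the lower arc -/

namespace Profile

variable {P : Profile}

lemma f_strictConvex : StrictConvexOn ℝ (Ioo 0 P.r) P.f := by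
  refine StrictMonoOn.strictConvexOn_of_deriv (convex_Ioo _ _)
    (fun z hz => (P.hf z hz.1 hz.2).continuousAt.continuousWithinAt) ?_
  rw [interior_Ioo]
  have hmono : StrictMonoOn P.f1 (Ioo 0 P.r) := by
    refine strictMonoOn_of_deriv_pos (convex_Ioo _ _)
      (fun z hz => (P.hf1 z hz.1 hz.2).continuousAt.continuousWithinAt) ?_
    rw [interior_Ioo]
    intro z hz
    rw [(P.hf1 z hz.1 hz.2).deriv]
    exact P.c_pos.trans_le (P.f2_ge z hz.1 hz.2)
  exact hmono.congr fun z hz => ((P.hf z hz.1 hz.2).deriv).symm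

lemma g_strictConvex : StrictConvexOn ℝ (Ioo 0 P.r) P.g := by
  refine StrictMonoOn.strictConvexOn_of_deriv (convex_Ioo _ _)
    (fun z hz => (P.hg z hz.1 hz.2).continuousAt.continuousWithinAt) ?_
  rw [interior_Ioo]
  have hmono : StrictMonoOn P.g1 (Ioo 0 P.r) := by
    refine strictMonoOn_of_deriv_pos (convex_Ioo _ _)
      (fun z hz => (P.hg1 z hz.1 hz.2).continuousAt.continuousWithinAt) ?_
    rw [interior_Ioo]
    intro z hz
    rw [(P.hg1 z hz.1 hz.2).deriv]
    exact P.g2_pos z hz.1 hz.2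
  exact hmono.congr fun z hz => ((P.hg z hz.1 hz.2).deriv).symm

/-- The midpoint of a nontrivial segment whose end-points are on or above the graph of a strictly
convex function is above the graph. -/
lemma lt_midpoint {s : Set ℝ} {φ : ℝ → ℝ} (hφ : StrictConvexOn ℝ s φ) {x₁ x₂ y₁ y₂ : ℝ}
    (h₁ : x₁ ∈ s) (h₂ : x₂ ∈ s) (hy₁ : φ x₁ ≤ y₁) (hy₂ : φ x₂ ≤ y₂)
    (hne : x₁ ≠ x₂ ∨ y₁ ≠ y₂) : φ ((x₁ + x₂) / 2) < (y₁ + y₂) / 2 := by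
  by_cases hx : x₁ = x₂
  · subst hx
    have hy : y₁ ≠ y₂ := hne.resolve_left (fun h => h rfl)
    rw [add_self_div_two]
    rcases lt_or_gt_of_ne hy with h | h <;> linarith
  · have := hφ.2 h₁ h₂ hx (show (0 : ℝ) < 1 / 2 by norm_num)
      (show (0 : ℝ) < 1 / 2 by norm_num) (by norm_num)
    simp only [smul_eq_mul] at this
    rw [show (x₁ + x₂) / 2 = 1 / 2 * x₁ + 1 / 2 * x₂ by ring]
    linarith

/-- A straight segment in the horn meets the boundary only finitely often near its
initial point. -/
lemma eventually_interior {x y v₁ v₂ : ℝ} (hv : v₁ ^ 2 + v₂ ^ 2 = 1)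
    (h : ∀ᶠ h in 𝓝[>] (0 : ℝ), 0 < x + h * v₁ ∧ x + h * v₁ < P.r ∧
      P.f (x + h * v₁) ≤ y + h * v₂ ∧ y + h * v₂ ≤ P.g (x + h * v₁)) :
    ∀ᶠ h in 𝓝[>] (0 : ℝ), P.f (x + h * v₁) < y + h * v₂ ∧ y + h * v₂ < P.g (x + h * v₁) := by
  obtain ⟨ε, hε0, hε⟩ := mem_nhdsGT_iff_exists_Ioo_subset.1 h
  have hε0 : 0 < ε := hε0
  have hne : ∀ s t : ℝ, s ≠ t → x + s * v₁ ≠ x + t * v₁ ∨ y + s * v₂ ≠ y + t * v₂ := by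
    intro s t hst
    by_contra hcon
    push Not at hcon
    have h1 : (s - t) * v₁ = 0 := by linarith [hcon.1]
    have h2 : (s - t) * v₂ = 0 := by linarith [hcon.2]
    have h3 := sub_ne_zero.2 hst
    have h4 := (mul_eq_zero.1 h1).resolve_left h3
    have h5 := (mul_eq_zero.1 h2).resolve_left h3
    rw [h4, h5] at hv
    norm_num at hv
  -- An inner point of the segment is a midpoint of two others, so strict convexity keeps it off the
  -- lower graph.
  have hlo : ∀ t ∈ Ioo 0 ε, P.f (x + t * v₁) < y + t * v₂ := by
    intro t ht
    obtain ⟨δ, hδ0, hδ1, hδ2⟩ : ∃ δ : ℝ, 0 < δ ∧ δ < t ∧ t + δ < ε := by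
      refine ⟨min t (ε - t) / 2, ?_, ?_, ?_⟩ <;>
        have h1 := min_le_left t (ε - t) <;> have h2 := min_le_right t (ε - t) <;>
        have h3 : 0 < min t (ε - t) := lt_min ht.1 (by linarith [ht.2]) <;>
        linarith [ht.1, ht.2]
    obtain ⟨p1, p2, p3, p4⟩ := hε (show t - δ ∈ Ioo 0 ε from ⟨by linarith, by linarith⟩)
    obtain ⟨q1, q2, q3, q4⟩ := hε (show t + δ ∈ Ioo 0 ε from ⟨by linarith [ht.1], hδ2⟩)
    have := lt_midpoint P.f_strictConvex ⟨p1, p2⟩ ⟨q1, q2⟩ p3 q3 (hne _ _ (by linarith))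
    rw [show (x + (t - δ) * v₁ + (x + (t + δ) * v₁)) / 2 = x + t * v₁ by ring] at this
    linarith
  -- The upper arc can be touched once, but between two contacts the chord would lie above the
  -- graph, outside the horn.
  have hhi : ∀ s ∈ Ioo 0 ε, ∀ t ∈ Ioo 0 ε, y + s * v₂ = P.g (x + s * v₁) →
      y + t * v₂ = P.g (x + t * v₁) → s = t := by
    intro s hs t ht h1 h2
    by_contra hst
    obtain ⟨p1, p2, -, -⟩ := hε hs
    obtain ⟨q1, q2, -, -⟩ := hε ht
    have := lt_midpoint P.g_strictConvex ⟨p1, p2⟩ ⟨q1, q2⟩ h1.ge h2.ge (hne _ _ hst)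
    obtain ⟨-, -, -, m4⟩ := hε (show (s + t) / 2 ∈ Ioo 0 ε from
      ⟨by linarith [hs.1, ht.1], by linarith [hs.2, ht.2]⟩)
    rw [show (x + s * v₁ + (x + t * v₁)) / 2 = x + (s + t) / 2 * v₁ by ring] at this
    linarith
  by_cases hex : ∃ s ∈ Ioo 0 ε, y + s * v₂ = P.g (x + s * v₁)
  · obtain ⟨s, hs, hsg⟩ := hex
    filter_upwards [Ioo_mem_nhdsGT hs.1] with t ht
    have htε : t ∈ Ioo 0 ε := ⟨ht.1, ht.2.trans hs.2⟩
    refine ⟨hlo t htε, lt_of_le_of_ne (hε htε).2.2.2 fun heq => ?_⟩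
    exact ht.2.ne (hhi t htε s hs heq hsg)
  · push Not at hex
    filter_upwards [Ioo_mem_nhdsGT hε0] with t ht
    exact ⟨hlo t ht, lt_of_le_of_ne (hε ht).2.2.2 (hex t ht)⟩

/-- The energy of the bouncing motion relative to the lower arc. -/
def energy (P : Profile) (x y v₁ v₂ : ℝ) : ℝ :=
  (v₂ - P.f1 x * v₁) ^ 2 / 2 + P.f2 x * v₁ ^ 2 * (y - P.f x)

/-- The height `η = y - f` satisfies `η'' = -f₂ v₁²` in flight. With constant `f₂` the sum `η'²/2 +
f₂ v₁² η` would be conserved; only the variation of `f₂` contributes. -/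
lemma hasDerivAt_energy {x y v₁ v₂ : ℝ} (h0 : 0 < x) (h1 : x < P.r) :
    HasDerivAt (fun h => P.energy (x + h * v₁) (y + h * v₂) v₁ v₂)
      (P.f3 x * v₁ ^ 3 * (y - P.f x)) 0 := by
  have hf := HasDerivAt.along_line (P.hf x h0 h1) v₁
  have hf1 := HasDerivAt.along_line (P.hf1 x h0 h1) v₁
  have hf2 := HasDerivAt.along_line (P.hf2 x h0 h1) v₁
  have hy := hasDerivAt_line y v₂
  unfold energy
  refine (((((hf1.mul_const v₁).const_sub v₂).pow 2).div_const 2).add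
    ((hf2.mul_const (v₁ ^ 2)).mul (hy.sub hf))).congr_deriv ?_
  simp
  ring

/-- The potential part of the energy is at least `c v₁² (y - f)`, so it controls the derivative
through `|f₃| ≤ K`. The third derivatives of the arcs matter only here. -/
lemma energy_rate {x y v₁ v₂ : ℝ} (h0 : 0 < x) (h1 : x < P.r) (hf : P.f x ≤ y)
    (hv : v₁ ^ 2 + v₂ ^ 2 = 1) :
    0 ≤ P.K / P.c * P.energy x y v₁ v₂ + P.f3 x * v₁ ^ 3 * (y - P.f x) := by
  have hv1 := (abs_le_one_of_sq_add_sq hv).1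
  have hc := P.c_pos
  have hK := P.K_pos
  have h2 : P.c * (v₁ ^ 2 * (y - P.f x)) ≤ P.energy x y v₁ v₂ := by
    have := mul_le_mul_of_nonneg_right (P.f2_ge x h0 h1)
      (mul_nonneg (sq_nonneg v₁) (sub_nonneg.2 hf))
    unfold energy
    nlinarith [sq_nonneg (v₂ - P.f1 x * v₁)]
  have h3 : P.K * (v₁ ^ 2 * (y - P.f x)) ≤ P.K / P.c * P.energy x y v₁ v₂ := by
    calc _ = P.K / P.c * (P.c * (v₁ ^ 2 * (y - P.f x))) := by field_simp
      _ ≤ _ := by gcongr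
  have h4 : |P.f3 x * v₁ ^ 3 * (y - P.f x)| ≤ P.K * (v₁ ^ 2 * (y - P.f x)) := by
    rw [show P.f3 x * v₁ ^ 3 * (y - P.f x) = P.f3 x * v₁ * (v₁ ^ 2 * (y - P.f x)) by ring,
      abs_mul, abs_of_nonneg (mul_nonneg (sq_nonneg v₁) (sub_nonneg.2 hf)), abs_mul]
    have h5 := P.f3_le x h0 h1
    have h6 : |P.f3 x| * |v₁| ≤ P.K * 1 := by gcongr
    have h7 := mul_nonneg (sq_nonneg v₁) (sub_nonneg.2 hf)
    nlinarith
  linarith [(abs_le.1 h4).1]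

lemma energy_pos {x y v₁ v₂ : ℝ} (h0 : 0 < x) (h1 : x < P.r) (hf : P.f x < y)
    (hv : v₁ ^ 2 + v₂ ^ 2 = 1) : 0 < P.energy x y v₁ v₂ := by
  unfold energy
  have h2 := P.c_pos.trans_le (P.f2_ge x h0 h1)
  rcases eq_or_ne v₁ 0 with h | h
  · subst h
    have : v₂ ^ 2 = 1 := by linarith
    simp [this]
  · have := mul_pos (mul_pos h2 (by positivity : 0 < v₁ ^ 2)) (sub_pos.2 hf)
    nlinarith [sq_nonneg (v₂ - P.f1 x * v₁)]

end Profile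

/-! ### Isolated contacts, and why the tip is never reached -/

namespace Flow

variable {P : Profile} {a b : ℝ} {x y u₁ u₂ w₁ w₂ : ℝ → ℝ}

lemma eventually_interior_right (F : Flow P a b x y u₁ u₂ w₁ w₂) {t : ℝ} (ht : t ∈ Ioo a b) :
    ∀ᶠ h in 𝓝[>] (0 : ℝ), P.f (x (t + h)) < y (t + h) ∧ y (t + h) < P.g (x (t + h)) := by
  have hmem : ∀ᶠ h in 𝓝[>] (0 : ℝ), t + h ∈ Ioo a b := by
    filter_upwards [Ioo_mem_nhdsGT (show (0 : ℝ) < b - t by linarith [ht.2])] with h h2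
    exact ⟨by linarith [h2.1, ht.1], by linarith [h2.2]⟩
  have := Profile.eventually_interior (P := P) (x := x t) (y := y t) (F.unit_u t ht) (by
    filter_upwards [hmem, F.right t ht] with h h1 h2
    rw [← h2.1, ← h2.2.1]
    exact ⟨F.x_pos _ h1, F.x_lt _ h1, F.lo _ h1, F.hi _ h1⟩)
  filter_upwards [this, F.right t ht] with h h1 h2
  rw [h2.1, h2.2.1]
  exact h1

lemma eventually_interior_left (F : Flow P a b x y u₁ u₂ w₁ w₂) {t : ℝ} (ht : t ∈ Ioo a b) :
    ∀ᶠ h in 𝓝[>] (0 : ℝ), P.f (x (t - h)) < y (t - h) ∧ y (t - h) < P.g (x (t - h)) := by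
  have hw : (-w₁ t) ^ 2 + (-w₂ t) ^ 2 = 1 := by
    have := F.unit_w t ht; linarith
  have e : ∀ p h q : ℝ, p + h * -q = p - h * q := fun p h q => by ring
  have := Profile.eventually_interior (P := P) (x := x t) (y := y t) hw (by
    filter_upwards [F.left_mem ht] with h h1
    rw [e, e, ← h1.2.1, ← h1.2.2.1]
    exact ⟨F.x_pos _ h1.1, F.x_lt _ h1.1, F.lo _ h1.1, F.hi _ h1.1⟩)
  filter_upwards [this, F.left t ht] with h h1 h2
  rw [e, e] at h1
  rw [h2.1, h2.2.1]
  exact h1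

lemma exists_interior (F : Flow P a b x y u₁ u₂ w₁ w₂) {t : ℝ} (ht : t ∈ Ioo a b) :
    ∃ t' ∈ Ioo t b, P.f (x t') < y t' ∧ y t' < P.g (x t') := by
  obtain ⟨h, h1, h2⟩ := ((F.eventually_interior_right ht).and
    (Ioo_mem_nhdsGT (show (0 : ℝ) < b - t by linarith [ht.2]))).exists
  exact ⟨t + h, ⟨by linarith [h2.1], by linarith [h2.2]⟩, h1⟩

/-- As long as only the lower arc is hit, the energy decays at most exponentially. -/
lemma exp_energy_monotoneOn (F : Flow P a b x y u₁ u₂ w₁ w₂)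
    (hg : ∀ t ∈ Ioo a b, y t < P.g (x t)) :
    MonotoneOn (fun t => Real.exp (P.K / P.c * t) * P.energy (x t) (y t) (u₁ t) (u₂ t))
      (Ioo a b) := by
  refine F.monotoneOn (fun t x y v₁ v₂ => Real.exp (P.K / P.c * t) * P.energy x y v₁ v₂)
    (fun t x y v₁ v₂ => Real.exp (P.K / P.c * t) *
      (P.K / P.c * P.energy x y v₁ v₂ + P.f3 x * v₁ ^ 3 * (y - P.f x))) ?_ ?_ ?_ ?_
  · intro t ht v₁ v₂ _
    have he : HasDerivAt (fun h => Real.exp (P.K / P.c * (t + h)))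
        (Real.exp (P.K / P.c * (t + 0)) * (P.K / P.c * 1)) 0 :=
      (((hasDerivAt_id (0 : ℝ)).const_add t).const_mul _).exp
    refine (he.mul (Profile.hasDerivAt_energy (F.x_pos t ht) (F.x_lt t ht))).congr_deriv ?_
    simp only [add_zero, zero_mul]
    ring
  · intro t ht
    exact mul_nonneg (Real.exp_pos _).le
      (Profile.energy_rate (F.x_pos t ht) (F.x_lt t ht) (F.lo t ht) (F.unit_u t ht))
  · intro t ht
    exact mul_nonneg (Real.exp_pos _).le
      (Profile.energy_rate (F.x_pos t ht) (F.x_lt t ht) (F.lo t ht) (F.unit_w t ht))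
  · intro t ht
    rcases F.rule ht with ⟨-, -, h1, h2⟩ | ⟨hc, j, -, -, -, h3⟩ | ⟨hc, -⟩
    · rw [h1, h2]
    -- The collision may change `v₁`, but the height is zero there, and the kinetic part only sees
    -- the reversed relative velocity.
    · simp only [Profile.energy, h3, hc, sub_self, mul_zero, neg_sq, le_refl]
    · exact absurd hc (hg t ht).ne

lemma exists_angMom_limit (F : Flow P a b x y u₁ u₂ w₁ w₂) (hab : a < b) :
    ∃ ℓ, Tendsto (fun t => angMom P.R (x t) (y t) (u₁ t) (u₂ t)) (𝓝[<] b) (𝓝 ℓ) ∧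
      ∀ t ∈ Ioo a b, angMom P.R (x t) (y t) (u₁ t) (u₂ t) ≤ ℓ := by
  have hbdd : BddAbove ((fun t => angMom P.R (x t) (y t) (u₁ t) (u₂ t)) '' Ioo a b) := by
    refine ⟨1 + P.R, ?_⟩
    rintro _ ⟨t, ht, rfl⟩
    exact (abs_le.1 (Profile.abs_angMom_le (F.x_pos t ht) (F.x_lt t ht) (F.lo t ht) (F.hi t ht)
      (F.unit_u t ht)).1).2
  exact ⟨_, F.angMom_monotoneOn.tendsto_nhdsWithin_Ioo_left (nonempty_Ioo.2 hab) hbdd,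
    fun t ht => le_csSup hbdd (mem_image_of_mem _ ht)⟩

lemma exists_Ioo_of_eventually {b a : ℝ} (hab : a < b) {p : ℝ → Prop}
    (h : ∀ᶠ t in 𝓝[<] b, p t) : ∃ a', a ≤ a' ∧ a' < b ∧ ∀ t ∈ Ioo a' b, p t := by
  obtain ⟨l, hl, hl'⟩ := mem_nhdsLT_iff_exists_Ioo_subset.1 h
  exact ⟨max a l, le_max_left _ _, max_lt hab hl,
    fun t ht => hl' ⟨(le_max_right _ _).trans_lt ht.1, ht.2⟩⟩

/-- A trajectory does not converge to the tip, unless it does so tangentially. -/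
lemma not_tendsto_tip_of_sq_lt (F : Flow P a b x y u₁ u₂ w₁ w₂) (hab : a < b)
    (hx : Tendsto x (𝓝[<] b) (𝓝 0)) {ℓ : ℝ}
    (hL : Tendsto (fun t => angMom P.R (x t) (y t) (u₁ t) (u₂ t)) (𝓝[<] b) (𝓝 ℓ))
    (hℓ : ℓ ^ 2 < P.R ^ 2) : False := by
  -- Of the gap `4 ε`, one `ε` is lost to the limit of `L²` and one to the circle power, which
  -- leaves `m² ≥ 2 ε`. This pays for `ε |v₁|` and for the error term `κ x²`.
  set ε := (P.R ^ 2 - ℓ ^ 2) / 4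
  have hε : 0 < ε := by simp only [ε]; linarith
  set κ := P.powerBound + P.powerBound ^ 2 / 4 + 2 * (1 + P.R) / P.R
  have h1 : ∀ᶠ t in 𝓝[<] b, angMom P.R (x t) (y t) (u₁ t) (u₂ t) ^ 2 < P.R ^ 2 - 3 * ε :=
    (hL.pow 2).eventually (gt_mem_nhds (by simp only [ε]; linarith))
  have h2 : ∀ᶠ t in 𝓝[<] b, P.powerBound * x t ^ 2 < ε := by
    have := (hx.pow 2).const_mul P.powerBound
    exact this.eventually (gt_mem_nhds (by simpa using hε))
  have h3 : ∀ᶠ t in 𝓝[<] b, κ * x t ^ 2 < ε := by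
    have := (hx.pow 2).const_mul κ
    exact this.eventually (gt_mem_nhds (by simpa using hε))
  obtain ⟨a', haa, hab', h⟩ := exists_Ioo_of_eventually hab (h1.and (h2.and h3))
  have F' := F.mono haa le_rfl
  have hrate : ∀ t ∈ Ioo a' b, ∀ v₁ v₂ : ℝ, v₁ ^ 2 + v₂ ^ 2 = 1 →
      angMom P.R (x t) (y t) v₁ v₂ ^ 2 < P.R ^ 2 - 3 * ε →
      0 ≤ P.progressDeriv (x t) (y t) v₁ v₂ + ε * (v₁ / x t) := by
    intro t ht v₁ v₂ hv hlt
    have hx0 := F'.x_pos t ht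
    have g1 := Profile.progressDeriv_ge hx0 (F'.x_lt t ht) (F'.lo t ht) (F'.hi t ht) hv
    rw [show P.powerBound + P.powerBound ^ 2 / 4 + 2 * (1 + P.R) / P.R = κ from rfl] at g1
    have g2 := (abs_le.1 (Profile.abs_circlePower_le hx0 (F'.x_lt t ht) (F'.lo t ht)
      (F'.hi t ht))).1
    have g3 := radMom_sq_add_angMom_sq P.R (x t) (y t) hv
    obtain ⟨-, h5, h6⟩ := h t ht
    have g4 : 2 * ε ≤ radMom P.R (x t) (y t) v₁ v₂ ^ 2 := by linarith
    have g5 : 0 ≤ angMom P.R (x t) (y t) v₁ v₂ ^ 2 / P.R := div_nonneg (sq_nonneg _) P.R_pos.le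
    have g6 := (abs_le.1 (abs_le_one_of_sq_add_sq hv).1).1
    have g7 : 0 ≤ (radMom P.R (x t) (y t) v₁ v₂ ^ 2 - κ * x t ^ 2 + ε * v₁) / x t :=
      div_nonneg (by nlinarith) hx0.le
    have g8 : (radMom P.R (x t) (y t) v₁ v₂ ^ 2 - κ * x t ^ 2 + ε * v₁) / x t =
        radMom P.R (x t) (y t) v₁ v₂ ^ 2 / x t - κ * x t + ε * (v₁ / x t) := by
      field_simp
    linarith
  -- `progress` is bounded while `ε log x` tends to `-∞`, so the monotonicity of their sum is
  -- contradictory.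
  have hmono := F'.monotoneOn
    (fun _ x y v₁ v₂ => P.progress x y v₁ v₂ + ε * Real.log x)
    (fun _ x y v₁ v₂ => P.progressDeriv x y v₁ v₂ + ε * (v₁ / x)) (by
      intro t ht v₁ v₂ hv
      have hx0 := F'.x_pos t ht
      have := (hasDerivAt_line (x t) v₁).log (by simpa using hx0.ne')
      simp only [zero_mul, add_zero] at this
      exact (Profile.hasDerivAt_progress hx0 hv).add (this.const_mul ε))
    (fun t ht => hrate t ht _ _ (F'.unit_u t ht) (h t ht).1)
    (fun t ht => by
      obtain ⟨t', ht', heq⟩ := F'.exists_angMom_left ht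
      exact hrate t ht _ _ (F'.unit_w t ht) (heq ▸ (h t' ht').1))
    (fun t ht => by simpa using F'.progress_jump ht)
  set B := (P.weight + P.powerBound + 1) * (1 + P.R)
  have hB : ∀ t ∈ Ioo a' b, |P.progress (x t) (y t) (u₁ t) (u₂ t)| ≤ B := fun t ht =>
    Profile.abs_progress_le (F'.x_pos t ht) (F'.x_lt t ht) (F'.lo t ht) (F'.hi t ht)
      (F'.unit_u t ht)
  set s := (a' + b) / 2
  have hs : s ∈ Ioo a' b := ⟨by simp only [s]; linarith, by simp only [s]; linarith⟩
  have hx' : Tendsto x (𝓝[<] b) (𝓝[>] 0) := by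
    refine tendsto_nhdsWithin_iff.2 ⟨hx, ?_⟩
    filter_upwards [Ioo_mem_nhdsLT hab'] with t ht using F'.x_pos t ht
  have hlog := (Real.tendsto_log_nhdsGT_zero.comp hx').eventually
    (eventually_lt_atBot ((ε * Real.log (x s) - 2 * B) / ε))
  obtain ⟨t, ht1, ht2⟩ := (hlog.and (Ioo_mem_nhdsLT hs.2)).exists
  have ht : t ∈ Ioo a' b := ⟨hs.1.trans ht2.1, ht2.2⟩
  have hfin := hmono hs ht ht2.1.le
  simp only [Function.comp_apply] at hfin ht1
  rw [lt_div_iff₀ hε] at ht1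
  linarith [(abs_le.1 (hB s hs)).1, (abs_le.1 (hB t ht)).2]

/-- Near the tip `L` is nearly `R v₁`, so `L > R / 2` forces `v₁ ≥ 0`. Then `x` is nondecreasing and
positive and cannot tend to 0. -/
lemma not_tendsto_tip_of_outward (F : Flow P a b x y u₁ u₂ w₁ w₂) (hab : a < b)
    (hx : Tendsto x (𝓝[<] b) (𝓝 0))
    (hL : Tendsto (fun t => angMom P.R (x t) (y t) (u₁ t) (u₂ t)) (𝓝[<] b) (𝓝 P.R)) :
    False := by
  have hR := P.R_pos
  have h1 : ∀ᶠ t in 𝓝[<] b, P.R / 2 < angMom P.R (x t) (y t) (u₁ t) (u₂ t) :=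
    hL.eventually (lt_mem_nhds (by linarith))
  have h2 : ∀ᶠ t in 𝓝[<] b, x t < P.R / 2 := hx.eventually (gt_mem_nhds (by linarith))
  obtain ⟨a', haa, hab', h⟩ := exists_Ioo_of_eventually hab (h1.and h2)
  have F' := F.mono haa le_rfl
  have hv : ∀ t ∈ Ioo a' b, ∀ v₁ v₂ : ℝ, v₁ ^ 2 + v₂ ^ 2 = 1 →
      P.R / 2 < angMom P.R (x t) (y t) v₁ v₂ → 0 ≤ v₁ := by
    intro t ht v₁ v₂ hv hlt
    have g1 := (abs_le.1 (abs_le_one_of_sq_add_sq hv).2).2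
    obtain ⟨-, -, hy⟩ := Profile.y_bounds (F'.x_pos t ht) (F'.x_lt t ht) (F'.lo t ht) (F'.hi t ht)
    unfold angMom at hlt
    have := F'.x_pos t ht
    have := (h t ht).2
    by_contra hneg
    nlinarith
  have hmono := F'.monotoneOn (fun _ x _ _ _ => x) (fun _ _ _ v₁ _ => v₁)
    (fun t _ v₁ _ _ => hasDerivAt_line (x t) v₁)
    (fun t ht => hv t ht _ _ (F'.unit_u t ht) (h t ht).1)
    (fun t ht => by
      obtain ⟨t', ht', heq⟩ := F'.exists_angMom_left ht
      exact hv t ht _ _ (F'.unit_w t ht) (heq ▸ (h t' ht').1))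
    (fun t _ => le_rfl)
  set s := (a' + b) / 2
  have hs : s ∈ Ioo a' b := ⟨by simp only [s]; linarith, by simp only [s]; linarith⟩
  obtain ⟨t, ht1, ht2⟩ := ((hx.eventually (gt_mem_nhds (F'.x_pos s hs))).and
    (Ioo_mem_nhdsLT hs.2)).exists
  exact absurd (hmono hs ⟨hs.1.trans ht2.1, ht2.2⟩ ht2.1.le) (not_le.2 ht1)

/-- The tangential approach along the lower arc. Its energy would tend to 0, whereas over a finite
time it can decrease only by a bounded factor. -/
lemma not_tendsto_tip_of_inward (F : Flow P a b x y u₁ u₂ w₁ w₂) (hab : a < b)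
    (hx : Tendsto x (𝓝[<] b) (𝓝 0))
    (hL : ∀ t ∈ Ioo a b, angMom P.R (x t) (y t) (u₁ t) (u₂ t) ≤ -P.R) : False := by
  have hR := P.R_pos
  have hK := P.K_pos
  have hB := P.powerBound_pos
  have hLsq : ∀ t ∈ Ioo a b, P.R ^ 2 ≤ angMom P.R (x t) (y t) (u₁ t) (u₂ t) ^ 2 := fun t ht => by
    nlinarith [hL t ht]
  -- From `m² + L² = ρ + R²` and `L² ≥ R²` one gets `ρ ≥ 0`, but the upper arc lies strictly inside
  -- the middle circle.
  have hg : ∀ t ∈ Ioo a b, y t < P.g (x t) := by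
    intro t ht
    refine lt_of_le_of_ne (F.hi t ht) fun heq => ?_
    have h1 := radMom_sq_add_angMom_sq P.R (x t) (y t) (F.unit_u t ht)
    have h2 := P.hi_inside _ (F.x_pos t ht) (F.x_lt t ht)
    rw [← heq] at h2
    unfold circlePower at h1
    nlinarith [hLsq t ht, sq_nonneg (radMom P.R (x t) (y t) (u₁ t) (u₂ t))]
  set C := 8 / P.R ^ 2 * (P.powerBound + 1) + 2 * P.K ^ 2 with hC
  -- Since `m² ≤ ρ = O(x²)`, the velocity component `u₂` is `O(x)`; so is the slope `f₁`, and the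
  -- height is `O(x²)`.
  have hE : ∀ t ∈ Ioo a b, P.energy (x t) (y t) (u₁ t) (u₂ t) ≤ C * x t ^ 2 := by
    intro t ht
    have hx0 := F.x_pos t ht
    have hxr := F.x_lt t ht
    have hu := F.unit_u t ht
    obtain ⟨hy0, hyK, hyR⟩ := Profile.y_bounds hx0 hxr (F.lo t ht) (F.hi t ht)
    have h1 := radMom_sq_add_angMom_sq P.R (x t) (y t) hu
    have h2 := (abs_le.1 (Profile.abs_circlePower_le hx0 hxr (F.lo t ht) (F.hi t ht))).2
    have h3 : radMom P.R (x t) (y t) (u₁ t) (u₂ t) ^ 2 ≤ P.powerBound * x t ^ 2 := by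
      linarith [hLsq t ht]
    have hu1 : u₁ t ^ 2 ≤ 1 := by nlinarith [sq_nonneg (u₂ t)]
    have h4 : ((P.R - y t) * u₂ t) ^ 2 ≤ 2 * (P.powerBound + 1) * x t ^ 2 := by
      have e : (P.R - y t) * u₂ t = x t * u₁ t - radMom P.R (x t) (y t) (u₁ t) (u₂ t) := by
        unfold radMom; ring
      rw [e]
      have : (x t * u₁ t) ^ 2 ≤ x t ^ 2 := by nlinarith [sq_nonneg (x t)]
      nlinarith [sq_nonneg (x t * u₁ t + radMom P.R (x t) (y t) (u₁ t) (u₂ t))]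
    have h5 : u₂ t ^ 2 ≤ 8 / P.R ^ 2 * (P.powerBound + 1) * x t ^ 2 := by
      have e1 : (P.R / 2) ^ 2 * u₂ t ^ 2 ≤ ((P.R - y t) * u₂ t) ^ 2 := by
        rw [mul_pow]
        gcongr
        linarith
      have e2 : 8 / P.R ^ 2 * (P.powerBound + 1) * x t ^ 2 =
          2 * (P.powerBound + 1) * x t ^ 2 / (P.R / 2) ^ 2 := by
        field_simp; ring
      rw [e2, le_div_iff₀ (by positivity)]
      linarith
    have h6 : (P.f1 (x t) * u₁ t) ^ 2 ≤ (P.K * x t) ^ 2 := by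
      rw [mul_pow]
      have e1 : P.f1 (x t) ^ 2 ≤ (P.K * x t) ^ 2 := by
        have := P.f1_le _ hx0 hxr
        have := P.f1_nonneg _ hx0 hxr
        gcongr
      nlinarith [sq_nonneg (P.f1 (x t))]
    have h7 : P.f2 (x t) * u₁ t ^ 2 * (y t - P.f (x t)) ≤ P.K * 1 * (P.K * x t ^ 2) := by
      have e1 := P.f2_le _ hx0 hxr
      have e2 := P.f_nonneg _ hx0 hxr
      have e3 : 0 ≤ y t - P.f (x t) := sub_nonneg.2 (F.lo t ht)
      gcongr
      linarith
    unfold Profile.energy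
    rw [hC]
    nlinarith [sq_nonneg (u₂ t + P.f1 (x t) * u₁ t)]
  obtain ⟨s, hs, hfs, -⟩ := F.exists_interior (t := (a + b) / 2)
    ⟨by linarith, by linarith⟩
  have hs' : s ∈ Ioo a b := ⟨by linarith [hs.1], hs.2⟩
  have hpos := Profile.energy_pos (F.x_pos s hs') (F.x_lt s hs') hfs (F.unit_u s hs')
  have hpos' := mul_pos (Real.exp_pos (P.K / P.c * s)) hpos
  have hlim : Tendsto (fun t => Real.exp (P.K / P.c * t) * (C * x t ^ 2)) (𝓝[<] b) (𝓝 0) := by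
    have h1 : Tendsto (fun t : ℝ => Real.exp (P.K / P.c * t)) (𝓝[<] b)
        (𝓝 (Real.exp (P.K / P.c * b))) :=
      ((by fun_prop : Continuous fun t : ℝ => Real.exp (P.K / P.c * t)).tendsto b).mono_left
        nhdsWithin_le_nhds
    simpa using h1.mul ((hx.pow 2).const_mul C)
  obtain ⟨t, ht1, ht2⟩ := ((hlim.eventually (gt_mem_nhds hpos')).and
    (Ioo_mem_nhdsLT hs.2)).exists
  have ht : t ∈ Ioo a b := ⟨hs'.1.trans ht2.1, ht2.2⟩
  have h1 := F.exp_energy_monotoneOn hg hs' ht ht2.1.le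
  have h2 := mul_le_mul_of_nonneg_left (hE t ht) (Real.exp_pos (P.K / P.c * t)).le
  simp only at h1
  linarith

/-- A trajectory does not converge to the tip. -/
lemma not_tendsto_tip (F : Flow P a b x y u₁ u₂ w₁ w₂) (hab : a < b)
    (hx : Tendsto x (𝓝[<] b) (𝓝 0)) : False := by
  have hR := P.R_pos
  obtain ⟨ℓ, hL, hle⟩ := F.exists_angMom_limit hab
  have hsq : ℓ ^ 2 ≤ P.R ^ 2 := by
    have h1 : Tendsto (fun t => P.powerBound * x t ^ 2 + P.R ^ 2) (𝓝[<] b) (𝓝 (P.R ^ 2)) := by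
      simpa using ((hx.pow 2).const_mul P.powerBound).add_const (P.R ^ 2)
    refine le_of_tendsto_of_tendsto (hL.pow 2) h1 ?_
    filter_upwards [Ioo_mem_nhdsLT hab] with t ht
    have h2 := radMom_sq_add_angMom_sq P.R (x t) (y t) (F.unit_u t ht)
    have h3 := (abs_le.1 (Profile.abs_circlePower_le (F.x_pos t ht) (F.x_lt t ht) (F.lo t ht)
      (F.hi t ht))).2
    nlinarith [sq_nonneg (radMom P.R (x t) (y t) (u₁ t) (u₂ t))]
  rcases hsq.lt_or_eq with h | h
  · exact F.not_tendsto_tip_of_sq_lt hab hx hL h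
  · rcases sq_eq_sq_iff_eq_or_eq_neg.1 h with h | h
    · exact F.not_tendsto_tip_of_outward hab hx (h ▸ hL)
    · exact F.not_tendsto_tip_of_inward hab hx (h ▸ hle)

/-! ### Limit points away from the tip -/

/-- A phase function that increases between collisions, vanishes at collisions and tends to zero
at the final time rules out collisions near the final time. -/
lemma no_contact_of_phase (F : Flow P a b x y u₁ u₂ w₁ w₂) (Φ D : ℝ → ℝ → ℝ → ℝ → ℝ)
    (hD : ∀ t ∈ Ioo a b, ∀ v₁ v₂ : ℝ, v₁ ^ 2 + v₂ ^ 2 = 1 →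
      HasDerivAt (fun h => Φ (x t + h * v₁) (y t + h * v₂) v₁ v₂)
        (D (x t) (y t) v₁ v₂) 0)
    (hmono : MonotoneOn (fun t => Φ (x t) (y t) (u₁ t) (u₂ t)) (Ioo a b))
    (hlim : Tendsto (fun t => Φ (x t) (y t) (u₁ t) (u₂ t)) (𝓝[<] b) (𝓝 0))
    (hpos : ∀ t ∈ Ioo a b, P.f (x t) < y t → y t < P.g (x t) → 0 < D (x t) (y t) (u₁ t) (u₂ t))
    {t : ℝ} (ht : t ∈ Ioo a b) : Φ (x t) (y t) (u₁ t) (u₂ t) ≠ 0 := by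
  intro h0
  -- After a contact the trajectory enters the interior, where `Φ` increases strictly. It then stays
  -- above a positive value, against its limit 0.
  obtain ⟨s, hs, hfs, hgs⟩ := F.exists_interior ht
  have hs' : s ∈ Ioo a b := ⟨ht.1.trans hs.1, hs.2⟩
  obtain ⟨s', hs1, hlt⟩ := F.exists_lt (fun _ => Φ) hs' (hD s hs' _ _ (F.unit_u s hs'))
    (hpos s hs' hfs hgs)
  have hs1' : s' ∈ Ioo a b := ⟨hs'.1.trans hs1.1, hs1.2⟩
  have h1 := hmono ht hs' hs.1.le
  simp only [h0] at h1
  obtain ⟨z, hz1, hz2⟩ := ((hlim.eventually (gt_mem_nhds (h1.trans_lt hlt))).and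
    (Ioo_mem_nhdsLT hs1.2)).exists
  exact absurd (hmono hs1' ⟨hs1'.1.trans hz2.1, hz2.2⟩ hz2.1.le) (not_le.2 hz1)

/-- The horn lies below the convex graph of `g`, so this arc is dispersing: with `η = g - y` the
derivative of `η η'` is `η'² + η g₂ v₁²`, a sum of nonnegative terms. -/
lemma eventually_interior_of_hi (F : Flow P a b x y u₁ u₂ w₁ w₂) (hab : a < b) {X Y : ℝ}
    (hx : Tendsto x (𝓝[<] b) (𝓝 X)) (hy : Tendsto y (𝓝[<] b) (𝓝 Y)) (hX0 : 0 < X)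
    (hXr : X < P.r) (hY : Y = P.g X) :
    ∀ᶠ t in 𝓝[<] b, P.f (x t) < y t ∧ y t < P.g (x t) := by
  have hfx := (P.hf X hX0 hXr).continuousAt.tendsto.comp hx
  have hgx := (P.hg X hX0 hXr).continuousAt.tendsto.comp hx
  have h1 : ∀ᶠ t in 𝓝[<] b, P.f (x t) < y t :=
    hfx.eventually_lt hy (by rw [hY]; exact P.f_lt_g X hX0 hXr)
  obtain ⟨a', haa, hab', h⟩ := exists_Ioo_of_eventually hab h1
  have F' := F.mono haa le_rfl
  have hDer : ∀ t ∈ Ioo a' b, ∀ v₁ v₂ : ℝ, v₁ ^ 2 + v₂ ^ 2 = 1 →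
      HasDerivAt (fun h => (P.g (x t + h * v₁) - (y t + h * v₂)) *
        (P.g1 (x t + h * v₁) * v₁ - v₂))
        ((P.g1 (x t) * v₁ - v₂) ^ 2 + (P.g (x t) - y t) * (P.g2 (x t) * v₁ ^ 2)) 0 := by
    intro t ht v₁ v₂ _
    have d1 := HasDerivAt.along_line (P.hg _ (F'.x_pos t ht) (F'.x_lt t ht)) v₁
    have d2 := HasDerivAt.along_line (P.hg1 _ (F'.x_pos t ht) (F'.x_lt t ht)) v₁
    refine ((d1.sub (hasDerivAt_line (y t) v₂)).mul
      ((d2.mul_const v₁).sub_const v₂)).congr_deriv ?_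
    simp; ring
  have hDnn : ∀ t ∈ Ioo a' b, ∀ v₁ v₂ : ℝ,
      0 ≤ (P.g1 (x t) * v₁ - v₂) ^ 2 + (P.g (x t) - y t) * (P.g2 (x t) * v₁ ^ 2) := by
    intro t ht v₁ v₂
    have e1 := P.g2_pos _ (F'.x_pos t ht) (F'.x_lt t ht)
    have e2 := sub_nonneg.2 (F'.hi t ht)
    positivity
  have hmono := F'.monotoneOn
    (fun _ x y v₁ v₂ => (P.g x - y) * (P.g1 x * v₁ - v₂))
    (fun _ x y v₁ v₂ => (P.g1 x * v₁ - v₂) ^ 2 + (P.g x - y) * (P.g2 x * v₁ ^ 2))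
    hDer (fun t ht => hDnn t ht _ _) (fun t ht => hDnn t ht _ _) (by
      intro t ht
      rcases F'.rule ht with ⟨-, -, h1, h2⟩ | ⟨hc, -⟩ | ⟨hc, -⟩
      · rw [h1, h2]
      · exact absurd hc (h t ht).ne'
      · simp [hc])
  have hlim : Tendsto (fun t => (P.g (x t) - y t) * (P.g1 (x t) * u₁ t - u₂ t)) (𝓝[<] b)
      (𝓝 0) := by
    refine squeeze_zero_norm' (a := fun t => (P.g (x t) - y t) * (P.K + 1)) ?_ ?_
    · filter_upwards [Ioo_mem_nhdsLT hab'] with t ht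
      rw [norm_mul, Real.norm_eq_abs, Real.norm_eq_abs,
        abs_of_nonneg (sub_nonneg.2 (F'.hi t ht))]
      have hx0 := F'.x_pos t ht
      have hxr := F'.x_lt t ht
      have e0 := sub_nonneg.2 (F'.hi t ht)
      have e1 := P.g1_le _ hx0 hxr
      have e2 := P.g1_nonneg _ hx0 hxr
      have e4 := P.r_le_one
      have e5 := P.K_pos
      obtain ⟨e6, e7⟩ := abs_le_one_of_sq_add_sq (F'.unit_u t ht)
      gcongr
      refine (abs_sub _ _).trans ?_
      rw [abs_mul, abs_of_nonneg e2]
      have : P.g1 (x t) * |u₁ t| ≤ P.K * 1 := by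
        gcongr
        nlinarith
      linarith
    · have := (hgx.sub hy).mul_const (P.K + 1)
      simpa [hY] using this
  filter_upwards [Ioo_mem_nhdsLT hab'] with t ht
  refine ⟨h t ht, lt_of_le_of_ne (F'.hi t ht) fun heq => ?_⟩
  refine F'.no_contact_of_phase (fun x y v₁ v₂ => (P.g x - y) * (P.g1 x * v₁ - v₂))
    (fun x y v₁ v₂ => (P.g1 x * v₁ - v₂) ^ 2 + (P.g x - y) * (P.g2 x * v₁ ^ 2))
    hDer hmono hlim ?_ ht (by simp [heq])
  intro s hs _ h2
  have e1 := P.g2_pos _ (F'.x_pos s hs) (F'.x_lt s hs)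
  have e2 := sub_pos.2 h2
  have e3 := F'.unit_u s hs
  rcases eq_or_ne (u₁ s) 0 with hz | hz
  · rw [hz] at e3 ⊢
    nlinarith
  · have : 0 < (P.g (x s) - y s) * (P.g2 (x s) * u₁ s ^ 2) := by positivity
    nlinarith [sq_nonneg (P.g1 (x s) * u₁ s - u₂ s)]

/-- On the focusing arc, with `η = y - f`, the derivative of `η η'` is `η'² - η f₂ v₁²`, that is,
twice the energy minus `3 η f₂ v₁²`. The energy stays away from 0 over a finite time while `η` tends
to 0, so this is finally positive. -/
lemma eventually_interior_of_lo (F : Flow P a b x y u₁ u₂ w₁ w₂) (hab : a < b) {X Y : ℝ}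
    (hx : Tendsto x (𝓝[<] b) (𝓝 X)) (hy : Tendsto y (𝓝[<] b) (𝓝 Y)) (hX0 : 0 < X)
    (hXr : X < P.r) (hY : Y = P.f X) :
    ∀ᶠ t in 𝓝[<] b, P.f (x t) < y t ∧ y t < P.g (x t) := by
  have hK := P.K_pos
  have hfx := (P.hf X hX0 hXr).continuousAt.tendsto.comp hx
  have hgx := (P.hg X hX0 hXr).continuousAt.tendsto.comp hx
  have h1 : ∀ᶠ t in 𝓝[<] b, y t < P.g (x t) :=
    hy.eventually_lt hgx (by rw [hY]; exact P.f_lt_g X hX0 hXr)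
  obtain ⟨a₁, haa₁, hab₁, hg₁⟩ := exists_Ioo_of_eventually hab h1
  have F₁ := F.mono haa₁ le_rfl
  obtain ⟨s, hs, hfs, -⟩ := F₁.exists_interior (t := (a₁ + b) / 2)
    ⟨by linarith, by linarith⟩
  have hs' : s ∈ Ioo a₁ b := ⟨by linarith [hs.1], hs.2⟩
  have hposE := Profile.energy_pos (F₁.x_pos s hs') (F₁.x_lt s hs') hfs (F₁.unit_u s hs')
  -- Dividing by the exponential at `b`, the largest on the interval, gives a lower bound for the
  -- energy at all later times.
  set E₀ := Real.exp (P.K / P.c * s) * P.energy (x s) (y s) (u₁ s) (u₂ s) /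
    Real.exp (P.K / P.c * b)
  have hE₀ : 0 < E₀ := by positivity
  have hE : ∀ t ∈ Ioo s b, E₀ ≤ P.energy (x t) (y t) (u₁ t) (u₂ t) := by
    intro t ht
    have ht' : t ∈ Ioo a₁ b := ⟨hs'.1.trans ht.1, ht.2⟩
    have h1 := F₁.exp_energy_monotoneOn hg₁ hs' ht' ht.1.le
    simp only at h1
    rw [div_le_iff₀ (Real.exp_pos _)]
    have h2 : Real.exp (P.K / P.c * t) ≤ Real.exp (P.K / P.c * b) := by
      apply Real.exp_le_exp.2
      have := P.c_pos
      have := ht.2.le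
      gcongr
    have h3 : 0 < P.energy (x t) (y t) (u₁ t) (u₂ t) := by
      by_contra hneg
      have := mul_nonpos_of_nonneg_of_nonpos (Real.exp_pos (P.K / P.c * t)).le (not_lt.1 hneg)
      have := mul_pos (Real.exp_pos (P.K / P.c * s)) hposE
      linarith
    nlinarith
  have h2 : ∀ᶠ t in 𝓝[<] b, 3 * P.K * (y t - P.f (x t)) < 2 * E₀ := by
    have : Tendsto (fun t => 3 * P.K * (y t - P.f (x t))) (𝓝[<] b) (𝓝 0) := by
      simpa [hY] using (hy.sub hfx).const_mul (3 * P.K)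
    exact this.eventually (gt_mem_nhds (by linarith))
  obtain ⟨a', hsa, hab', h⟩ := exists_Ioo_of_eventually hs.2 h2
  have F' := F₁.mono (hs'.1.le.trans hsa) le_rfl
  have hg' : ∀ t ∈ Ioo a' b, y t < P.g (x t) := fun t ht =>
    hg₁ t ⟨(hs'.1.trans_le hsa).trans ht.1, ht.2⟩
  have hE' : ∀ t ∈ Ioo a' b, E₀ ≤ P.energy (x t) (y t) (u₁ t) (u₂ t) := fun t ht =>
    hE t ⟨hsa.trans_lt ht.1, ht.2⟩
  have hDer : ∀ t ∈ Ioo a' b, ∀ v₁ v₂ : ℝ, v₁ ^ 2 + v₂ ^ 2 = 1 →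
      HasDerivAt (fun h => (y t + h * v₂ - P.f (x t + h * v₁)) *
        (v₂ - P.f1 (x t + h * v₁) * v₁))
        ((v₂ - P.f1 (x t) * v₁) ^ 2 - (y t - P.f (x t)) * (P.f2 (x t) * v₁ ^ 2)) 0 := by
    intro t ht v₁ v₂ _
    have d1 := HasDerivAt.along_line (P.hf _ (F'.x_pos t ht) (F'.x_lt t ht)) v₁
    have d2 := HasDerivAt.along_line (P.hf1 _ (F'.x_pos t ht) (F'.x_lt t ht)) v₁
    refine (((hasDerivAt_line (y t) v₂).sub d1).mul
      ((d2.mul_const v₁).const_sub v₂)).congr_deriv ?_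
    simp; ring
  have hDpos : ∀ t ∈ Ioo a' b, ∀ v₁ v₂ : ℝ, v₁ ^ 2 + v₂ ^ 2 = 1 →
      E₀ ≤ P.energy (x t) (y t) v₁ v₂ →
      0 < (v₂ - P.f1 (x t) * v₁) ^ 2 - (y t - P.f (x t)) * (P.f2 (x t) * v₁ ^ 2) := by
    intro t ht v₁ v₂ hv hle
    have e1 := P.f2_le _ (F'.x_pos t ht) (F'.x_lt t ht)
    have e2 := sub_nonneg.2 (F'.lo t ht)
    have e3 : v₁ ^ 2 ≤ 1 := by nlinarith [sq_nonneg v₂]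
    have e4 : P.f2 (x t) * v₁ ^ 2 * (y t - P.f (x t)) ≤ P.K * 1 * (y t - P.f (x t)) := by
      gcongr
    have e5 := h t ht
    unfold Profile.energy at hle
    nlinarith
  have hEw : ∀ t ∈ Ioo a' b, E₀ ≤ P.energy (x t) (y t) (w₁ t) (w₂ t) := by
    intro t ht
    refine (hE' t ht).trans ?_
    rcases F'.rule ht with ⟨-, -, h1, h2⟩ | ⟨hc, j, -, -, -, h3⟩ | ⟨hc, -⟩
    · rw [h1, h2]
    · simp only [Profile.energy, h3, hc, sub_self, mul_zero, neg_sq, le_refl]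
    · exact absurd hc (hg' t ht).ne
  have hmono := F'.monotoneOn
    (fun _ x y v₁ v₂ => (y - P.f x) * (v₂ - P.f1 x * v₁))
    (fun _ x y v₁ v₂ => (v₂ - P.f1 x * v₁) ^ 2 - (y - P.f x) * (P.f2 x * v₁ ^ 2))
    hDer (fun t ht => (hDpos t ht _ _ (F'.unit_u t ht) (hE' t ht)).le)
    (fun t ht => (hDpos t ht _ _ (F'.unit_w t ht) (hEw t ht)).le) (by
      intro t ht
      rcases F'.rule ht with ⟨-, -, h1, h2⟩ | ⟨hc, -⟩ | ⟨hc, -⟩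
      · rw [h1, h2]
      · simp [hc]
      · exact absurd hc (hg' t ht).ne)
  have hlim : Tendsto (fun t => (y t - P.f (x t)) * (u₂ t - P.f1 (x t) * u₁ t)) (𝓝[<] b)
      (𝓝 0) := by
    refine squeeze_zero_norm' (a := fun t => (y t - P.f (x t)) * (1 + P.K)) ?_ ?_
    · filter_upwards [Ioo_mem_nhdsLT hab'] with t ht
      rw [norm_mul, Real.norm_eq_abs, Real.norm_eq_abs,
        abs_of_nonneg (sub_nonneg.2 (F'.lo t ht))]
      have hx0 := F'.x_pos t ht
      have hxr := F'.x_lt t ht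
      have e0 := sub_nonneg.2 (F'.lo t ht)
      have e1 := P.f1_le _ hx0 hxr
      have e2 := P.f1_nonneg _ hx0 hxr
      have e4 := P.r_le_one
      obtain ⟨e6, e7⟩ := abs_le_one_of_sq_add_sq (F'.unit_u t ht)
      gcongr
      refine (abs_sub _ _).trans ?_
      rw [abs_mul, abs_of_nonneg e2]
      have : P.f1 (x t) * |u₁ t| ≤ P.K * 1 := by
        gcongr
        nlinarith
      linarith
    · have := (hy.sub hfx).mul_const (1 + P.K)
      simpa [hY] using this
  filter_upwards [Ioo_mem_nhdsLT hab'] with t ht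
  refine ⟨lt_of_le_of_ne (F'.lo t ht) fun heq => ?_, hg' t ht⟩
  exact F'.no_contact_of_phase (fun x y v₁ v₂ => (y - P.f x) * (v₂ - P.f1 x * v₁))
    (fun x y v₁ v₂ => (v₂ - P.f1 x * v₁) ^ 2 - (y - P.f x) * (P.f2 x * v₁ ^ 2))
    hDer hmono hlim
    (fun s hs _ _ => hDpos s hs _ _ (F'.unit_u s hs) (hE' s hs)) ht (by simp [heq])

/-- At unit speed `x + t` and `y + t` are nondecreasing, and in the horn they are bounded. -/
lemma exists_limit (F : Flow P a b x y u₁ u₂ w₁ w₂) (hab : a < b) :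
    ∃ X Y, Tendsto x (𝓝[<] b) (𝓝 X) ∧ Tendsto y (𝓝[<] b) (𝓝 Y) := by
  have hid : Tendsto (fun t : ℝ => t) (𝓝[<] b) (𝓝 b) := nhdsWithin_le_nhds
  have aux : ∀ z : ℝ → ℝ, MonotoneOn (fun t => z t + t) (Ioo a b) →
      (∀ t ∈ Ioo a b, z t ≤ P.r + P.R) → ∃ Z, Tendsto z (𝓝[<] b) (𝓝 Z) := by
    intro z hm hz
    have hbdd : BddAbove ((fun t => z t + t) '' Ioo a b) := by
      refine ⟨P.r + P.R + b, ?_⟩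
      rintro _ ⟨t, ht, rfl⟩
      exact add_le_add (hz t ht) ht.2.le
    have h := (hm.tendsto_nhdsWithin_Ioo_left (nonempty_Ioo.2 hab) hbdd).sub hid
    simp only [add_sub_cancel_right] at h
    exact ⟨_, h⟩
  have hu := fun t (ht : t ∈ Ioo a b) => abs_le_one_of_sq_add_sq (F.unit_u t ht)
  have hw := fun t (ht : t ∈ Ioo a b) => abs_le_one_of_sq_add_sq (F.unit_w t ht)
  obtain ⟨X, hX⟩ := aux x (F.monotoneOn (fun t x _ _ _ => x + t) (fun _ _ _ v₁ _ => v₁ + 1)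
    (fun t _ v₁ _ _ => (hasDerivAt_line _ _).add ((hasDerivAt_id (0 : ℝ)).const_add t))
    (fun t ht => by linarith [(abs_le.1 (hu t ht).1).1])
    (fun t ht => by linarith [(abs_le.1 (hw t ht).1).1]) (fun _ _ => le_rfl))
    (fun t ht => by linarith [F.x_lt t ht, P.R_pos])
  obtain ⟨Y, hY⟩ := aux y (F.monotoneOn (fun t _ y _ _ => y + t) (fun _ _ _ _ v₂ => v₂ + 1)
    (fun t _ _ v₂ _ => (hasDerivAt_line _ _).add ((hasDerivAt_id (0 : ℝ)).const_add t))
    (fun t ht => by linarith [(abs_le.1 (hu t ht).2).1])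
    (fun t ht => by linarith [(abs_le.1 (hw t ht).2).1]) (fun _ _ => le_rfl))
    (fun t ht => by
      have := (Profile.y_bounds (F.x_pos t ht) (F.x_lt t ht) (F.lo t ht) (F.hi t ht)).2.2
      linarith [P.r_pos, P.R_pos])
  exact ⟨X, Y, hX, hY⟩

/-- A trajectory that stays well inside the horn up to a final time converges to a point of the
horn other than the tip, and has no collisions near the final time. -/
lemma exists_limit_interior (F : Flow P a b x y u₁ u₂ w₁ w₂) (hab : a < b) {r' : ℝ}
    (hr' : r' < P.r) (hxr : ∀ t ∈ Ioo a b, x t ≤ r') :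
    ∃ X Y, Tendsto x (𝓝[<] b) (𝓝 X) ∧ Tendsto y (𝓝[<] b) (𝓝 Y) ∧ 0 < X ∧ X ≤ r' ∧
      P.f X ≤ Y ∧ Y ≤ P.g X ∧ ∀ᶠ t in 𝓝[<] b, P.f (x t) < y t ∧ y t < P.g (x t) := by
  obtain ⟨X, Y, hX, hY⟩ := F.exists_limit hab
  have hev : ∀ᶠ t in 𝓝[<] b, t ∈ Ioo a b := Ioo_mem_nhdsLT hab
  have hX0 : 0 ≤ X := ge_of_tendsto hX (hev.mono fun t ht => (F.x_pos t ht).le)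
  have hXr : X ≤ r' := le_of_tendsto hX (hev.mono hxr)
  have hXpos : 0 < X := by
    refine lt_of_le_of_ne hX0 fun h => ?_
    rw [← h] at hX
    exact F.not_tendsto_tip hab hX
  have hXP : X < P.r := hXr.trans_lt hr'
  have hfx := (P.hf X hXpos hXP).continuousAt.tendsto.comp hX
  have hgx := (P.hg X hXpos hXP).continuousAt.tendsto.comp hX
  have hf : P.f X ≤ Y := le_of_tendsto_of_tendsto hfx hY (hev.mono fun t ht => F.lo t ht)
  have hg : Y ≤ P.g X := le_of_tendsto_of_tendsto hY hgx (hev.mono fun t ht => F.hi t ht)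
  refine ⟨X, Y, hX, hY, hXpos, hXr, hf, hg, ?_⟩
  rcases hf.eq_or_lt with h | h
  · exact F.eventually_interior_of_lo hab hX hY hXpos hXP h.symm
  rcases hg.eq_or_lt with h' | h'
  · exact F.eventually_interior_of_hi hab hX hY hXpos hXP h'
  · exact (hfx.eventually_lt hY h).and (hY.eventually_lt hgx h')

/-- Without collisions the trajectory is a straight segment. -/
lemma straight (F : Flow P a b x y u₁ u₂ w₁ w₂)
    (h : ∀ t ∈ Ioo a b, P.f (x t) < y t ∧ y t < P.g (x t)) {s t : ℝ} (hs : s ∈ Ioo a b)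
    (ht : t ∈ Ioo a b) : u₁ t = u₁ s ∧ u₂ t = u₂ s ∧ x t - t * u₁ t = x s - s * u₁ s ∧
      y t - t * u₂ t = y s - s * u₂ s := by
  have hfree : ∀ t ∈ Ioo a b, u₁ t = w₁ t ∧ u₂ t = w₂ t := fun t ht =>
    F.free t ht (h t ht).1 (h t ht).2
  have aux : ∀ Φ : ℝ → ℝ → ℝ → ℝ → ℝ → ℝ, (∀ t x y v₁ v₂ h : ℝ,
      Φ (t + h) (x + h * v₁) (y + h * v₂) v₁ v₂ = Φ t x y v₁ v₂) →
      MonotoneOn (fun t => Φ t (x t) (y t) (u₁ t) (u₂ t)) (Ioo a b) := by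
    intro Φ hΦ
    refine F.monotoneOn Φ (fun _ _ _ _ _ => 0) ?_ (fun _ _ => le_rfl) (fun _ _ => le_rfl) ?_
    · intro t _ v₁ v₂ _
      simp only [hΦ]
      exact hasDerivAt_const _ _
    · intro t ht
      rw [(hfree t ht).1, (hfree t ht).2]
  have aux2 : ∀ Φ : ℝ → ℝ → ℝ → ℝ → ℝ → ℝ, (∀ t x y v₁ v₂ h : ℝ,
      Φ (t + h) (x + h * v₁) (y + h * v₂) v₁ v₂ = Φ t x y v₁ v₂) →
      Φ t (x t) (y t) (u₁ t) (u₂ t) = Φ s (x s) (y s) (u₁ s) (u₂ s) := by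
    intro Φ hΦ
    have m1 := aux Φ hΦ
    have m2 := aux (fun t x y v₁ v₂ => -Φ t x y v₁ v₂) (fun t x y v₁ v₂ h => by rw [hΦ])
    rcases le_total s t with hst | hst
    · have a1 := m1 hs ht hst; have a2 := m2 hs ht hst; simp only at a1 a2; linarith
    · have a1 := m1 ht hs hst; have a2 := m2 ht hs hst; simp only at a1 a2; linarith
  exact ⟨aux2 (fun _ _ _ v₁ _ => v₁) (fun _ _ _ _ _ _ => rfl),
    aux2 (fun _ _ _ _ v₂ => v₂) (fun _ _ _ _ _ _ => rfl),
    aux2 (fun t x _ v₁ _ => x - t * v₁) (fun _ _ _ _ _ _ => by ring),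
    aux2 (fun t _ y _ v₂ => y - t * v₂) (fun _ _ _ _ _ _ => by ring)⟩

end Flow

/-! ### Estimates for graphs tangent to the axis -/

lemma le_of_hasDerivAt_le {ψ χ ψ' χ' : ℝ → ℝ} {x : ℝ} (hx : 0 ≤ x)
    (hψ : ∀ z ∈ Icc 0 x, HasDerivAt ψ (ψ' z) z) (hχ : ∀ z ∈ Icc 0 x, HasDerivAt χ (χ' z) z)
    (hle : ∀ z ∈ Icc 0 x, ψ' z ≤ χ' z) (h0 : ψ 0 = χ 0) : ψ x ≤ χ x := by
  have hmono : MonotoneOn (fun z => χ z - ψ z) (Icc 0 x) := by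
    refine monotoneOn_of_deriv_nonneg (convex_Icc _ _)
      (fun z hz => ((hχ z hz).sub (hψ z hz)).continuousAt.continuousWithinAt)
      (fun z hz => ?_) (fun z hz => ?_)
    · exact ((hχ z (interior_subset hz)).sub
        (hψ z (interior_subset hz))).differentiableAt.differentiableWithinAt
    · have := ((hχ z (interior_subset hz)).fun_sub (hψ z (interior_subset hz))).deriv
      rw [this]
      exact sub_nonneg.2 (hle z (interior_subset hz))
  have := hmono (left_mem_Icc.2 hx) (right_mem_Icc.2 hx) hx
  simp only [h0, sub_self] at this
  linarith

/-- The second derivative is within `ε` of `k` by continuity; integrating once and twice from 0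
gives the bounds for slope and height. -/
lemma graph_estimates {φ : ℝ → ℝ} {k ε : ℝ} (hφ : ContDiffAt ℝ 3 φ 0) (h0 : φ 0 = 0)
    (h1 : deriv φ 0 = 0) (h2 : deriv (deriv φ) 0 = k) (hε : 0 < ε) :
    ∀ᶠ r in 𝓝[>] (0 : ℝ), ∀ x, 0 < x → x < r →
      HasDerivAt φ (deriv φ x) x ∧ HasDerivAt (deriv φ) (deriv (deriv φ) x) x ∧
      HasDerivAt (deriv (deriv φ)) (deriv (deriv (deriv φ)) x) x ∧
      k - ε ≤ deriv (deriv φ) x ∧ deriv (deriv φ) x ≤ k + ε ∧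
      |deriv (deriv (deriv φ)) x| ≤ |deriv (deriv (deriv φ)) 0| + 1 ∧
      (k - ε) * x ≤ deriv φ x ∧ deriv φ x ≤ (k + ε) * x ∧
      (k - ε) * (x ^ 2 / 2) ≤ φ x ∧ φ x ≤ (k + ε) * (x ^ 2 / 2) := by
  have hφ1 : ContDiffAt ℝ 2 (deriv φ) 0 := hφ.derivWithin (by norm_num)
  have hφ2 : ContDiffAt ℝ 1 (deriv (deriv φ)) 0 := hφ1.derivWithin (by norm_num)
  have hφ3 : ContDiffAt ℝ 0 (deriv (deriv (deriv φ))) 0 := hφ2.derivWithin (by norm_num)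
  have e0 := (hφ.eventually (by decide)).mono fun x hx =>
    (hx.differentiableAt (by norm_num)).hasDerivAt
  have e1 := (hφ1.eventually (by decide)).mono fun x hx =>
    (hx.differentiableAt (by norm_num)).hasDerivAt
  have e2 := (hφ2.eventually (by decide)).mono fun x hx =>
    (hx.differentiableAt (by norm_num)).hasDerivAt
  have e3 : ∀ᶠ x in 𝓝 (0 : ℝ), deriv (deriv φ) x ∈ Icc (k - ε) (k + ε) :=
    hφ2.continuousAt.eventually (Icc_mem_nhds (by rw [h2]; linarith) (by rw [h2]; linarith))
  have e4 : ∀ᶠ x in 𝓝 (0 : ℝ), |deriv (deriv (deriv φ)) x| < |deriv (deriv (deriv φ)) 0| + 1 :=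
    hφ3.continuousAt.abs.eventually (gt_mem_nhds (by linarith))
  obtain ⟨ρ, hρ, hall⟩ := Metric.eventually_nhds_iff.1
    (e0.and (e1.and (e2.and (e3.and e4))))
  filter_upwards [Ioo_mem_nhdsGT hρ] with r hr x hx0 hxr
  have hz : ∀ z ∈ Icc 0 x, dist z 0 < ρ := by
    intro z hz
    rw [Real.dist_eq, sub_zero, abs_of_nonneg hz.1]
    linarith [hz.2, hr.2]
  have d1 : ∀ c : ℝ, ∀ z ∈ Icc 0 x, HasDerivAt (fun z => c * z) c z := fun c z _ => by
    simpa using (hasDerivAt_id z).const_mul c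
  have d2 : ∀ c : ℝ, ∀ z ∈ Icc 0 x, HasDerivAt (fun z => c * (z ^ 2 / 2)) (c * z) z :=
      fun c z _ => by
    refine (((hasDerivAt_pow 2 z).div_const 2).const_mul c).congr_deriv ?_
    simp
  have hlo : ∀ z ∈ Icc 0 x, (k - ε) * z ≤ deriv φ z := by
    intro z hzx
    have hs : Icc 0 z ⊆ Icc 0 x := Icc_subset_Icc_right hzx.2
    exact le_of_hasDerivAt_le hzx.1 (fun y hy => d1 _ y (hs hy))
      (fun y hy => (hall (hz y (hs hy))).2.1) (fun y hy => (hall (hz y (hs hy))).2.2.2.1.1)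
      (by simp [h1])
  have hhi : ∀ z ∈ Icc 0 x, deriv φ z ≤ (k + ε) * z := by
    intro z hzx
    have hs : Icc 0 z ⊆ Icc 0 x := Icc_subset_Icc_right hzx.2
    exact le_of_hasDerivAt_le hzx.1 (fun y hy => (hall (hz y (hs hy))).2.1)
      (fun y hy => d1 _ y (hs hy)) (fun y hy => (hall (hz y (hs hy))).2.2.2.1.2)
      (by simp [h1])
  have hx : x ∈ Icc 0 x := right_mem_Icc.2 hx0.le
  obtain ⟨a0, a1, a2, a3, a4⟩ := hall (hz x hx)
  refine ⟨a0, a1, a2, a3.1, a3.2, a4.le, hlo x hx, hhi x hx, ?_, ?_⟩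
  · exact le_of_hasDerivAt_le hx0.le (d2 _) (fun y hy => (hall (hz y hy)).1) hlo (by simp [h0])
  · exact le_of_hasDerivAt_le hx0.le (fun y hy => (hall (hz y hy)).1) (d2 _) hhi (by simp [h0])

lemma eventually_mul_lt (C : ℝ) {δ : ℝ} (hδ : 0 < δ) : ∀ᶠ r in 𝓝[>] (0 : ℝ), C * r < δ := by
  have : Tendsto (fun r : ℝ => C * r) (𝓝 0) (𝓝 0) := by
    simpa using (continuous_const_mul C).tendsto (0 : ℝ)
  exact (this.eventually (gt_mem_nhds hδ)).filter_mono nhdsWithin_le_nhds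

set_option maxHeartbeats 800000 in
-- `R` lies strictly between `1/k₂` and `1/k₁`, so the margins `α = 1 - R k₁` and `β = R k₂ - 1` are
-- positive. They are the leading coefficients of the torques, and `c` keeps what remains after the
-- errors in `ε` and `r`.
lemma exists_profile {f g : ℝ → ℝ} {k₁ k₂ : ℝ} (hf : ContDiffAt ℝ 3 f 0)
    (hg : ContDiffAt ℝ 3 g 0) (hf0 : f 0 = 0) (hg0 : g 0 = 0) (hf1 : deriv f 0 = 0)
    (hg1 : deriv g 0 = 0) (hf2 : deriv (deriv f) 0 = k₁) (hg2 : deriv (deriv g) 0 = k₂)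
    (hk₁ : 0 < k₁) (hk : k₁ < k₂) {δ : ℝ} (hδ : 0 < δ) :
    ∃ P : Profile, P.f = f ∧ P.g = g ∧ P.f1 = deriv f ∧ P.g1 = deriv g ∧
      P.R = (k₁⁻¹ + k₂⁻¹) / 2 ∧ P.r < δ := by
  have hk₂ : 0 < k₂ := hk₁.trans hk
  set R := (k₁⁻¹ + k₂⁻¹) / 2 with hRdef
  have hR : 0 < R := by positivity
  have hinv : k₂⁻¹ < k₁⁻¹ := (inv_lt_inv₀ hk₂ hk₁).2 hk
  set α := 1 - R * k₁ with hα
  set β := R * k₂ - 1 with hβ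
  have hα0 : 0 < α := by
    have : R * k₁ < k₁⁻¹ * k₁ := by
      apply mul_lt_mul_of_pos_right _ hk₁; linarith
    rw [inv_mul_cancel₀ hk₁.ne'] at this
    linarith
  have hβ0 : 0 < β := by
    have : k₂⁻¹ * k₂ < R * k₂ := by
      apply mul_lt_mul_of_pos_right _ hk₂; linarith
    rw [inv_mul_cancel₀ hk₂.ne'] at this
    linarith
  obtain ⟨ε, hε, hε1, hε2, hε3, hε4⟩ : ∃ ε > 0, ε < k₁ / 2 ∧ 2 * ε < k₂ - k₁ ∧ R * ε < α / 2 ∧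
      R * ε < β / 4 := by
    have t1 := eventually_mul_lt 1 (show 0 < k₁ / 2 by positivity)
    have t2 := eventually_mul_lt 2 (show 0 < k₂ - k₁ by linarith)
    have t3 := eventually_mul_lt R (show 0 < α / 2 by positivity)
    have t4 := eventually_mul_lt R (show 0 < β / 4 by positivity)
    obtain ⟨ε, h0, h1, h2, h3, h4⟩ :=
      (eventually_mem_nhdsWithin.and (t1.and (t2.and (t3.and t4)))).exists
    exact ⟨ε, h0, by linarith, h2, h3, h4⟩
  set K := k₂ + ε + |deriv (deriv (deriv f)) 0| + 1 with hK
  have hK2 : k₂ + ε ≤ K := by linarith [abs_nonneg (deriv (deriv (deriv f)) 0)]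
  have hK0 : 0 < K := by linarith
  obtain ⟨r, hr0, hef, heg, hr1, hrR, hrδ, hKr, hsm, hKr2, hKr3⟩ :=
    (eventually_mem_nhdsWithin.and ((graph_estimates hf hf0 hf1 hf2 hε).and
    ((graph_estimates hg hg0 hg1 hg2 hε).and ((eventually_mul_lt 1 one_pos).and
    ((eventually_mul_lt 1 hR).and ((eventually_mul_lt 1 hδ).and
    ((eventually_mul_lt K (half_pos hR)).and
    ((eventually_mul_lt ((1 + 2 * R * K) / R + (1 + 2 * R * K) + (1 + 2 * R * K) ^ 2 / 4 +
      2 * (1 + R) / R) (half_pos hR)).and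
    ((eventually_mul_lt (K * k₂) (show 0 < β / 4 by positivity)).and
    (eventually_mul_lt (K ^ 2) (show 0 < β / 2 by positivity))))))))))).exists
  rw [one_mul] at hr1 hrR hrδ
  have hr0 : 0 < r := hr0
  set c := min (k₁ / 2) (min (α / 2) (β / 4))
  have hc0 : 0 < c := lt_min (by positivity) (lt_min (by positivity) (by positivity))
  have hc1 : c ≤ k₁ / 2 := min_le_left _ _
  have hc2 : c ≤ α / 2 := (min_le_right _ _).trans (min_le_left _ _)
  have hc3 : c ≤ β / 4 := (min_le_right _ _).trans (min_le_right _ _)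
  have sq_le : ∀ x, 0 < x → x < r → x ^ 2 ≤ r := fun x h0 hr => by
    calc x ^ 2 = x * x := sq x
      _ ≤ r * 1 := mul_le_mul hr.le (hr.le.trans hr1.le) h0.le hr0.le
      _ = r := mul_one r
  have f_nonneg : ∀ x, 0 < x → x < r → 0 ≤ f x := fun x h0 hr => by
    have := (hef x h0 hr).2.2.2.2.2.2.2.2.1
    have : 0 ≤ (k₁ - ε) * (x ^ 2 / 2) := mul_nonneg (by linarith) (by positivity)
    linarith
  have f1_nonneg : ∀ x, 0 < x → x < r → 0 ≤ deriv f x := fun x h0 hr => by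
    have := (hef x h0 hr).2.2.2.2.2.2.1
    have : 0 ≤ (k₁ - ε) * x := mul_nonneg (by linarith) h0.le
    linarith
  have g1_nonneg : ∀ x, 0 < x → x < r → 0 ≤ deriv g x := fun x h0 hr => by
    have := (heg x h0 hr).2.2.2.2.2.2.1
    have : 0 ≤ (k₂ - ε) * x := mul_nonneg (by linarith) h0.le
    linarith
  have g_nonneg : ∀ x, 0 < x → x < r → 0 ≤ g x := fun x h0 hr => by
    have := (heg x h0 hr).2.2.2.2.2.2.2.2.1
    have : 0 ≤ (k₂ - ε) * (x ^ 2 / 2) := mul_nonneg (by linarith) (by positivity)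
    linarith
  have g_le : ∀ x, 0 < x → x < r → g x ≤ K * x ^ 2 := fun x h0 hr => by
    have h1 := (heg x h0 hr).2.2.2.2.2.2.2.2.2
    have : (k₂ + ε) * (x ^ 2 / 2) ≤ K * (x ^ 2 / 2) := by gcongr
    have : 0 ≤ K * (x ^ 2 / 2) := by positivity
    linarith
  refine ⟨{
    f := f, f1 := deriv f, f2 := deriv (deriv f), f3 := deriv (deriv (deriv f))
    g := g, g1 := deriv g, g2 := deriv (deriv g), R := R, c := c, K := K, r := r
    R_pos := hR, c_pos := hc0, K_pos := hK0, r_pos := hr0, r_le_one := hr1.le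
    r_le_R := hrR.le, K_r := hKr.le, small := hsm.le
    hf := fun x h0 hr => (hef x h0 hr).1
    hf1 := fun x h0 hr => (hef x h0 hr).2.1
    hf2 := fun x h0 hr => (hef x h0 hr).2.2.1
    hg := fun x h0 hr => (heg x h0 hr).1
    hg1 := fun x h0 hr => (heg x h0 hr).2.1
    f_nonneg := f_nonneg
    f_lt_g := fun x h0 hr => by
      have h1 := (hef x h0 hr).2.2.2.2.2.2.2.2.2
      have h2 := (heg x h0 hr).2.2.2.2.2.2.2.2.1
      have : (k₁ + ε) * (x ^ 2 / 2) < (k₂ - ε) * (x ^ 2 / 2) :=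
        mul_lt_mul_of_pos_right (by linarith) (by positivity)
      linarith
    g_le := g_le
    f1_nonneg := f1_nonneg
    f1_le := fun x h0 hr => (hef x h0 hr).2.2.2.2.2.2.2.1.trans
      (mul_le_mul_of_nonneg_right (by linarith) h0.le)
    g1_nonneg := g1_nonneg
    g1_le := fun x h0 hr => (heg x h0 hr).2.2.2.2.2.2.2.1.trans
      (mul_le_mul_of_nonneg_right hK2 h0.le)
    f2_ge := fun x h0 hr => by linarith [(hef x h0 hr).2.2.2.1]
    f2_le := fun x h0 hr => by linarith [(hef x h0 hr).2.2.2.2.1]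
    f3_le := fun x h0 hr => by linarith [(hef x h0 hr).2.2.2.2.2.1]
    g2_pos := fun x h0 hr => by linarith [(heg x h0 hr).2.2.2.1]
    lo_torque := fun x h0 hr => by
      have h1 := (hef x h0 hr).2.2.2.2.2.2.2.1
      have h2 := mul_nonneg (f_nonneg x h0 hr) (f1_nonneg x h0 hr)
      have h3 := mul_le_mul_of_nonneg_left h1 hR.le
      have h4 : c * x ≤ (1 - R * (k₁ + ε)) * x :=
        mul_le_mul_of_nonneg_right (by linarith) h0.le
      linarith
    hi_torque := fun x h0 hr => by
      have h1 := (heg x h0 hr).2.2.2.2.2.2.1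
      have h2 := g_le x h0 hr
      have h3 := g_nonneg x h0 hr
      have hx2 := sq_le x h0 hr
      have h4 : g x ≤ K * r := h2.trans (by gcongr)
      have h5 : g x ≤ R / 2 := h4.trans hKr.le
      have h6 : (R - g x) * ((k₂ - ε) * x) ≤ (R - g x) * deriv g x :=
        mul_le_mul_of_nonneg_left h1 (by linarith)
      have h7 : g x * (k₂ - ε) ≤ K * r * k₂ := by
        have : 0 ≤ K * r := by positivity
        calc g x * (k₂ - ε) ≤ K * r * (k₂ - ε) :=
              mul_le_mul_of_nonneg_right h4 (by linarith)
          _ ≤ K * r * k₂ := by gcongr; linarith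
      have h8 : c * x ≤ (R * (k₂ - ε) - g x * (k₂ - ε) - 1) * x :=
        mul_le_mul_of_nonneg_right (by linarith) h0.le
      linarith
    hi_inside := fun x h0 hr => by
      have h1 := (heg x h0 hr).2.2.2.2.2.2.2.2.1
      have h2 := g_le x h0 hr
      have h3 := g_nonneg x h0 hr
      have hx2 := sq_le x h0 hr
      have h4 : g x ^ 2 ≤ (K ^ 2 * r) * x ^ 2 := by
        calc g x ^ 2 ≤ (K * x ^ 2) ^ 2 := by gcongr
          _ = K ^ 2 * x ^ 2 * x ^ 2 := by ring
          _ ≤ _ := by gcongr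
      have h5 := mul_le_mul_of_nonneg_left h1 (show 0 ≤ 2 * R by positivity)
      have h6 : (1 + K ^ 2 * r) * x ^ 2 < R * (k₂ - ε) * x ^ 2 :=
        mul_lt_mul_of_pos_right (by linarith) (by positivity)
      linarith }, rfl, rfl, rfl, rfl, rfl, hrδ⟩

/-! ### Smooth arcs as graphs -/

/-- By induction: extend the derivative and integrate, starting from the constant extension of a
continuous function. This replaces one-sided derivatives at the end-point by ordinary ones. -/
lemma exists_contDiff_extension {E : Type*} [NormedAddCommGroup E] [NormedSpace ℝ E]
    [CompleteSpace E] {ℓ : ℝ} (hℓ : 0 < ℓ) (n : ℕ) :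
    ∀ f : ℝ → E, ContDiffOn ℝ n f (Icc 0 ℓ) →
      ∃ g : ℝ → E, ContDiff ℝ n g ∧ EqOn f g (Icc 0 ℓ) := by
  have hu : UniqueDiffOn ℝ (Icc 0 ℓ) := uniqueDiffOn_Icc hℓ
  induction n with
  | zero =>
    intro f hf
    refine ⟨IccExtend hℓ.le ((Icc 0 ℓ).domRestrict f), ?_, fun x hx => ?_⟩
    · rw [Nat.cast_zero, contDiff_zero]
      exact (continuousOn_iff_continuous_domRestrict.1 hf.continuousOn).Icc_extend'
    · rw [IccExtend_of_mem _ _ hx]; rfl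
  | succ n ih =>
    intro f hf
    obtain ⟨g₁, hg₁, heq⟩ := ih (derivWithin f (Icc 0 ℓ))
      (hf.derivWithin hu (by push_cast; exact le_rfl))
    have hder : ∀ x, HasDerivAt (fun x => f 0 + ∫ z in (0 : ℝ)..x, g₁ z) (g₁ x) x := fun x =>
      (hg₁.continuous.integral_hasStrictDerivAt 0 x).hasDerivAt.const_add _
    refine ⟨fun x => f 0 + ∫ z in (0 : ℝ)..x, g₁ z, ?_, ?_⟩
    · push_cast
      rw [contDiff_succ_iff_deriv]
      refine ⟨fun x => (hder x).differentiableAt, fun h => absurd h (by simp), ?_⟩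
      rw [show deriv (fun x => f 0 + ∫ z in (0 : ℝ)..x, g₁ z) = g₁ from
        funext fun x => (hder x).deriv]
      exact hg₁
    · refine eq_of_derivWithin_eq (hf.differentiableOn (by simp))
        (fun x _ => (hder x).differentiableAt.differentiableWithinAt) ?_ (by simp)
      intro x hx
      have hx' := Ico_subset_Icc_self hx
      rw [(hder x).hasDerivWithinAt.derivWithin (hu x hx'), heq hx']

/-- The inverse function theorem gives `f = Y ∘ X⁻¹` locally. Differentiating `Y' = f'(X) X'` at 0,
where `f' = 0` and `X' = 1`, gives `Y'' = f''`. -/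
lemma exists_graph {X Y : ℝ → ℝ} (hX : ContDiff ℝ 3 X) (hY : ContDiff ℝ 3 Y) (hX0 : X 0 = 0)
    (hY0 : Y 0 = 0) (hX1 : deriv X 0 = 1) (hY1 : deriv Y 0 = 0) :
    ∃ f : ℝ → ℝ, ContDiffAt ℝ 3 f 0 ∧ f 0 = 0 ∧ deriv f 0 = 0 ∧
      deriv (deriv f) 0 = deriv (deriv Y) 0 ∧
      ∀ᶠ s in 𝓝 0, Y s = f (X s) ∧ deriv Y s = deriv f (X s) * deriv X s ∧ 1 / 2 < deriv X s := by
  have hXd : ∀ s, HasDerivAt X (deriv X s) s := fun s =>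
    (hX.differentiable (by norm_num) s).hasDerivAt
  have hF : HasFDerivAt X ((ContinuousLinearEquiv.refl ℝ ℝ : ℝ ≃L[ℝ] ℝ) : ℝ →L[ℝ] ℝ) 0 := by
    have := (hXd 0).hasFDerivAt
    rw [hX1] at this
    refine this.congr_fderiv ?_
    ext; simp
  have hne : (3 : WithTop ℕ∞) ≠ 0 := by norm_num
  set S := hX.contDiffAt.localInverse hF hne
  have hS : ContDiffAt ℝ 3 S 0 := by
    have := hX.contDiffAt.to_localInverse hF hne
    rwa [hX0] at this
  have hinv : ∀ᶠ s in 𝓝 0, S (X s) = s :=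
    (hX.contDiffAt.hasStrictFDerivAt' hF hne).eventually_left_inverse
  have hS0 : S 0 = 0 := by simpa [hX0] using hinv.self_of_nhds
  have hf : ContDiffAt ℝ 3 (Y ∘ S) 0 := hY.contDiffAt.comp 0 hS
  have hXc : Tendsto X (𝓝 0) (𝓝 0) := by simpa [hX0] using hX.continuous.tendsto 0
  have hYf : ∀ᶠ s in 𝓝 0, Y s = (Y ∘ S) (X s) := hinv.mono fun s hs => by simp [hs]
  have hfd : ∀ᶠ s in 𝓝 0, DifferentiableAt ℝ (Y ∘ S) (X s) :=
    hXc.eventually ((hf.eventually (by decide)).mono fun x hx => hx.differentiableAt hne)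
  have hY' : ∀ᶠ s in 𝓝 0, deriv Y s = deriv (Y ∘ S) (X s) * deriv X s := by
    filter_upwards [hYf.eventually_nhds, hfd] with s h1 h2
    have h3 : Y =ᶠ[𝓝 s] (Y ∘ S) ∘ X := h1
    rw [h3.deriv_eq]
    exact (h2.hasDerivAt.comp s (hXd s)).deriv
  have hf1 : deriv (Y ∘ S) 0 = 0 := by
    have := hY'.self_of_nhds
    rw [hX0, hX1, hY1] at this
    linarith
  refine ⟨Y ∘ S, hf, by simp [hS0, hY0], hf1, ?_, ?_⟩
  · have hf' : ContDiffAt ℝ 2 (deriv (Y ∘ S)) 0 := hf.derivWithin (by norm_num)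
    have hX' : ContDiffAt ℝ 2 (deriv X) 0 := hX.contDiffAt.derivWithin (by norm_num)
    have e1 : HasDerivAt (deriv (Y ∘ S)) (deriv (deriv (Y ∘ S)) 0) (X 0) := by
      rw [hX0]; exact (hf'.differentiableAt (by norm_num)).hasDerivAt
    have e2 := (e1.comp 0 (hXd 0)).mul (hX'.differentiableAt (by norm_num)).hasDerivAt
    have e3 : deriv Y =ᶠ[𝓝 0] (deriv (Y ∘ S) ∘ X) * deriv X := hY'
    rw [e3.deriv_eq, e2.deriv, hX1]
    simp [hX0, hf1]
  · have h3 : ∀ᶠ s in 𝓝 0, 1 / 2 < deriv X s := by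
      have : Continuous (deriv X) := hX.continuous_deriv (by norm_num)
      exact this.continuousAt.eventually (lt_mem_nhds (by rw [hX1]; norm_num))
    exact hYf.and (hY'.and h3)

/-! ### Frames in the plane -/

lemma inner_eq (a b : Plane) : inner ℝ a b = a 0 * b 0 + a 1 * b 1 := by
  rw [EuclideanSpace.inner_eq_star_dotProduct]
  simp [dotProduct, Fin.sum_univ_two, mul_comm]

@[simp] lemma rot_zero (a : Plane) : rot a 0 = -a 1 := rfl

@[simp] lemma rot_one (a : Plane) : rot a 1 = a 0 := rfl

/-- An orthonormal frame `e, σ • rot e`, where `σ = ±1`. -/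
structure Frame where
  e : Plane
  σ : ℝ
  unit : e 0 ^ 2 + e 1 ^ 2 = 1
  σ_sq : σ * σ = 1

namespace Frame

variable (B : Frame)

/-- The first coordinate of a vector. -/
def X (v : Plane) : ℝ := inner ℝ v B.e

/-- The second coordinate of a vector. -/
def Y (v : Plane) : ℝ := B.σ * inner ℝ v (rot B.e)

lemma X_add (v w : Plane) : B.X (v + w) = B.X v + B.X w := inner_add_left _ _ _

lemma Y_add (v w : Plane) : B.Y (v + w) = B.Y v + B.Y w := by
  simp only [Y, inner_add_left, mul_add]

lemma X_sub (v w : Plane) : B.X (v - w) = B.X v - B.X w := inner_sub_left _ _ _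

lemma Y_sub (v w : Plane) : B.Y (v - w) = B.Y v - B.Y w := by
  simp only [Y, inner_sub_left, mul_sub]

lemma X_smul (c : ℝ) (v : Plane) : B.X (c • v) = c * B.X v := by
  simp only [X, real_inner_smul_left]

lemma Y_smul (c : ℝ) (v : Plane) : B.Y (c • v) = c * B.Y v := by
  simp only [Y, real_inner_smul_left]; ring

lemma continuous_X : Continuous B.X := by unfold X; fun_prop

lemma continuous_Y : Continuous B.Y := by unfold Y; fun_prop

lemma ext {v w : Plane} (hX : B.X v = B.X w) (hY : B.Y v = B.Y w) : v = w := by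
  simp only [X, Y, inner_eq, rot_zero, rot_one] at hX hY
  have h := B.unit
  have hs := B.σ_sq
  have hY' : v 0 * -B.e 1 + v 1 * B.e 0 = w 0 * -B.e 1 + w 1 * B.e 0 := by
    linear_combination B.σ * hY + (w 0 * -B.e 1 + w 1 * B.e 0 - v 0 * -B.e 1 - v 1 * B.e 0) * hs
  ext i
  fin_cases i
  · simp only [Fin.zero_eta]
    linear_combination B.e 0 * hX - B.e 1 * hY' + (w 0 - v 0) * h
  · simp only [Fin.mk_one]
    linear_combination B.e 1 * hX + B.e 0 * hY' + (w 1 - v 1) * h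

lemma inner_eq_coords (v w : Plane) : inner ℝ v w = B.X v * B.X w + B.Y v * B.Y w := by
  simp only [X, Y, inner_eq, rot_zero, rot_one]
  have h := B.unit
  have hs := B.σ_sq
  linear_combination (-(v 0 * -B.e 1 + v 1 * B.e 0) * (w 0 * -B.e 1 + w 1 * B.e 0)) * hs -
    (v 0 * w 0 + v 1 * w 1) * h

lemma cross_eq_coords (v w : Plane) : B.σ * cross v w = B.X v * B.Y w - B.Y v * B.X w := by
  simp only [X, Y, inner_eq, rot_zero, rot_one, cross]
  linear_combination (-B.σ * (v 0 * w 1 - v 1 * w 0)) * B.unit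

lemma norm_sq_eq_coords (v : Plane) : ‖v‖ ^ 2 = B.X v ^ 2 + B.Y v ^ 2 := by
  rw [← real_inner_self_eq_norm_sq, B.inner_eq_coords]; ring

lemma X_rot (v : Plane) : B.X (rot v) = -B.σ * B.Y v := by
  simp only [X, Y, inner_eq, rot_zero, rot_one]
  linear_combination (v 0 * -B.e 1 + v 1 * B.e 0) * B.σ_sq

lemma Y_rot (v : Plane) : B.Y (rot v) = B.σ * B.X v := by
  simp only [X, Y, inner_eq, rot_zero, rot_one]; ring

lemma X_e : B.X B.e = 1 := by
  simp only [X, inner_eq]; linarith [B.unit]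

lemma Y_e : B.Y B.e = 0 := by
  simp only [Y, inner_eq, rot_zero, rot_one]; ring

/-- The vector with the given coordinates. -/
def vec (x y : ℝ) : Plane := x • B.e + (B.σ * y) • rot B.e

lemma X_vec (x y : ℝ) : B.X (B.vec x y) = x := by
  simp only [vec, X_add, X_smul, X_rot, X_e, Y_e]; ring

lemma Y_vec (x y : ℝ) : B.Y (B.vec x y) = y := by
  simp only [vec, Y_add, Y_smul, Y_rot, X_e, Y_e]
  linear_combination y * B.σ_sq

end Frame

/-- The initial part of an arc is a graph in a frame adapted to its initial point. -/
lemma Arc.exists_graph (A : Arc) (B : Frame) (he : A.tangent 0 = B.e) :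
    ∃ f : ℝ → ℝ, ContDiffAt ℝ 3 f 0 ∧ f 0 = 0 ∧ deriv f 0 = 0 ∧
      deriv (deriv f) 0 = B.σ * A.curvature 0 ∧
      ∃ s₀ > 0, s₀ ≤ A.length ∧ ∀ s ∈ Icc 0 s₀,
        B.Y (A.toFun s - A.toFun 0) = f (B.X (A.toFun s - A.toFun 0)) ∧
        s ≤ 2 * B.X (A.toFun s - A.toFun 0) ∧ 0 < B.X (A.tangent s) ∧
        B.Y (A.tangent s) = B.X (A.tangent s) * deriv f (B.X (A.toFun s - A.toFun 0)) := by
  obtain ⟨γ, hγ, heq⟩ := exists_contDiff_extension A.length_pos 3 A.toFun A.contDiffOn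
  have hu := uniqueDiffOn_Icc A.length_pos
  have h0mem : (0 : ℝ) ∈ Icc 0 A.length := left_mem_Icc.2 A.length_pos.le
  have hγ' : ContDiff ℝ 2 (deriv γ) := (contDiff_succ_iff_deriv.1 (show ContDiff ℝ (2 + 1) γ by
    rw [show (2 + 1 : WithTop ℕ∞) = 3 by norm_num]; exact hγ)).2.2
  have hγd : ∀ s, HasDerivAt γ (deriv γ s) s := fun s =>
    (hγ.differentiable (by norm_num) s).hasDerivAt
  have hγd' : ∀ s, HasDerivAt (deriv γ) (deriv (deriv γ) s) s := fun s =>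
    (hγ'.differentiable (by norm_num) s).hasDerivAt
  have htan : ∀ s ∈ Icc 0 A.length, A.tangent s = deriv γ s := by
    intro s hs
    rw [Arc.tangent, derivWithin_congr heq (heq hs)]
    exact (hγd s).hasDerivWithinAt.derivWithin (hu s hs)
  have hcurv : A.curvature 0 = cross (deriv γ 0) (deriv (deriv γ) 0) := by
    rw [Arc.curvature, htan 0 h0mem, iteratedDerivWithin_congr heq h0mem,
      iteratedDerivWithin_eq_iteratedDeriv hu (hγ.contDiffAt.of_le (by norm_num)) h0mem,
      iteratedDeriv_succ, iteratedDeriv_one]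
  have he' : deriv γ 0 = B.e := by rw [← htan 0 h0mem, he]
  set X : ℝ → ℝ := fun s => B.X (γ s - γ 0) with hXdef
  set Y : ℝ → ℝ := fun s => B.Y (γ s - γ 0) with hYdef
  have hX : ContDiff ℝ 3 X := (hγ.sub contDiff_const).inner ℝ contDiff_const
  have hY : ContDiff ℝ 3 Y :=
    contDiff_const.mul ((hγ.sub contDiff_const).inner ℝ contDiff_const)
  have hinner : ∀ (g : ℝ → Plane) (g' c : Plane) (s : ℝ), HasDerivAt g g' s →
      HasDerivAt (fun s => inner ℝ (g s) c) (inner ℝ g' c) s := by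
    intro g g' c s h
    simpa using h.inner ℝ (hasDerivAt_const s c)
  have hXd : ∀ s, HasDerivAt X (B.X (deriv γ s)) s := fun s =>
    hinner _ _ _ s ((hγd s).sub_const _)
  have hYd : ∀ s, HasDerivAt Y (B.Y (deriv γ s)) s := fun s =>
    (hinner _ _ _ s ((hγd s).sub_const _)).const_mul _
  have hX' : deriv X = fun s => B.X (deriv γ s) := funext fun s => (hXd s).deriv
  have hY' : deriv Y = fun s => B.Y (deriv γ s) := funext fun s => (hYd s).deriv
  have hYd' : HasDerivAt (deriv Y) (B.Y (deriv (deriv γ) 0)) 0 := by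
    rw [hY']
    exact (hinner _ _ _ 0 (hγd' 0)).const_mul _
  have hX0 : X 0 = 0 := by simp [hXdef, Frame.X]
  have hY0 : Y 0 = 0 := by simp [hYdef, Frame.Y]
  obtain ⟨f, hf, hf0, hf1, hf2, hev⟩ := HornBilliard.exists_graph hX hY hX0 hY0
    (by rw [hX']; simp only [he', B.X_e]) (by rw [hY']; simp only [he', B.Y_e])
  refine ⟨f, hf, hf0, hf1, ?_, ?_⟩
  · rw [hf2, hYd'.deriv, hcurv, B.cross_eq_coords, he', B.X_e, B.Y_e]; ring
  · obtain ⟨ρ, hρ, hall⟩ := Metric.eventually_nhds_iff.1 hev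
    refine ⟨min (ρ / 2) A.length, lt_min (by positivity) A.length_pos, min_le_right _ _, ?_⟩
    have hs_all : ∀ s ∈ Icc 0 (min (ρ / 2) A.length), _ := fun s hs => hall (y := s) (by
      rw [Real.dist_eq, sub_zero, abs_of_nonneg hs.1]
      linarith [hs.2.trans (min_le_left (ρ / 2) A.length)])
    intro s hs
    have hsl : s ∈ Icc 0 A.length := ⟨hs.1, hs.2.trans (min_le_right _ _)⟩
    rw [heq hsl, heq h0mem, htan s hsl]
    obtain ⟨h1, h2, h3⟩ := hs_all s hs
    rw [hX'] at h2 h3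
    rw [hY'] at h2
    simp only at h2 h3
    refine ⟨h1, ?_, by linarith, by rw [h2]; ring⟩
    have hle := le_of_hasDerivAt_le (ψ := fun z => 1 / 2 * z) (ψ' := fun _ => 1 / 2)
      (χ := X) (χ' := fun z => B.X (deriv γ z)) hs.1
      (fun z _ => by simpa using (hasDerivAt_id z).const_mul (1 / 2 : ℝ))
      (fun z _ => hXd z)
      (fun z hz => by
        have := (hs_all z ⟨hz.1, hz.2.trans hs.2⟩).2.2
        rw [hX'] at this
        exact this.le)
      (by simp [hX0])
    simp only [hXdef] at hle
    linarith

/-! ### The chart at the tip -/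

/-- Coordinates near the tip in which the horn is the region between two graphs. -/
structure Chart (A : Fin 2 → Arc) (Q : Set Plane) where
  P : Profile
  B : Frame
  lo : Fin 2
  hi : Fin 2
  V : Set Plane
  σ_eq : B.σ = SignType.sign ((A 0).curvature 0)
  lo_or_hi : ∀ i, i = lo ∨ i = hi
  isOpen : IsOpen V
  tip_mem : tip A ∈ V
  X_lt : ∀ p ∈ V, B.X (p - tip A) < P.r
  mem_imp : ∀ p ∈ V, p ∈ Q → p ≠ tip A → 0 < B.X (p - tip A) ∧
    P.f (B.X (p - tip A)) ≤ B.Y (p - tip A) ∧ B.Y (p - tip A) ≤ P.g (B.X (p - tip A))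
  imp_mem : ∀ p ∈ V, 0 < B.X (p - tip A) → P.f (B.X (p - tip A)) ≤ B.Y (p - tip A) →
    B.Y (p - tip A) ≤ P.g (B.X (p - tip A)) → p ∈ Q
  arc_coords : ∀ p ∈ V, ∀ i, ∀ s ∈ Ioc 0 (A i).length, p = (A i).toFun s →
    0 < B.X (p - tip A) ∧ s ≤ 2 * B.X (p - tip A) ∧ 0 < B.X ((A i).tangent s)
  lo_coords : ∀ p ∈ V, ∀ s ∈ Ioc 0 (A lo).length, p = (A lo).toFun s →
    B.Y (p - tip A) = P.f (B.X (p - tip A)) ∧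
      B.Y ((A lo).tangent s) = B.X ((A lo).tangent s) * P.f1 (B.X (p - tip A))
  hi_coords : ∀ p ∈ V, ∀ s ∈ Ioc 0 (A hi).length, p = (A hi).toFun s →
    B.Y (p - tip A) = P.g (B.X (p - tip A)) ∧
      B.Y ((A hi).tangent s) = B.X ((A hi).tangent s) * P.g1 (B.X (p - tip A))
  lo_mem : ∀ p ∈ V, 0 < B.X (p - tip A) → B.Y (p - tip A) = P.f (B.X (p - tip A)) →
    p ∈ (A lo).carrier
  hi_mem : ∀ p ∈ V, 0 < B.X (p - tip A) → B.Y (p - tip A) = P.g (B.X (p - tip A)) →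
    p ∈ (A hi).carrier
  X_center : B.X (middleCenter A - tip A) = 0
  Y_center : B.Y (middleCenter A - tip A) = P.R

/-- The rest of the arc is compact and, by injectivity, misses the initial point; so it cannot
return to the tip. -/
lemma Arc.eventually_lt (A : Arc) {s₀ : ℝ} (h0 : 0 < s₀) :
    ∀ᶠ p in 𝓝 (A.toFun 0), ∀ s ∈ Ioc 0 A.length, p = A.toFun s → s < s₀ := by
  have hcl : IsClosed (A.toFun '' Icc s₀ A.length) := by
    refine (isCompact_Icc.image_of_continuousOn ?_).isClosed
    exact A.contDiffOn.continuousOn.mono (Icc_subset_Icc_left h0.le)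
  have hn : A.toFun 0 ∉ A.toFun '' Icc s₀ A.length := by
    rintro ⟨s, hs, h⟩
    have := A.injOn ⟨h0.le.trans hs.1, hs.2⟩ (left_mem_Icc.2 A.length_pos.le) h
    linarith [hs.1]
  filter_upwards [hcl.isOpen_compl.mem_nhds hn] with p hp s hs hps
  by_contra hlt
  exact hp ⟨s, ⟨not_lt.1 hlt, hs.2⟩, hps.symm⟩

/-- The sign `σ` of the curvatures turns both graphs upwards, and the arc of smaller absolute
curvature becomes the lower one. -/
lemma exists_chart {A : Fin 2 → Arc} (hA : IsHorn A) {Q : Set Plane} (hQ : IsHornTable A Q) :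
    Nonempty (Chart A Q) := by
  have hk0 : (A 0).curvature 0 ≠ 0 := left_ne_zero_of_mul hA.same_sign.ne'
  have htip : ∀ i, (A i).toFun 0 = tip A := by
    intro i; fin_cases i
    · rfl
    · exact hA.common_point.symm
  have htan : ∀ i, (A i).tangent 0 = (A 0).tangent 0 := by
    intro i; fin_cases i
    · rfl
    · exact hA.common_tangent.symm
  set B : Frame :=
    { e := (A 0).tangent 0
      σ := SignType.sign ((A 0).curvature 0)
      unit := by
        have h : ‖(A 0).tangent 0‖ = 1 :=
          (A 0).unit_speed 0 (left_mem_Icc.2 (A 0).length_pos.le)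
        have h2 : ‖(A 0).tangent 0‖ ^ 2 = 1 := by rw [h]; norm_num
        rw [← real_inner_self_eq_norm_sq, inner_eq] at h2
        linarith
      σ_sq := by
        rcases lt_or_gt_of_ne hk0 with h | h
        · simp [sign_neg h]
        · simp [sign_pos h] } with hB
  have hκpos : ∀ i, 0 < B.σ * (A i).curvature 0 := by
    have h0 : 0 < B.σ * (A 0).curvature 0 := by
      rcases lt_or_gt_of_ne hk0 with h | h
      · simp [hB, sign_neg h, h]
      · simp [hB, sign_pos h, h]
    intro i; fin_cases i
    · exact h0
    · have h1 : B.σ * (A 0).curvature 0 * (B.σ * (A 1).curvature 0) =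
          (A 0).curvature 0 * (A 1).curvature 0 := by
        linear_combination ((A 0).curvature 0 * (A 1).curvature 0) * B.σ_sq
      have h2 := hA.same_sign
      rw [← h1] at h2
      exact (mul_pos_iff_of_pos_left h0).1 h2
  have hσ0 : B.σ ≠ 0 := fun h => by have := B.σ_sq; rw [h] at this; norm_num at this
  have hκne : B.σ * (A 0).curvature 0 ≠ B.σ * (A 1).curvature 0 := fun h =>
    hA.curvature_ne (mul_left_cancel₀ hσ0 h)
  obtain ⟨lo, hi, hlo_hi, hlt⟩ : ∃ lo hi : Fin 2, (∀ i, i = lo ∨ i = hi) ∧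
      B.σ * (A lo).curvature 0 < B.σ * (A hi).curvature 0 := by
    rcases lt_or_gt_of_ne hκne with h | h
    · exact ⟨0, 1, by decide, h⟩
    · exact ⟨1, 0, by decide, h⟩
  have hgraph := fun i => (A i).exists_graph B (htan i)
  simp only [htip] at hgraph
  choose F hF hF0 hF1 hF2 s₀ hs₀ hs₀l hFs using hgraph
  obtain ⟨P, hPf, hPg, hPf1, hPg1, hPR, -⟩ := exists_profile (hF lo) (hF hi) (hF0 lo) (hF0 hi)
    (hF1 lo) (hF1 hi) (hF2 lo) (hF2 hi) (hκpos lo) hlt one_pos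
  obtain ⟨δ, hδQ, hδ0⟩ := (hQ.and (Ioo_mem_nhdsGT
    (show 0 < min (s₀ 0) (s₀ 1) from lt_min (hs₀ 0) (hs₀ 1)))).exists
  have hδs : ∀ i, δ < s₀ i := by
    intro i; fin_cases i
    · exact hδ0.2.trans_le (min_le_left _ _)
    · exact hδ0.2.trans_le (min_le_right _ _)
  have hXcont : Continuous fun p => B.X (p - tip A) :=
    B.continuous_X.comp (continuous_id.sub continuous_const)
  have hX0 : B.X (tip A - tip A) = 0 := by simp [Frame.X]
  -- Because `s ≤ 2 X` along the arcs, their pieces of length `δ` cover at least the abscissas up to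
  -- `δ / 2`.
  have hsmall : ∀ᶠ p in 𝓝 (tip A), B.X (p - tip A) < min P.r (δ / 2) :=
    hXcont.continuousAt.eventually (gt_mem_nhds (by
      change B.X (tip A - tip A) < _
      rw [hX0]; exact lt_min P.r_pos (half_pos hδ0.1)))
  have harc : ∀ i, ∀ᶠ p in 𝓝 (tip A), ∀ s ∈ Ioc 0 (A i).length, p = (A i).toFun s → s < s₀ i :=
    fun i => htip i ▸ (A i).eventually_lt (hs₀ i)
  obtain ⟨V, hV, hVo, hVt⟩ := eventually_nhds_iff.1
    (hδQ.and (hsmall.and ((harc 0).and (harc 1))))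
  have harcV : ∀ p ∈ V, ∀ i, ∀ s ∈ Ioc 0 (A i).length, p = (A i).toFun s → s ∈ Icc 0 (s₀ i) := by
    intro p hp i s hs hps
    refine ⟨hs.1.le, le_of_lt ?_⟩
    fin_cases i
    · exact (hV p hp).2.2.1 s hs hps
    · exact (hV p hp).2.2.2 s hs hps
  have hsurj : ∀ i, ∀ x ∈ Icc 0 (δ / 2), ∃ s ∈ Icc 0 δ, B.X ((A i).toFun s - tip A) = x := by
    intro i x hx
    have hcont : ContinuousOn (fun s => B.X ((A i).toFun s - tip A)) (Icc 0 δ) :=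
      hXcont.comp_continuousOn ((A i).contDiffOn.continuousOn.mono
        (Icc_subset_Icc_right ((hδs i).le.trans (hs₀l i))))
    have := intermediate_value_Icc hδ0.1.le hcont
    have h1 := (hFs i δ ⟨hδ0.1.le, (hδs i).le⟩).2.1
    exact this ⟨by rw [htip i, hX0]; exact hx.1, by linarith [hx.2]⟩
  have hcarrier : ∀ p ∈ V, ∀ i, 0 < B.X (p - tip A) →
      B.Y (p - tip A) = F i (B.X (p - tip A)) → p ∈ (A i).carrier := by
    intro p hp i h1 h2
    obtain ⟨s, hs, hXs⟩ := hsurj i (B.X (p - tip A))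
      ⟨h1.le, (hV p hp).2.1.le.trans (min_le_right _ _)⟩
    have hss : s ∈ Icc 0 (s₀ i) := ⟨hs.1, hs.2.trans (hδs i).le⟩
    have hYs := (hFs i s hss).1
    rw [hXs, ← h2] at hYs
    have heq := sub_left_injective (B.ext hXs hYs)
    refine ⟨s, ⟨lt_of_le_of_ne hs.1 fun h => ?_, hss.2.trans (hs₀l i)⟩, heq⟩
    rw [← h, htip i, hX0] at hXs
    linarith
  have hFlt : ∀ x, 0 < x → x < P.r → F lo x < F hi x := fun x h0 hr => by
    have := P.f_lt_g x h0 hr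
    rwa [hPf, hPg] at this
  have hbetween : ∀ x y, 0 < x → x < P.r →
      (y ∈ uIcc (F 0 x) (F 1 x) ↔ F lo x ≤ y ∧ y ≤ F hi x) := by
    intro x y h0 hr
    have h := hFlt x h0 hr
    rcases hlo_hi 0 with h1 | h1 <;> rcases hlo_hi 1 with h2 | h2
    · rw [← h1] at h2; exact absurd h2 (by decide)
    · rw [h1, h2, uIcc_of_le h.le]; rfl
    · rw [h1, h2, uIcc_of_ge h.le]; rfl
    · rw [← h1] at h2; exact absurd h2 (by decide)
  have hcenter : ∀ i, (A i).osculatingCenter - tip A =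
      B.vec 0 ((B.σ * (A i).curvature 0)⁻¹) := by
    intro i
    rw [Arc.osculatingCenter, htip, add_sub_cancel_left, htan, Frame.vec, zero_smul, zero_add]
    congr 1
    have : (A i).curvature 0 ≠ 0 := right_ne_zero_of_mul (hκpos i).ne'
    field_simp
  have hmid : middleCenter A - tip A = (1 / 2 : ℝ) •
      (((A lo).osculatingCenter - tip A) + ((A hi).osculatingCenter - tip A)) := by
    have : middleCenter A = (1 / 2 : ℝ) •
        ((A lo).osculatingCenter + (A hi).osculatingCenter) := by
      unfold middleCenter
      rcases hlo_hi 0 with h1 | h1 <;> rcases hlo_hi 1 with h2 | h2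
      · rw [← h1] at h2; exact absurd h2 (by decide)
      · rw [h1, h2]
      · rw [h1, h2, add_comm]
      · rw [← h1] at h2; exact absurd h2 (by decide)
    rw [this]; module
  refine ⟨{
    P := P, B := B, lo := lo, hi := hi, V := V, σ_eq := rfl, lo_or_hi := hlo_hi
    isOpen := hVo, tip_mem := hVt
    X_lt := fun p hp => (hV p hp).2.1.trans_le (min_le_left _ _)
    mem_imp := ?_, imp_mem := ?_, arc_coords := ?_, lo_coords := ?_, hi_coords := ?_
    lo_mem := fun p hp h1 h2 => hcarrier p hp lo h1 (by rwa [hPf] at h2)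
    hi_mem := fun p hp h1 h2 => hcarrier p hp hi h1 (by rwa [hPg] at h2)
    X_center := ?_, Y_center := ?_ }⟩
  · intro p hp hpQ hne
    obtain ⟨s, hs, t, ht, horth, hseg⟩ := ((hV p hp).1).1 hpQ
    obtain ⟨y1, x1, -⟩ := hFs 0 s ⟨hs.1, hs.2.trans (hδs 0).le⟩
    obtain ⟨y2, x2, -⟩ := hFs 1 t ⟨ht.1, ht.2.trans (hδs 1).le⟩
    have hXeq : B.X ((A 1).toFun t - tip A) = B.X ((A 0).toFun s - tip A) := by
      have : B.X ((A 0).toFun s - (A 1).toFun t) = 0 := horth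
      rw [← sub_sub_sub_cancel_right _ _ (tip A), B.X_sub] at this
      linarith
    rw [hXeq] at y2 x2
    set x := B.X ((A 0).toFun s - tip A) with hx
    obtain ⟨a, b, ha, hb, hab, hcomb⟩ := hseg
    have hp' : p - tip A = a • ((A 0).toFun s - tip A) + b • ((A 1).toFun t - tip A) := by
      rw [← hcomb]
      have : tip A = (a + b) • tip A := by rw [hab, one_smul]
      nth_rw 1 [this]; module
    have hXp : B.X (p - tip A) = x := by
      rw [hp', B.X_add, B.X_smul, B.X_smul, hXeq, ← hx, ← add_mul, hab, one_mul]
    have hYp : B.Y (p - tip A) = a * F 0 x + b * F 1 x := by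
      rw [hp', B.Y_add, B.Y_smul, B.Y_smul, y1, y2]
    have hx0 : 0 < x := by
      refine lt_of_le_of_ne (by linarith [hs.1]) fun h => hne ?_
      have hs0 : s = 0 := by linarith [hs.1]
      have ht0 : t = 0 := by linarith [ht.1]
      rw [hs0, ht0, htip, htip, sub_self, smul_zero, smul_zero, add_zero] at hp'
      exact sub_eq_zero.1 hp'
    have hxr : x < P.r := by
      have := (hV p hp).2.1
      rw [hXp] at this
      exact this.trans_le (min_le_left _ _)
    rw [hXp, hPf, hPg]
    refine ⟨hx0, (hbetween x _ hx0 hxr).1 ?_⟩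
    rw [hYp, ← segment_eq_uIcc]
    exact ⟨a, b, ha, hb, hab, by simp⟩
  · intro p hp h0 hf hg
    refine ((hV p hp).1).2 ?_
    have hXδ : B.X (p - tip A) ∈ Icc 0 (δ / 2) :=
      ⟨h0.le, (hV p hp).2.1.le.trans (min_le_right _ _)⟩
    have hXr := (hV p hp).2.1.trans_le (min_le_left _ _)
    obtain ⟨s, hs, hXs⟩ := hsurj 0 _ hXδ
    obtain ⟨t, ht, hXt⟩ := hsurj 1 _ hXδ
    have y1 := (hFs 0 s ⟨hs.1, hs.2.trans (hδs 0).le⟩).1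
    have y2 := (hFs 1 t ⟨ht.1, ht.2.trans (hδs 1).le⟩).1
    rw [hXs] at y1
    rw [hXt] at y2
    refine ⟨s, hs, t, ht, ?_, ?_⟩
    · change B.X ((A 0).toFun s - (A 1).toFun t) = 0
      rw [← sub_sub_sub_cancel_right _ _ (tip A), B.X_sub, hXs, hXt, sub_self]
    · rw [hPf] at hf
      rw [hPg] at hg
      have := (hbetween _ (B.Y (p - tip A)) h0 hXr).2 ⟨hf, hg⟩
      rw [← segment_eq_uIcc] at this
      obtain ⟨a, b, ha, hb, hab, hcomb⟩ := this
      refine ⟨a, b, ha, hb, hab, ?_⟩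
      have hsub : a • (A 0).toFun s + b • (A 1).toFun t - tip A =
          a • ((A 0).toFun s - tip A) + b • ((A 1).toFun t - tip A) := by
        have : tip A = (a + b) • tip A := by rw [hab, one_smul]
        nth_rw 1 [this]; module
      refine sub_left_injective (b := tip A) (B.ext ?_ ?_)
      · simp only
        rw [hsub, B.X_add, B.X_smul, B.X_smul, hXs, hXt, ← add_mul, hab, one_mul]
      · simp only
        rw [hsub, B.Y_add, B.Y_smul, B.Y_smul, y1, y2, ← hcomb]; simp
  · intro p hp i s hs hps
    obtain ⟨-, h2, h3, -⟩ := hFs i s (harcV p hp i s hs hps)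
    rw [← hps] at h2
    exact ⟨by linarith [hs.1], h2, h3⟩
  · intro p hp s hs hps
    obtain ⟨h1, -, -, h4⟩ := hFs lo s (harcV p hp lo s hs hps)
    rw [← hps] at h1 h4
    rw [hPf, hPf1]
    exact ⟨h1, h4⟩
  · intro p hp s hs hps
    obtain ⟨h1, -, -, h4⟩ := hFs hi s (harcV p hp hi s hs hps)
    rw [← hps] at h1 h4
    rw [hPg, hPg1]
    exact ⟨h1, h4⟩
  · rw [hmid, hcenter, hcenter, B.X_smul, B.X_add, B.X_vec, B.X_vec]; ring
  · rw [hmid, hcenter, hcenter, B.Y_smul, B.Y_add, B.Y_vec, B.Y_vec, hPR]; ring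

/-! ### Trajectories in coordinates -/

lemma eventually_nhdsGT_of_shift {p : ℝ → Prop} {t : ℝ} (h : ∀ᶠ h in 𝓝[>] (0 : ℝ), p (t + h)) :
    ∀ᶠ s in 𝓝[>] t, p s := by
  obtain ⟨ε, hε, hsub⟩ := mem_nhdsGT_iff_exists_Ioo_subset.1 h
  have hε : 0 < ε := hε
  filter_upwards [Ioo_mem_nhdsGT (show t < t + ε by linarith)] with s hs
  have := hsub (show s - t ∈ Ioo 0 ε from ⟨by linarith [hs.1], by linarith [hs.2]⟩)
  simpa using this

lemma eventually_nhdsLT_of_shift {p : ℝ → Prop} {t : ℝ} (h : ∀ᶠ h in 𝓝[>] (0 : ℝ), p (t - h)) :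
    ∀ᶠ s in 𝓝[<] t, p s := by
  obtain ⟨ε, hε, hsub⟩ := mem_nhdsGT_iff_exists_Ioo_subset.1 h
  have hε : 0 < ε := hε
  filter_upwards [Ioo_mem_nhdsLT (show t - ε < t by linarith)] with s hs
  have := hsub (show t - s ∈ Ioo 0 ε from ⟨by linarith [hs.2], by linarith [hs.1]⟩)
  simpa using this

lemma eventually_nhdsGT_zero_lt {ε : ℝ} (hε : 0 < ε) : ∀ᶠ h in 𝓝[>] (0 : ℝ), 0 < h ∧ h < ε :=
  Ioo_mem_nhdsGT hε

lemma Outgoing.unique {q : ℝ → Plane} {t : ℝ} {u u' : Plane} (h : Outgoing q t u)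
    (h' : Outgoing q t u') : u = u' := by
  obtain ⟨z, ⟨h1, h2⟩, h3⟩ := ((h.and h').and (eventually_nhdsGT_zero_lt one_pos)).exists
  rw [h1] at h2
  exact smul_right_injective Plane h3.1.ne' (add_left_cancel h2)

lemma Incoming.unique {q : ℝ → Plane} {t : ℝ} {w w' : Plane} (h : Incoming q t w)
    (h' : Incoming q t w') : w = w' := by
  obtain ⟨z, ⟨h1, h2⟩, h3⟩ := ((h.and h').and (eventually_nhdsGT_zero_lt one_pos)).exists
  rw [h1] at h2
  exact smul_right_injective Plane h3.1.ne' (sub_right_injective h2)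

/-- With uniqueness of the outgoing velocity, this shows that the velocity chosen at nearby later
times is the same `u`. -/
lemma Outgoing.eventually {q : ℝ → Plane} {t : ℝ} {u : Plane} (h : Outgoing q t u) :
    ∀ᶠ h in 𝓝[>] (0 : ℝ), q (t + h) = q t + h • u ∧ Outgoing q (t + h) u := by
  obtain ⟨ε, hε, hsub⟩ := mem_nhdsGT_iff_exists_Ioo_subset.1 h
  filter_upwards [eventually_nhdsGT_zero_lt hε] with z hz
  have h1 : q (t + z) = q t + z • u := hsub hz
  refine ⟨h1, ?_⟩
  filter_upwards [eventually_nhdsGT_zero_lt (show 0 < ε - z by linarith [hz.2])] with z' hz'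
  have h2 : q (t + (z + z')) = q t + (z + z') • u :=
    hsub ⟨by linarith [hz.1, hz'.1], by linarith [hz'.2]⟩
  rw [h1, add_assoc, h2]; module

lemma Incoming.eventually {q : ℝ → Plane} {t : ℝ} {w : Plane} (h : Incoming q t w) :
    ∀ᶠ h in 𝓝[>] (0 : ℝ), q (t - h) = q t - h • w ∧ Outgoing q (t - h) w := by
  obtain ⟨ε, hε, hsub⟩ := mem_nhdsGT_iff_exists_Ioo_subset.1 h
  filter_upwards [eventually_nhdsGT_zero_lt hε] with z hz
  have h1 : q (t - z) = q t - z • w := hsub hz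
  refine ⟨h1, ?_⟩
  filter_upwards [eventually_nhdsGT_zero_lt hz.1] with z' hz'
  have h2 : q (t - (z - z')) = q t - (z - z') • w :=
    hsub ⟨by linarith [hz'.2], by linarith [hz.2, hz'.1]⟩
  rw [h1, show t - z + z' = t - (z - z') by ring, h2]; module

/-- The velocity change `j (-s, 1)` in a collision with an arc of slope `s`. -/
lemma Frame.reflect_coords (B : Frame) {τ w u : Plane} {s : ℝ} (hτ : ‖τ‖ = 1)
    (hs : B.Y τ = B.X τ * s) (hu : u = w - (2 * inner ℝ w (rot τ)) • rot τ) :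
    ∃ j, B.X u = B.X w - j * s ∧ B.Y u = B.Y w + j ∧
      j * (1 + s ^ 2) = -2 * (B.Y w - s * B.X w) := by
  have h1 : B.X τ ^ 2 * (1 + s ^ 2) = 1 := by
    have := B.norm_sq_eq_coords τ
    rw [hτ, hs] at this
    linarith
  have h2 : inner ℝ w (rot τ) = B.σ * B.X τ * (B.Y w - s * B.X w) := by
    rw [B.inner_eq_coords, B.X_rot, B.Y_rot, hs]; ring
  refine ⟨-2 * B.X τ ^ 2 * (B.Y w - s * B.X w), ?_, ?_, ?_⟩
  · rw [hu, B.X_sub, B.X_smul, B.X_rot, h2, hs]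
    linear_combination (2 * B.X τ ^ 2 * s * (B.Y w - s * B.X w)) * B.σ_sq
  · rw [hu, B.Y_sub, B.Y_smul, B.Y_rot, h2]
    linear_combination (-2 * B.X τ ^ 2 * (B.Y w - s * B.X w)) * B.σ_sq
  · linear_combination (-2 * (B.Y w - s * B.X w)) * h1

lemma Arc.norm_tangent (A : Arc) {s : ℝ} (hs : s ∈ Ioc 0 A.length) : ‖A.tangent s‖ = 1 :=
  A.unit_speed s (Ioc_subset_Icc_self hs)

namespace Chart

variable {A : Fin 2 → Arc} {Q : Set Plane} (C : Chart A Q)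

/-- The first coordinate of a point. -/
def x (p : Plane) : ℝ := C.B.X (p - tip A)

/-- The second coordinate of a point. -/
def y (p : Plane) : ℝ := C.B.Y (p - tip A)

lemma continuous_x : Continuous C.x :=
  C.B.continuous_X.comp (continuous_id.sub continuous_const)

lemma continuous_y : Continuous C.y :=
  C.B.continuous_Y.comp (continuous_id.sub continuous_const)

lemma x_add_smul (p v : Plane) (h : ℝ) : C.x (p + h • v) = C.x p + h * C.B.X v := by
  unfold x; rw [add_sub_right_comm, C.B.X_add, C.B.X_smul]

lemma y_add_smul (p v : Plane) (h : ℝ) : C.y (p + h • v) = C.y p + h * C.B.Y v := by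
  unfold y; rw [add_sub_right_comm, C.B.Y_add, C.B.Y_smul]

lemma x_sub_smul (p v : Plane) (h : ℝ) : C.x (p - h • v) = C.x p - h * C.B.X v := by
  unfold x; rw [sub_right_comm, C.B.X_sub, C.B.X_smul]

lemma y_sub_smul (p v : Plane) (h : ℝ) : C.y (p - h • v) = C.y p - h * C.B.Y v := by
  unfold y; rw [sub_right_comm, C.B.Y_sub, C.B.Y_smul]

lemma unit_coords {v : Plane} (hv : ‖v‖ = 1) : C.B.X v ^ 2 + C.B.Y v ^ 2 = 1 := by
  rw [← C.B.norm_sq_eq_coords, hv, one_pow]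

/-- The open horn, in the domain of the chart. -/
def interiorHorn : Set Plane :=
  {p | p ∈ C.V ∧ 0 < C.x p ∧ C.P.f (C.x p) < C.y p ∧ C.y p < C.P.g (C.x p)}

lemma f_comp_x_continuousAt {p : Plane} (hp : p ∈ C.V) (h0 : 0 < C.x p) :
    ContinuousAt (fun p => C.P.f (C.x p)) p :=
  ContinuousAt.comp (f := C.x) (C.P.hf _ h0 (C.X_lt p hp)).continuousAt C.continuous_x.continuousAt

lemma g_comp_x_continuousAt {p : Plane} (hp : p ∈ C.V) (h0 : 0 < C.x p) :
    ContinuousAt (fun p => C.P.g (C.x p)) p :=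
  ContinuousAt.comp (f := C.x) (C.P.hg _ h0 (C.X_lt p hp)).continuousAt C.continuous_x.continuousAt

lemma eventually_x_pos {p : Plane} (h0 : 0 < C.x p) : ∀ᶠ p' in 𝓝 p, 0 < C.x p' :=
  C.continuous_x.continuousAt.eventually (lt_mem_nhds h0)

lemma eventually_f_lt {p : Plane} (hp : p ∈ C.V) (h0 : 0 < C.x p) (h : C.P.f (C.x p) < C.y p) :
    ∀ᶠ p' in 𝓝 p, C.P.f (C.x p') < C.y p' :=
  (C.f_comp_x_continuousAt hp h0).eventually_lt C.continuous_y.continuousAt h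

lemma eventually_lt_g {p : Plane} (hp : p ∈ C.V) (h0 : 0 < C.x p) (h : C.y p < C.P.g (C.x p)) :
    ∀ᶠ p' in 𝓝 p, C.y p' < C.P.g (C.x p') :=
  C.continuous_y.continuousAt.eventually_lt (C.g_comp_x_continuousAt hp h0) h

lemma interiorHorn_isOpen : IsOpen C.interiorHorn := by
  refine isOpen_iff_mem_nhds.2 fun p hp => ?_
  filter_upwards [C.isOpen.mem_nhds hp.1, C.eventually_x_pos hp.2.1,
    C.eventually_f_lt hp.1 hp.2.1 hp.2.2.1, C.eventually_lt_g hp.1 hp.2.1 hp.2.2.2]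
    with p' h1 h2 h3 h4
  exact ⟨h1, h2, h3, h4⟩

lemma mem_of_interiorHorn {p : Plane} (hp : p ∈ C.interiorHorn) : p ∈ Q :=
  C.imp_mem p hp.1 hp.2.1 hp.2.2.1.le hp.2.2.2.le

lemma mem_interior {p : Plane} (hp : p ∈ C.interiorHorn) : p ∈ interior Q :=
  interior_maximal (fun _ h => C.mem_of_interiorHorn h) C.interiorHorn_isOpen hp

lemma not_mem_carrier {p : Plane} (hp : p ∈ C.interiorHorn) (i : Fin 2) : p ∉ (A i).carrier := by
  rintro ⟨s, hs, rfl⟩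
  rcases C.lo_or_hi i with rfl | rfl
  · exact hp.2.2.1.ne (C.lo_coords _ hp.1 s hs rfl).1.symm
  · exact hp.2.2.2.ne (C.hi_coords _ hp.1 s hs rfl).1

lemma ne_tip_of_x_pos {p : Plane} (h : 0 < C.x p) : p ≠ tip A := by
  rintro rfl
  simp [x, Frame.X] at h

lemma velocityRule_of_interiorHorn {p u : Plane} (hp : p ∈ C.interiorHorn) :
    VelocityRule A Q p u u :=
  ⟨C.ne_tip_of_x_pos hp.2.1, fun _ _ => rfl,
    fun i s hs h => absurd ⟨s, hs, h.symm⟩ (C.not_mem_carrier hp i)⟩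

lemma reflect_lo {p w u : Plane} (hp : p ∈ C.V) {s : ℝ} (hs : s ∈ Ioc 0 (A C.lo).length)
    (hps : p = (A C.lo).toFun s)
    (hu : u = w - (2 * inner ℝ w (rot ((A C.lo).tangent s))) • rot ((A C.lo).tangent s)) :
    ∃ j, C.B.X u = C.B.X w - j * C.P.f1 (C.x p) ∧ C.B.Y u = C.B.Y w + j ∧
      j * (1 + C.P.f1 (C.x p) ^ 2) = -2 * (C.B.Y w - C.P.f1 (C.x p) * C.B.X w) :=
  C.B.reflect_coords ((A C.lo).norm_tangent hs) (C.lo_coords p hp s hs hps).2 hu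

lemma reflect_hi {p w u : Plane} (hp : p ∈ C.V) {s : ℝ} (hs : s ∈ Ioc 0 (A C.hi).length)
    (hps : p = (A C.hi).toFun s)
    (hu : u = w - (2 * inner ℝ w (rot ((A C.hi).tangent s))) • rot ((A C.hi).tangent s)) :
    ∃ j, C.B.X u = C.B.X w - j * C.P.g1 (C.x p) ∧ C.B.Y u = C.B.Y w + j ∧
      j * (1 + C.P.g1 (C.x p) ^ 2) = -2 * (C.B.Y w - C.P.g1 (C.x p) * C.B.X w) :=
  C.B.reflect_coords ((A C.hi).norm_tangent hs) (C.hi_coords p hp s hs hps).2 hu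

/-- A trajectory that stays in the domain of the chart, in coordinates. -/
lemma exists_flow {T : EReal} {q : ℝ → Plane} (hq : IsTrajectory A Q T q) {b : ℝ}
    (hb : (b : EReal) ≤ T) (hV : ∀ t ∈ Ioo 0 b, q t ∈ C.V) :
    ∃ u w : ℝ → Plane, Flow C.P 0 b (fun t => C.x (q t)) (fun t => C.y (q t))
      (fun t => C.B.X (u t)) (fun t => C.B.Y (u t)) (fun t => C.B.X (w t))
      (fun t => C.B.Y (w t)) ∧ ∀ t ∈ Ioo 0 b, ‖u t‖ = 1 := by
  have hT : ∀ t ∈ Ioo 0 b, (t : EReal) < T := fun t ht =>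
    (EReal.coe_lt_coe_iff.2 ht.2).trans_le hb
  have hex : ∀ t, ∃ u w : Plane, t ∈ Ioo 0 b → ‖w‖ = 1 ∧ ‖u‖ = 1 ∧
      Incoming q t w ∧ Outgoing q t u ∧ VelocityRule A Q (q t) w u := by
    intro t
    by_cases ht : t ∈ Ioo 0 b
    · obtain ⟨w, u, h⟩ := hq.motion t ht.1 (hT t ht)
      exact ⟨u, w, fun _ => h⟩
    · exact ⟨0, 0, fun h => absurd h ht⟩
  choose u w huw using hex
  have hmem : ∀ t ∈ Ioo 0 b, 0 < C.x (q t) ∧ C.P.f (C.x (q t)) ≤ C.y (q t) ∧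
      C.y (q t) ≤ C.P.g (C.x (q t)) := fun t ht =>
    C.mem_imp _ (hV t ht) (hq.mem t ht.1.le (hT t ht)) (huw t ht).2.2.2.2.ne_tip
  refine ⟨u, w, ?_, fun t ht => (huw t ht).2.1⟩
  constructor
  · exact fun t ht => (hmem t ht).1
  · exact fun t ht => C.X_lt _ (hV t ht)
  · exact fun t ht => (hmem t ht).2.1
  · exact fun t ht => (hmem t ht).2.2
  · exact fun t ht => C.unit_coords (huw t ht).2.1
  · exact fun t ht => C.unit_coords (huw t ht).1
  · intro t ht
    filter_upwards [(huw t ht).2.2.2.1.eventually,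
      eventually_nhdsGT_zero_lt (show 0 < b - t by linarith [ht.2])] with h h1 h2
    have hu : u (t + h) = u t :=
      (huw (t + h) ⟨by linarith [ht.1, h2.1], by linarith [h2.2]⟩).2.2.2.1.unique h1.2
    simp only [h1.1, hu, x_add_smul, y_add_smul, and_self]
  · intro t ht
    filter_upwards [(huw t ht).2.2.1.eventually,
      eventually_nhdsGT_zero_lt ht.1] with h h1 h2
    have hu : u (t - h) = w t :=
      (huw (t - h) ⟨by linarith [h2.2], by linarith [h2.1, ht.2]⟩).2.2.2.1.unique h1.2
    simp only [h1.1, hu, x_sub_smul, y_sub_smul, and_self]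
  · intro t ht hc
    obtain ⟨s, hs, hps⟩ := C.lo_mem _ (hV t ht) (hmem t ht).1 hc
    exact C.reflect_lo (hV t ht) hs hps.symm
      ((huw t ht).2.2.2.2.reflect C.lo s hs hps.symm)
  · intro t ht hc
    obtain ⟨s, hs, hps⟩ := C.hi_mem _ (hV t ht) (hmem t ht).1 hc
    exact C.reflect_hi (hV t ht) hs hps.symm
      ((huw t ht).2.2.2.2.reflect C.hi s hs hps.symm)
  · intro t ht h1 h2
    have hI : q t ∈ C.interiorHorn := ⟨hV t ht, (hmem t ht).1, h1, h2⟩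
    have := (huw t ht).2.2.2.2.free (C.mem_interior hI) (C.not_mem_carrier hI)
    simp only [this, and_self]

/-- A trajectory that stays close to the tip has finitely many collisions, ends at a finite time,
and arrives at a point of the horn, other than the tip, with a well-defined velocity. -/
lemma finite_collisions {T : EReal} {q : ℝ → Plane} (hq : IsTrajectory A Q T q) {ε : ℝ}
    (hε : Metric.closedBall (tip A) ε ⊆ C.V ∩ {p | C.x p ≤ C.P.r / 2})
    (hU : ∀ t : ℝ, 0 ≤ t → (t : EReal) < T → q t ∈ Metric.ball (tip A) ε) :
    (collisionTimes A T q).Finite ∧ ∃ b : ℝ, 0 < b ∧ T = b ∧ ∃ p ∈ C.V, 0 < C.x p ∧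
      C.P.f (C.x p) ≤ C.y p ∧ C.y p ≤ C.P.g (C.x p) ∧ ∃ w : Plane, ‖w‖ = 1 ∧
        ∀ᶠ h in 𝓝[>] (0 : ℝ), q (b - h) = p - h • w ∧ q (b - h) ∈ C.interiorHorn := by
  have hV : ∀ t : ℝ, 0 ≤ t → (t : EReal) < T → q t ∈ C.V ∧ C.x (q t) ≤ C.P.r / 2 := fun t h0 h1 =>
    hε (Metric.ball_subset_closedBall (hU t h0 h1))
  have hTtop : T ≠ ⊤ := by
    intro hT
    set L := 4 * ((C.P.weight + C.P.powerBound + 1) * (1 + C.P.R)) / C.P.R + 1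
    -- An infinite trajectory would give a flow longer than the bound of `Flow.length_le`.
    obtain ⟨u, w, F, -⟩ := C.exists_flow hq (b := L + 1) (hT ▸ le_top)
      (fun t ht => (hV t ht.1.le (hT ▸ EReal.coe_lt_top t)).1)
    linarith [F.length_le]
  have hTbot : T ≠ ⊥ := fun h => by
    have := hq.pos
    rw [h] at this
    exact not_lt_bot this
  lift T to ℝ using ⟨hTtop, hTbot⟩ with b
  have hb : 0 < b := by exact_mod_cast hq.pos
  have hV' : ∀ t : ℝ, 0 ≤ t → t < b → q t ∈ C.V ∧ C.x (q t) ≤ C.P.r / 2 := fun t h0 h1 =>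
    hV t h0 (EReal.coe_lt_coe_iff.2 h1)
  obtain ⟨u, w, F, hun⟩ := C.exists_flow hq (b := b) le_rfl (fun t ht => (hV' t ht.1.le ht.2).1)
  obtain ⟨X, Y, hX, hY, hX0, hXr, hfX, hgX, hint⟩ := F.exists_limit_interior hb
    (show C.P.r / 2 < C.P.r by linarith [C.P.r_pos]) (fun t ht => (hV' t ht.1.le ht.2).2)
  have hnc : ∀ t ∈ Ioo 0 b, C.P.f (C.x (q t)) < C.y (q t) → C.y (q t) < C.P.g (C.x (q t)) →
      q t ∈ C.interiorHorn := fun t ht h1 h2 =>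
    ⟨(hV' t ht.1.le ht.2).1, F.x_pos t ht, h1, h2⟩
  have hcoll : ∀ t, q t ∈ C.interiorHorn → t ∉ collisionTimes A b q := by
    rintro t ht ⟨-, -, i, hi⟩
    exact C.not_mem_carrier ht i hi
  have hend : ∀ᶠ t in 𝓝[<] b, q t ∈ C.interiorHorn := by
    filter_upwards [hint, Ioo_mem_nhdsLT hb] with t h1 h2
    exact hnc t h2 h1.1 h1.2
  have hright : ∀ t, 0 ≤ t → t < b → ∀ᶠ s in 𝓝[>] t, s ∉ collisionTimes A b q := by
    intro t h0 h1
    apply eventually_nhdsGT_of_shift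
    have hin : ∀ᶠ h in 𝓝[>] (0 : ℝ), t + h ∈ Ioo 0 b := by
      filter_upwards [eventually_nhdsGT_zero_lt (show 0 < b - t by linarith)] with h hh
      exact ⟨by linarith [hh.1], by linarith [hh.2]⟩
    have hI : ∀ᶠ h in 𝓝[>] (0 : ℝ), C.P.f (C.x (q (t + h))) < C.y (q (t + h)) ∧
        C.y (q (t + h)) < C.P.g (C.x (q (t + h))) := by
      rcases h0.eq_or_lt with rfl | h0
      -- The flow only covers positive times, so time 0 is treated directly with the initial
      -- velocity.
      · obtain ⟨u₀, hu₀, hout⟩ := hq.start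
        have := Profile.eventually_interior (P := C.P) (x := C.x (q 0)) (y := C.y (q 0))
          (C.unit_coords hu₀) (by
            filter_upwards [hin, hout] with h h1 h2
            rw [← x_add_smul, ← y_add_smul, ← h2]
            exact ⟨F.x_pos _ h1, F.x_lt _ h1, F.lo _ h1, F.hi _ h1⟩)
        filter_upwards [this, hout] with h h1 h2
        rwa [← x_add_smul, ← y_add_smul, ← h2] at h1
      · exact F.eventually_interior_right ⟨h0, h1⟩
    filter_upwards [hin, hI] with h h2 h3
    exact hcoll _ (hnc _ h2 h3.1 h3.2)
  have hleft : ∀ t, 0 < t → t ≤ b → ∀ᶠ s in 𝓝[<] t, s ∉ collisionTimes A b q := by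
    intro t h0 h1
    rcases h1.eq_or_lt with rfl | h1
    · exact hend.mono hcoll
    · apply eventually_nhdsLT_of_shift
      filter_upwards [F.eventually_interior_left ⟨h0, h1⟩, F.left_mem ⟨h0, h1⟩] with h h2 h3
      exact hcoll _ (hnc _ h3.1 h2.1 h2.2)
  refine ⟨?_, b, hb, rfl, ?_⟩
  -- Infinitely many collision times in `[0, b]` would accumulate, but each point has one-sided
  -- neighborhoods free of them; the left side of `b` is the delicate case settled by `hend`.
  · by_contra hinf
    have hsub : collisionTimes A b q ⊆ Icc 0 b := fun t ht =>
      ⟨ht.1, (EReal.coe_lt_coe_iff.1 ht.2.1).le⟩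
    obtain ⟨t, ht, hacc⟩ := Set.Infinite.exists_accPt_of_subset_isCompact hinf isCompact_Icc hsub
    have hfreq := accPt_iff_frequently_nhdsNE.1 hacc
    refine hfreq ?_
    rw [← nhdsLT_sup_nhdsGT, eventually_sup]
    constructor
    · rcases ht.1.eq_or_lt with h | h
      · filter_upwards [self_mem_nhdsWithin] with s hs hs'
        have hs : s < t := hs
        linarith [(hsub hs').1]
      · exact hleft t h ht.2
    · rcases ht.2.eq_or_lt with h | h
      · filter_upwards [self_mem_nhdsWithin] with s hs hs'
        have hs : t < s := hs
        linarith [(hsub hs').2]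
      · exact hright t ht.1 h
  · obtain ⟨a', ha0, hab, hI⟩ := Flow.exists_Ioo_of_eventually hb hend
    have F' := F.mono ha0 (le_refl b)
    set s := (a' + b) / 2
    have hs : s ∈ Ioo a' b := ⟨by simp only [s]; linarith, by simp only [s]; linarith⟩
    have hs0 : s ∈ Ioo 0 b := ⟨ha0.trans_lt hs.1, hs.2⟩
    have hline : ∀ t ∈ Ioo a' b, q t = q s + (t - s) • u s := by
      intro t ht
      obtain ⟨h1, h2, h3, h4⟩ := F'.straight (fun t ht => (hI t ht).2.2) hs ht
      rw [h1] at h3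
      rw [h2] at h4
      refine sub_left_injective (b := tip A) (C.B.ext ?_ ?_)
      · change C.x (q t) = C.x (q s + (t - s) • u s)
        rw [x_add_smul]; linarith
      · change C.y (q t) = C.y (q s + (t - s) • u s)
        rw [y_add_smul]; linarith
    set p := q s + (b - s) • u s
    have hqp : Tendsto q (𝓝[<] b) (𝓝 p) := by
      have h1 : Tendsto (fun t : ℝ => q s + (t - s) • u s) (𝓝[<] b) (𝓝 p) :=
        ((by fun_prop : Continuous fun t : ℝ => q s + (t - s) • u s).tendsto b).mono_left
          nhdsWithin_le_nhds
      refine h1.congr' ?_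
      filter_upwards [Ioo_mem_nhdsLT hab] with t ht using (hline t ht).symm
    have hxp : C.x p = X := tendsto_nhds_unique ((C.continuous_x.tendsto p).comp hqp) hX
    have hyp : C.y p = Y := tendsto_nhds_unique ((C.continuous_y.tendsto p).comp hqp) hY
    have hpV : p ∈ C.V := by
      refine (hε (Metric.isClosed_closedBall.mem_of_tendsto hqp ?_)).1
      filter_upwards [Ioo_mem_nhdsLT hb] with t ht
      exact Metric.ball_subset_closedBall (hU t ht.1.le (EReal.coe_lt_coe_iff.2 ht.2))
    refine ⟨p, hpV, by rw [hxp]; exact hX0, by rw [hxp, hyp]; exact hfX,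
      by rw [hxp, hyp]; exact hgX, u s, hun s hs0, ?_⟩
    filter_upwards [eventually_nhdsGT_zero_lt (show 0 < b - a' by linarith)] with h hh
    have hmem : b - h ∈ Ioo a' b := ⟨by linarith [hh.2], by linarith [hh.1]⟩
    refine ⟨?_, hI _ hmem⟩
    rw [hline _ hmem]
    simp only [p]
    module

end Chart

/-! ### Continuation of a trajectory by one more reflection -/

lemma eventually_pos_of_second_deriv {φ φ' : ℝ → ℝ} {d : ℝ}
    (h1 : ∀ᶠ z in 𝓝 (0 : ℝ), HasDerivAt φ (φ' z) z) (h2 : HasDerivAt φ' d 0) (hd : 0 < d)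
    (h00 : φ 0 = 0) (h0 : 0 ≤ φ' 0) : ∀ᶠ h in 𝓝[>] (0 : ℝ), 0 < φ h := by
  obtain ⟨ρ, hρ, hall⟩ := Metric.eventually_nhds_iff.1 h1
  obtain ⟨ε, hε, hsub⟩ := mem_nhdsGT_iff_exists_Ioo_subset.1
    (eventually_lt_of_hasDerivAt_pos h2 hd).1
  filter_upwards [eventually_nhdsGT_zero_lt hε, eventually_nhdsGT_zero_lt hρ] with h hh hh'
  have hder : ∀ z ∈ Icc 0 h, HasDerivAt φ (φ' z) z := fun z hz => hall (by
    rw [Real.dist_eq, sub_zero, abs_of_nonneg hz.1]; linarith [hz.2, hh'.2])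
  have hmono : StrictMonoOn φ (Icc 0 h) := by
    refine strictMonoOn_of_deriv_pos (convex_Icc _ _)
      (fun z hz => (hder z hz).continuousAt.continuousWithinAt) ?_
    rw [interior_Icc]
    intro z hz
    rw [(hder z (Ioo_subset_Icc_self hz)).deriv]
    exact h0.trans_lt (hsub ⟨hz.1, hz.2.trans hh.2⟩)
  have := hmono (left_mem_Icc.2 hh.1.le) (right_mem_Icc.2 hh.1.le) hh.1
  rwa [h00] at this

/-- A unit-speed motion that starts on the graph of a strictly convex function and does not point
strictly above it gets strictly below the graph. -/
lemma eventually_lt_graph {F F1 F2 : ℝ → ℝ} {r x v₁ v₂ : ℝ}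
    (hF : ∀ z, 0 < z → z < r → HasDerivAt F (F1 z) z)
    (hF1 : ∀ z, 0 < z → z < r → HasDerivAt F1 (F2 z) z) (hx0 : 0 < x) (hxr : x < r)
    (hF2 : 0 < F2 x) (hv : v₁ ^ 2 + v₂ ^ 2 = 1) (hle : v₂ ≤ F1 x * v₁) :
    ∀ᶠ h in 𝓝[>] (0 : ℝ), F x + h * v₂ < F (x + h * v₁) := by
  have hd1 := (HasDerivAt.along_line (hF x hx0 hxr) v₁).sub (hasDerivAt_line (F x) v₂)
  rcases hle.lt_or_eq with hlt | heq
  · filter_upwards [(eventually_lt_of_hasDerivAt_pos hd1 (by linarith)).1] with h hh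
    simp only [Pi.sub_apply, zero_mul, add_zero, sub_self] at hh
    linarith
  · have hv1 : v₁ ≠ 0 := by
      rintro rfl
      rw [mul_zero] at heq
      rw [heq] at hv
      norm_num at hv
    have hline : Tendsto (fun h : ℝ => x + h * v₁) (𝓝 0) (𝓝 x) := by
      have := (hasDerivAt_line x v₁).continuousAt.tendsto
      simpa using this
    have hnear : ∀ᶠ z in 𝓝 (0 : ℝ), HasDerivAt (fun h => F (x + h * v₁) - (F x + h * v₂))
        (F1 (x + z * v₁) * v₁ - v₂) z := by
      filter_upwards [hline.eventually (Ioo_mem_nhds hx0 hxr)] with z hz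
      have e1 : ∀ c v : ℝ, HasDerivAt (fun h : ℝ => c + h * v) v z := fun c v => by
        simpa using ((hasDerivAt_id z).mul_const v).const_add c
      exact ((hF _ hz.1 hz.2).comp z (e1 x v₁)).sub (e1 (F x) v₂)
    have hd2 := ((HasDerivAt.along_line (hF1 x hx0 hxr) v₁).mul_const v₁).sub_const v₂
    filter_upwards [eventually_pos_of_second_deriv hnear hd2
      (by have : 0 < v₁ ^ 2 := by positivity
          nlinarith) (by simp) (by simp [heq])] with h hh
    linarith

lemma tendsto_line (p u : Plane) : Tendsto (fun h : ℝ => p + h • u) (𝓝[>] 0) (𝓝 p) := by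
  have : Tendsto (fun h : ℝ => p + h • u) (𝓝 0) (𝓝 (p + (0 : ℝ) • u)) :=
    (by fun_prop : Continuous fun h : ℝ => p + h • u).tendsto 0
  rw [zero_smul, add_zero] at this
  exact this.mono_left nhdsWithin_le_nhds

namespace Chart

variable {A : Fin 2 → Arc} {Q : Set Plane} (C : Chart A Q)

lemma norm_eq_one {v : Plane} (h : C.B.X v ^ 2 + C.B.Y v ^ 2 = 1) : ‖v‖ = 1 := by
  rw [← C.B.norm_sq_eq_coords] at h
  exact (pow_eq_one_iff_of_nonneg (norm_nonneg v) two_ne_zero).1 h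

/-- A particle that arrives at a point of the horn other than the tip can be reflected. -/
lemma exists_continuation {p w : Plane} (hp : p ∈ C.V) (h0 : 0 < C.x p)
    (hf : C.P.f (C.x p) ≤ C.y p) (hg : C.y p ≤ C.P.g (C.x p)) (hw : ‖w‖ = 1)
    (hin : ∀ᶠ h in 𝓝[>] (0 : ℝ), p - h • w ∈ C.interiorHorn) :
    ∃ u : Plane, ‖u‖ = 1 ∧ VelocityRule A Q p w u ∧
      ∀ᶠ h in 𝓝[>] (0 : ℝ), p + h • u ∈ C.interiorHorn := by
  have hr := C.X_lt p hp
  have hw' := C.unit_coords hw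
  have hVline : ∀ u : Plane, ∀ᶠ h in 𝓝[>] (0 : ℝ), p + h • u ∈ C.V ∧ 0 < C.x (p + h • u) :=
    fun u => (tendsto_line p u).eventually
      ((C.isOpen.eventually_mem hp).and (C.eventually_x_pos h0))
  have hnorm : ∀ (u : Plane) (s j : ℝ), C.B.X u = C.B.X w - j * s → C.B.Y u = C.B.Y w + j →
      j * (1 + s ^ 2) = -2 * (C.B.Y w - s * C.B.X w) → ‖u‖ = 1 := by
    intro u s j e1 e2 e3
    apply C.norm_eq_one
    rw [e1, e2]
    linear_combination hw' + j * e3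
  rcases hf.eq_or_lt with hlo | hlo
  · obtain ⟨s, hs, hps⟩ := C.lo_mem p hp h0 hlo.symm
    set u := w - (2 * inner ℝ w (rot ((A C.lo).tangent s))) • rot ((A C.lo).tangent s) with hu
    obtain ⟨j, e1, e2, e3⟩ := C.reflect_lo hp hs hps.symm hu
    -- A tangential arrival at the lower arc is impossible: traced backwards, a tangent line leaves
    -- the region above a strictly convex graph. Hence the reflected particle moves strictly
    -- upwards.
    have hneg : C.B.Y w - C.P.f1 (C.x p) * C.B.X w < 0 := by
      by_contra hcon
      have := eventually_lt_graph (v₁ := -C.B.X w) (v₂ := -C.B.Y w) C.P.hf C.P.hf1 h0 hr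
        (C.P.c_pos.trans_le (C.P.f2_ge _ h0 hr)) (by linarith) (by linarith)
      obtain ⟨z, h1, h2⟩ := (this.and hin).exists
      have h3 := h2.2.2.1
      rw [x_sub_smul, y_sub_smul, ← hlo] at h3
      simp only [mul_neg, ← sub_eq_add_neg] at h1
      linarith
    have hpos : 0 < C.B.Y u - C.P.f1 (C.x p) * C.B.X u := by
      rw [e1, e2]; linarith
    refine ⟨u, hnorm u _ j e1 e2 e3, ⟨C.ne_tip_of_x_pos h0, fun _ hc => ?_, ?_⟩, ?_⟩
    · exact absurd ⟨s, hs, hps⟩ (hc C.lo)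
    · intro i s' hs' hps'
      rcases C.lo_or_hi i with rfl | rfl
      · rw [(A C.lo).injOn (Ioc_subset_Icc_self hs') (Ioc_subset_Icc_self hs)
          (hps'.symm.trans hps.symm)]
      · have h1 := (C.hi_coords p hp s' hs' hps').1
        have h2 := C.P.f_lt_g _ h0 hr
        exact absurd (hlo.trans h1) h2.ne
    · have hd := (hasDerivAt_line (C.y p) (C.B.Y u)).sub
        (HasDerivAt.along_line (C.P.hf _ h0 hr) (C.B.X u))
      have hlt : C.y p < C.P.g (C.x p) := by
        have := C.P.f_lt_g _ h0 hr
        exact hlo.symm.trans_lt this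
      filter_upwards [hVline u, (eventually_lt_of_hasDerivAt_pos hd hpos).1,
        (tendsto_line p u).eventually (C.eventually_lt_g hp h0 hlt)] with h h1 h2 h3
      refine ⟨h1.1, h1.2, ?_, h3⟩
      rw [x_add_smul, y_add_smul]
      simp only [Pi.sub_apply, zero_mul, add_zero, hlo, sub_self] at h2
      linarith
  rcases hg.eq_or_lt with hhi | hhi
  · obtain ⟨s, hs, hps⟩ := C.hi_mem p hp h0 hhi
    set u := w - (2 * inner ℝ w (rot ((A C.hi).tangent s))) • rot ((A C.hi).tangent s) with hu
    obtain ⟨j, e1, e2, e3⟩ := C.reflect_hi hp hs hps.symm hu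
    -- Grazing is possible at the upper arc, so only a weak inequality holds; a tangent line of the
    -- strictly convex graph falls below it at once, so the particle still re-enters the interior.
    have hnn : 0 ≤ C.B.Y w - C.P.g1 (C.x p) * C.B.X w := by
      by_contra hcon
      have hd := (hasDerivAt_line (C.y p) (-C.B.Y w)).sub
        (HasDerivAt.along_line (C.P.hg _ h0 hr) (-C.B.X w))
      obtain ⟨z, h1, h2⟩ :=
        ((eventually_lt_of_hasDerivAt_pos hd (by linarith)).1.and hin).exists
      have h3 := h2.2.2.2
      rw [x_sub_smul, y_sub_smul] at h3
      simp only [Pi.sub_apply, mul_neg, zero_mul, hhi, sub_zero, sub_self,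
        ← sub_eq_add_neg] at h1
      linarith
    have hle : C.B.Y u ≤ C.P.g1 (C.x p) * C.B.X u := by
      rw [e1, e2]; linarith
    have hunit := hnorm u _ j e1 e2 e3
    refine ⟨u, hunit, ⟨C.ne_tip_of_x_pos h0, fun _ hc => ?_, ?_⟩, ?_⟩
    · exact absurd ⟨s, hs, hps⟩ (hc C.hi)
    · intro i s' hs' hps'
      rcases C.lo_or_hi i with rfl | rfl
      · have h1 := (C.lo_coords p hp s' hs' hps').1
        exact absurd h1 hlo.ne'
      · rw [(A C.hi).injOn (Ioc_subset_Icc_self hs') (Ioc_subset_Icc_self hs)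
          (hps'.symm.trans hps.symm)]
    · filter_upwards [hVline u, (tendsto_line p u).eventually (C.eventually_f_lt hp h0 hlo),
        eventually_lt_graph C.P.hg C.P.hg1 h0 hr (C.P.g2_pos _ h0 hr)
          (C.unit_coords hunit) hle] with h h1 h2 h3
      refine ⟨h1.1, h1.2, h2, ?_⟩
      rw [x_add_smul, y_add_smul, hhi]
      exact h3
  · have hI : p ∈ C.interiorHorn := ⟨hp, h0, hlo, hhi⟩
    exact ⟨w, hw, C.velocityRule_of_interiorHorn hI,
      (tendsto_line p w).eventually (C.interiorHorn_isOpen.eventually_mem hI)⟩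

/-- A trajectory that arrives at a point of the horn other than the tip can be continued. -/
lemma exists_extension {q : ℝ → Plane} {b : ℝ} (hb : 0 < b) (hq : IsTrajectory A Q b q)
    {p w : Plane} (hp : p ∈ C.V) (h0 : 0 < C.x p) (hf : C.P.f (C.x p) ≤ C.y p)
    (hg : C.y p ≤ C.P.g (C.x p)) (hw : ‖w‖ = 1)
    (hin : ∀ᶠ h in 𝓝[>] (0 : ℝ), q (b - h) = p - h • w ∧ q (b - h) ∈ C.interiorHorn) :
    ∃ (T' : EReal) (q' : ℝ → Plane), IsTrajectory A Q T' q' ∧ (b : EReal) < T' ∧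
      ∀ t : ℝ, t < b → q' t = q t := by
  obtain ⟨u, hu, hrule, hout⟩ := C.exists_continuation hp h0 hf hg hw
    (hin.mono fun h hh => hh.1 ▸ hh.2)
  obtain ⟨ε, hε, hsub⟩ := mem_nhdsGT_iff_exists_Ioo_subset.1 hout
  have hε : 0 < ε := hε
  set q' : ℝ → Plane := fun t => if t < b then q t else p + (t - b) • u
  have hlt : ∀ t, t < b → q' t = q t := fun t ht => if_pos ht
  have hge : ∀ t, b ≤ t → q' t = p + (t - b) • u := fun t ht => if_neg (not_lt.2 ht)
  have hOut : ∀ t v, t < b → Outgoing q t v → Outgoing q' t v := by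
    intro t v ht h
    filter_upwards [h, eventually_nhdsGT_zero_lt (show 0 < b - t by linarith)] with z h1 h2
    rw [hlt _ (by linarith [h2.2]), hlt _ ht, h1]
  have hIn : ∀ t v, t < b → Incoming q t v → Incoming q' t v := by
    intro t v ht h
    filter_upwards [h, eventually_nhdsGT_zero_lt one_pos] with z h1 h2
    rw [hlt _ (by linarith [h2.1]), hlt _ ht, h1]
  have hOut' : ∀ t, b ≤ t → Outgoing q' t u := by
    intro t ht
    filter_upwards [eventually_nhdsGT_zero_lt one_pos] with z h2
    rw [hge _ (by linarith [h2.1]), hge _ ht]; module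
  have hIn' : ∀ t, b < t → Incoming q' t u := by
    intro t ht
    filter_upwards [eventually_nhdsGT_zero_lt (show 0 < t - b by linarith)] with z h2
    rw [hge _ (by linarith [h2.2]), hge _ ht.le]; module
  have hqb : q' b = p := by rw [hge b le_rfl, sub_self, zero_smul, add_zero]
  have hInb : Incoming q' b w := by
    filter_upwards [hin, eventually_nhdsGT_zero_lt one_pos] with z h1 h2
    rw [hlt _ (by linarith [h2.1]), hqb, h1.1]
  refine ⟨((b + ε : ℝ) : EReal), q', ⟨?_, ?_, ?_, ?_⟩, EReal.coe_lt_coe_iff.2 (by linarith), hlt⟩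
  · exact_mod_cast (by linarith : (0 : ℝ) < b + ε)
  · intro t ht0 htT
    have htT := EReal.coe_lt_coe_iff.1 htT
    rcases lt_trichotomy t b with h | h | h
    · rw [hlt t h]; exact hq.mem t ht0 (EReal.coe_lt_coe_iff.2 h)
    · rw [h, hqb]; exact C.imp_mem p hp h0 hf hg
    · rw [hge t h.le]
      exact C.mem_of_interiorHorn (hsub ⟨by linarith, by linarith⟩)
  · obtain ⟨u₀, h1, h2⟩ := hq.start
    exact ⟨u₀, h1, hOut 0 u₀ hb h2⟩
  · intro t ht0 htT
    have htT := EReal.coe_lt_coe_iff.1 htT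
    rcases lt_trichotomy t b with h | h | h
    · obtain ⟨w', u', h1, h2, h3, h4, h5⟩ := hq.motion t ht0 (EReal.coe_lt_coe_iff.2 h)
      exact ⟨w', u', h1, h2, hIn t w' h h3, hOut t u' h h4, by rwa [hlt t h]⟩
    · subst h
      exact ⟨w, u, hw, hu, hInb, hOut' t le_rfl, by rwa [hqb]⟩
    · refine ⟨u, u, hu, hu, hIn' t h, hOut' t h.le, ?_⟩
      rw [hge t h.le]
      exact C.velocityRule_of_interiorHorn (hsub ⟨by linarith, by linarith⟩)

/-! ### Exit from the neighborhood and gain of angular momentum -/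

/-- A trajectory that never left the ball could be extended. Otherwise its restriction to the time
before the first exit stays in the ball and has finitely many collisions. -/
lemma exists_exit {T : EReal} {q : ℝ → Plane} (hq : IsMaximalTrajectory A Q T q) {ε : ℝ}
    (hε : Metric.closedBall (tip A) ε ⊆ C.V ∩ {p | C.x p ≤ C.P.r / 2})
    (h0 : q 0 ∈ Metric.ball (tip A) ε) :
    ∃ t : ℝ, 0 ≤ t ∧ (t : EReal) < T ∧ q t ∉ Metric.ball (tip A) ε ∧
      (collisionTimes A (t : EReal) q).Finite := by
  have hT := hq.isTrajectory
  by_cases hstay : ∀ t : ℝ, 0 ≤ t → (t : EReal) < T → q t ∈ Metric.ball (tip A) ε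
  · exfalso
    obtain ⟨-, b, hb, rfl, p, hp, hx, hf, hg, w, hw, hin⟩ := C.finite_collisions hT hε hstay
    obtain ⟨T', q', h1, h2, h3⟩ := C.exists_extension hb hT hp hx hf hg hw hin
    exact h2.ne' (hq.maximal T' q' h1 h2.le fun t _ ht => h3 t (EReal.coe_lt_coe_iff.1 ht))
  · push Not at hstay
    obtain ⟨t₁, ht₁0, ht₁T, ht₁⟩ := hstay
    set S : Set ℝ := {t | 0 ≤ t ∧ q t ∉ Metric.ball (tip A) ε}
    have hSne : S.Nonempty := ⟨t₁, ht₁0, ht₁⟩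
    have hSb : BddBelow S := ⟨0, fun t ht => ht.1⟩
    set t := sInf S
    have ht0 : 0 ≤ t := le_csInf hSne fun t ht => ht.1
    have htle : t ≤ t₁ := csInf_le hSb ⟨ht₁0, ht₁⟩
    have htT : (t : EReal) < T := (EReal.coe_le_coe_iff.2 htle).trans_lt ht₁T
    have hbefore : ∀ s : ℝ, 0 ≤ s → s < t → q s ∈ Metric.ball (tip A) ε := by
      intro s hs hst
      by_contra hcon
      exact absurd (csInf_le hSb ⟨hs, hcon⟩) (not_le.2 hst)
    have hout : ∃ u, Outgoing q t u := by
      rcases ht0.eq_or_lt with h | h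
      · obtain ⟨u, -, hu⟩ := hT.start
        exact ⟨u, h ▸ hu⟩
      · obtain ⟨w, u, -, -, -, hu, -⟩ := hT.motion t h htT
        exact ⟨u, hu⟩
    obtain ⟨u, hu⟩ := hout
    -- The infimum is attained: the ball is open and the motion is continuous from the right.
    have htS : q t ∉ Metric.ball (tip A) ε := by
      intro hcon
      have hev : ∀ᶠ h in 𝓝[>] (0 : ℝ), q (t + h) ∈ Metric.ball (tip A) ε := by
        filter_upwards [hu, (tendsto_line (q t) u).eventually
          (Metric.isOpen_ball.eventually_mem hcon)] with h h1 h2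
        rwa [h1]
      obtain ⟨δ, hδ, hsub⟩ := mem_nhdsGT_iff_exists_Ioo_subset.1 hev
      have hδ : 0 < δ := hδ
      obtain ⟨s, hs, hst⟩ := exists_lt_of_csInf_lt hSne (show sInf S < t + δ by
        change t < t + δ; linarith)
      have hts : t ≤ s := csInf_le hSb hs
      rcases hts.eq_or_lt with h | h
      · exact hs.2 (h ▸ hcon)
      · have := hsub (show s - t ∈ Ioo 0 δ from ⟨by linarith, by linarith⟩)
        simp only [mem_ofPred_eq, add_sub_cancel] at this
        exact hs.2 this
    have htpos : 0 < t := by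
      refine lt_of_le_of_ne ht0 fun h => htS ?_
      rw [← h]; exact h0
    refine ⟨t, ht0, htT, htS, (C.finite_collisions (T := t) (q := q) ⟨?_, ?_, hT.start, ?_⟩ hε
      fun s hs hst => hbefore s hs (EReal.coe_lt_coe_iff.1 hst)).1⟩
    · exact_mod_cast htpos
    · exact fun s hs hst => hT.mem s hs (hst.trans htT)
    · exact fun s hs hst => hT.motion s hs (hst.trans htT)

lemma angularMomentum_eq (p v : Plane) :
    angularMomentum A p v = angMom C.P.R (C.x p) (C.y p) (C.B.X v) (C.B.Y v) := by
  have h : p - middleCenter A = (p - tip A) - (middleCenter A - tip A) := by abel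
  rw [angularMomentum, ← C.σ_eq, C.B.cross_eq_coords, h, C.B.X_sub, C.B.Y_sub, C.X_center,
    C.Y_center]
  unfold angMom x y
  ring

/-- The outward normal at a point of slope `s` has coordinates `k (-s, 1)`. -/
lemma normal_coords {n τ : Plane} {s : ℝ} (hn : ‖n‖ = 1) (hτ : inner ℝ n τ = 0)
    (hpos : 0 < C.B.X τ) (hs : C.B.Y τ = C.B.X τ * s) :
    C.B.X n = -(C.B.Y n * s) ∧ C.B.Y n ^ 2 * (1 + s ^ 2) = 1 := by
  have h1 : C.B.X n = -(C.B.Y n * s) := by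
    rw [C.B.inner_eq_coords, hs] at hτ
    have : C.B.X τ * (C.B.X n + C.B.Y n * s) = 0 := by linarith
    linarith [(mul_eq_zero.1 this).resolve_left hpos.ne']
  refine ⟨h1, ?_⟩
  have := C.unit_coords hn
  rw [h1] at this
  linarith

/-- The quantitative increase of the angular momentum in a reflection in an arc of slope `s`
with outward normal `n`. -/
lemma angMom_gain {R c K x y s l j α w₁ w₂ n : ℝ} (hc : 0 < c) (hx : 0 < x)
    (hsK : |s| ≤ K) (hl : l ≤ 2 * x) (hn : n ^ 2 * (1 + s ^ 2) = 1) (hα : 0 < α)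
    (hwn : α = n * (w₂ - s * w₁)) (hj : j * (1 + s ^ 2) = -2 * (w₂ - s * w₁))
    (htorque : c * x * |n| ≤ -n * (x - (R - y) * s)) :
    c / (2 * (1 + K)) * l * α <
      angMom R x y (w₁ - j * s) (w₂ + j) - angMom R x y w₁ w₂ := by
  have hK : 0 ≤ K := (abs_nonneg s).trans hsK
  -- The impulse is `-2 α` times the normal `n (-s, 1)`, so the gain is `2 α` times a torque of size
  -- at least `c x |n|`. The bounds `|n| ≥ 1 / (1 + K)` and `l ≤ 2 x` give the constant, and the
  -- remaining factor 2 gives strictness.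
  have hjn : j = -2 * n * α := by
    have h1 : 1 + s ^ 2 ≠ 0 := by positivity
    apply mul_right_cancel₀ h1
    rw [hj, hwn]
    linear_combination (2 * (w₂ - s * w₁)) * hn
  have hgain : angMom R x y (w₁ - j * s) (w₂ + j) - angMom R x y w₁ w₂ =
      2 * α * (-n * (x - (R - y) * s)) := by
    rw [hjn]; unfold angMom; ring
  have hnK : 1 ≤ |n| * (1 + K) := by
    have h2 : 1 + s ^ 2 ≤ (1 + K) ^ 2 := by
      have : s ^ 2 ≤ K ^ 2 := by rw [← sq_abs s]; gcongr
      nlinarith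
    have h3 : 1 ≤ (|n| * (1 + K)) ^ 2 := by
      calc (1 : ℝ) = n ^ 2 * (1 + s ^ 2) := hn.symm
        _ ≤ n ^ 2 * (1 + K) ^ 2 := by gcongr
        _ = (|n| * (1 + K)) ^ 2 := by rw [mul_pow, sq_abs]
    exact (one_le_sq_iff₀ (by positivity)).1 h3
  rw [hgain]
  have h1K : 0 < 1 + K := by linarith
  calc c / (2 * (1 + K)) * l * α ≤ c / (2 * (1 + K)) * (2 * x) * α := by gcongr
    _ = α * (c * x) / (1 + K) := by field_simp
    _ ≤ α * (c * x) * |n| := by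
      rw [div_le_iff₀ h1K]
      have : 0 < α * (c * x) := by positivity
      nlinarith
    _ < 2 * α * (c * x * |n|) := by
      have hn0 : 0 < |n| := by
        by_contra hneg
        nlinarith
      have : 0 < α * (c * x * |n|) := by positivity
      linarith
    _ ≤ _ := by gcongr

lemma angularMomentum_gain {T : EReal} {q : ℝ → Plane} (hq : IsTrajectory A Q T q) {t : ℝ}
    (ht0 : 0 < t) (htT : (t : EReal) < T) (hV : q t ∈ C.V) {i : Fin 2} {s : ℝ}
    (hs : s ∈ Ioc 0 (A i).length) (hps : q t = (A i).toFun s) {w u n : Plane}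
    (hw : Incoming q t w) (hu : Outgoing q t u) (hn : IsOutwardNormal A Q i s n)
    (hwn : 0 < inner ℝ w n) :
    C.P.c / (2 * (1 + C.P.K)) * s * inner ℝ w n <
      angularMomentum A (q t) u - angularMomentum A (q t) w := by
  obtain ⟨w', u', -, -, hw', hu', hrule⟩ := hq.motion t ht0 htT
  obtain rfl := hw.unique hw'
  obtain rfl := hu.unique hu'
  have hrefl := hrule.reflect i s hs hps
  obtain ⟨hx, hl, hτ⟩ := C.arc_coords _ hV i s hs hps
  have hr := C.X_lt _ hV
  have hr1 : C.x (q t) ≤ 1 := hr.le.trans C.P.r_le_one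
  have hK := C.P.K_pos
  have hKx : C.P.K * C.x (q t) ≤ C.P.K := by nlinarith
  change 0 < C.x (q t) at hx
  change s ≤ 2 * C.x (q t) at hl
  change C.x (q t) < C.P.r at hr
  have hout := hn.outward
  rw [← hps] at hout
  have hVline : ∀ᶠ h in 𝓝[>] (0 : ℝ), q t + h • n ∈ C.V ∧ 0 < C.x (q t + h • n) :=
    (tendsto_line (q t) n).eventually
      ((C.isOpen.eventually_mem hV).and (C.eventually_x_pos hx))
  have hfg := C.P.f_lt_g _ hx hr
  have hinner : ∀ σ : ℝ, C.B.X n = -(C.B.Y n * σ) →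
      inner ℝ w n = C.B.Y n * (C.B.Y w - σ * C.B.X w) := by
    intro σ h; rw [C.B.inner_eq_coords, h]; ring
  rw [C.angularMomentum_eq, C.angularMomentum_eq]
  rcases C.lo_or_hi i with rfl | rfl
  · obtain ⟨hy, hslope⟩ := C.lo_coords _ hV s hs hps
    change C.y (q t) = C.P.f (C.x (q t)) at hy
    change C.B.Y _ = C.B.X _ * C.P.f1 (C.x (q t)) at hslope
    obtain ⟨hn1, hn2⟩ := C.normal_coords hn.unit hn.normal hτ hslope
    obtain ⟨j, e1, e2, e3⟩ := C.reflect_lo hV hs hps hrefl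
    have hf0 := C.P.f1_nonneg _ hx hr
    have hf1 := C.P.f1_le _ hx hr
    -- With the opposite sign, the points just beyond the arc in direction `n` would lie in the
    -- horn, hence in `Q`.
    have hneg : C.B.Y n < 0 := by
      by_contra hcon
      have hpos : 0 < C.B.Y n := lt_of_le_of_ne (not_lt.1 hcon) fun h => by
        rw [← h] at hn2; norm_num at hn2
      have hd := (hasDerivAt_line (C.y (q t)) (C.B.Y n)).sub
        (HasDerivAt.along_line (C.P.hf _ hx hr) (C.B.X n))
      have hdpos : 0 < C.B.Y n - C.P.f1 (C.x (q t)) * C.B.X n := by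
        rw [hn1]; nlinarith [mul_nonneg hpos.le (sq_nonneg (C.P.f1 (C.x (q t))))]
      obtain ⟨h, ⟨⟨h1, h2⟩, h3⟩, h4, h5⟩ := ((hVline.and
        (eventually_lt_of_hasDerivAt_pos hd hdpos).1).and (((tendsto_line (q t) n).eventually
        (C.eventually_lt_g hV hx (by rw [hy]; exact hfg))).and hout)).exists
      refine h5 (C.imp_mem _ h1 h2 ?_ h4.le)
      change C.P.f (C.x (q t + h • n)) ≤ C.y (q t + h • n)
      rw [x_add_smul, y_add_smul]
      simp only [Pi.sub_apply, zero_mul, add_zero, hy, sub_self] at h3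
      rw [hy]; linarith
    rw [e1, e2]
    refine angMom_gain C.P.c_pos hx (K := C.P.K) (by rw [abs_of_nonneg hf0]; linarith) hl hn2
      hwn (hinner _ hn1) e3 ?_
    have ht := C.P.lo_torque _ hx hr
    rw [abs_of_neg hneg, hy]
    nlinarith
  · obtain ⟨hy, hslope⟩ := C.hi_coords _ hV s hs hps
    change C.y (q t) = C.P.g (C.x (q t)) at hy
    change C.B.Y _ = C.B.X _ * C.P.g1 (C.x (q t)) at hslope
    obtain ⟨hn1, hn2⟩ := C.normal_coords hn.unit hn.normal hτ hslope
    obtain ⟨j, e1, e2, e3⟩ := C.reflect_hi hV hs hps hrefl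
    have hg0 := C.P.g1_nonneg _ hx hr
    have hg1 := C.P.g1_le _ hx hr
    have hpos : 0 < C.B.Y n := by
      by_contra hcon
      have hneg : C.B.Y n < 0 := lt_of_le_of_ne (not_lt.1 hcon) fun h => by
        rw [h] at hn2; norm_num at hn2
      have hd := (HasDerivAt.along_line (C.P.hg _ hx hr) (C.B.X n)).sub
        (hasDerivAt_line (C.y (q t)) (C.B.Y n))
      have hdpos : 0 < C.P.g1 (C.x (q t)) * C.B.X n - C.B.Y n := by
        rw [hn1]; nlinarith [mul_nonneg (neg_nonneg.2 hneg.le) (sq_nonneg (C.P.g1 (C.x (q t))))]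
      obtain ⟨h, ⟨⟨h1, h2⟩, h3⟩, h4, h5⟩ := ((hVline.and
        (eventually_lt_of_hasDerivAt_pos hd hdpos).1).and (((tendsto_line (q t) n).eventually
        (C.eventually_f_lt hV hx (by rw [hy]; exact hfg))).and hout)).exists
      refine h5 (C.imp_mem _ h1 h2 h4.le ?_)
      change C.y (q t + h • n) ≤ C.P.g (C.x (q t + h • n))
      rw [x_add_smul, y_add_smul]
      simp only [Pi.sub_apply, zero_mul, add_zero, hy, sub_self] at h3
      rw [hy]; linarith
    rw [e1, e2]
    refine angMom_gain C.P.c_pos hx (K := C.P.K) (by rw [abs_of_nonneg hg0]; linarith) hl hn2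
      hwn (hinner _ hn1) e3 ?_
    have ht := C.P.hi_torque _ hx hr
    rw [abs_of_pos hpos, hy]
    nlinarith

end Chart

end HornBilliard

end

theorem theoremA (A : Fin 2 → HornBilliard.Arc) (hA : HornBilliard.IsHorn A)
    (Q : Set HornBilliard.Plane) (hQ : HornBilliard.IsHornTable A Q) :
    ∃ U ∈ 𝓝 (HornBilliard.tip A),
      -- a trajectory makes only finitely many collisions as long as it stays in `U`
      (∀ (T : EReal) (q : ℝ → HornBilliard.Plane), HornBilliard.IsTrajectory A Q T q →
        (∀ t : ℝ, 0 ≤ t → (t : EReal) < T → q t ∈ U) →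
        (HornBilliard.collisionTimes A T q).Finite) ∧
      -- every trajectory that starts in `U` leaves `U`, after finitely many collisions
      (∀ (T : EReal) (q : ℝ → HornBilliard.Plane), HornBilliard.IsMaximalTrajectory A Q T q →
        q 0 ∈ U →
        ∃ t : ℝ, 0 ≤ t ∧ (t : EReal) < T ∧ q t ∉ U ∧
          (HornBilliard.collisionTimes A (t : EReal) q).Finite) ∧
      -- every non-grazing collision in `U` increases the angular momentum
      (∃ c : ℝ, 0 < c ∧
        ∀ (T : EReal) (q : ℝ → HornBilliard.Plane), HornBilliard.IsTrajectory A Q T q →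
        ∀ t : ℝ, 0 < t → (t : EReal) < T → q t ∈ U →
        ∀ (i : Fin 2), ∀ s ∈ Ioc 0 (A i).length, q t = (A i).toFun s →
        ∀ w u n : HornBilliard.Plane, HornBilliard.Incoming q t w →
          HornBilliard.Outgoing q t u → HornBilliard.IsOutwardNormal A Q i s n →
          0 < inner ℝ w n →
          c * s * inner ℝ w n <
            HornBilliard.angularMomentum A (q t) u - HornBilliard.angularMomentum A (q t) w) := by
  obtain ⟨C⟩ := HornBilliard.exists_chart hA hQ
  -- The bound `r / 2` keeps limits of trajectories strictly inside the range of the profile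
  -- estimates; for the same reason a closed ball is fitted in, and its open ball serves as `U`.
  have hnhds : C.V ∩ {p | C.x p ≤ C.P.r / 2} ∈ 𝓝 (HornBilliard.tip A) := by
    refine inter_mem (C.isOpen.mem_nhds C.tip_mem) ?_
    have h0 : C.x (HornBilliard.tip A) = 0 := by
      simp [HornBilliard.Chart.x, HornBilliard.Frame.X]
    have hr : C.x (HornBilliard.tip A) < C.P.r / 2 := by
      rw [h0]; linarith [C.P.r_pos]
    exact (C.continuous_x.continuousAt.eventually (gt_mem_nhds hr)).mono fun p hp => hp.le
  obtain ⟨ε, hε, hsub⟩ := Metric.nhds_basis_closedBall.mem_iff.1 hnhds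
  have hc := C.P.c_pos
  have hK := C.P.K_pos
  refine ⟨Metric.ball (HornBilliard.tip A) ε, Metric.ball_mem_nhds _ hε,
    fun T q hq hU => (C.finite_collisions hq hsub hU).1,
    fun T q hq h0 => C.exists_exit hq hsub h0,
    C.P.c / (2 * (1 + C.P.K)), by positivity, ?_⟩
  intro T q hq t ht0 htT htU i s hs hps w u n hw hu hn hwn
  exact C.angularMomentum_gain hq ht0 htT (hsub (Metric.ball_subset_closedBall htU)).1 hs hps
    hw hu hn hwn
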